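/- Let $M$ be a smooth (Hausdorff) manifold of dimension $n\ge 2$ with a (not necessarily reversible) Finsler metric $F$, i.e. $F:TM\to[0,\infty)$ is continuous, smooth and positive outside the zero section, positively homogeneous of degree one on fibres, and $g_{ij}(x,y)=\frac12\frac{\partial^2F^2}{\partial y^i\partial y^j}(x,y)$ is positive definite for $y\neq0$; write $g^v$ for the resulting inner product on $T_pM$, $0\ne v\in T_pM$. A smooth curve $x(t)$ is a geodesic of $F$ if $\ddot x^k+2G^k(x,\dot x)=0$, where $G^k=\frac14 g^{kl}\left(2\frac{\partial g_{li}}{\partial x^j}-\frac{\partial g_{ij}}{\partial x^l}\right)\dot x^i\dot x^j$, and it is parametrized by arc length if $F(x,\dot x)=1$. Let $p\in M$ and $v,w\in T_pM$ with $F(v)=1$, $g^v(w,w)=1$, $g^v(v,w)=0$. For $\eta,\epsilon>0$ call a smooth chart of $M$, with inverse $\xi$, whose image contains $[-2\eta,2\eta]\times D^{n-1}(\epsilon)$ ($D^{n-1}(\epsilon)$ the open $\epsilon$-ball), adapted to $(v,w)$ if: $\xi(0)=p$; at $p$ one has $\partial_1=v$, $\partial_2$ and $w$ are linearly dependent, and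 $g_{ij}(0,(1,0,\dots,0))=\delta_{ij}$; every curve $t\mapsto\xi(t,x^2,\dots,x^n)$, $|t|\le2\eta$, $(x^2,\dots,x^n)\in D^{n-1}(\epsilon)$, is a geodesic parametrized by arc length; and $s\mapsto\xi(0,s,0,\dots,0)$, $|s|<\epsilon$, is a geodesic. (a) There is a chart which is adapted to $(v,w)$ for all sufficiently small $\eta,\epsilon>0$. (b) Let $\eta,\epsilon>0$ with $7\epsilon<\eta$, let $\xi$ be the inverse of an adapted chart, and put $\gamma(t)=\xi(t,0,\dots,0)$. Let $u_s(t)$, $|s|<\delta_0$, $t\in\mathbb R$, be smooth in $(s,t)$ with $u_0=0$, $u_s(t)=s$ for $|t|\le\eta+2\epsilon$ and $u_s(t)=0$ for $|t|>\eta+4\epsilon$. Let $U$ be an open neighbourhood of $\gamma([-\eta-4\epsilon,-\eta])\cup\gamma([\eta,\eta+4\epsilon])$. Then there are $\delta\in(0,\delta_0]$ and smooth functions $\phi_s:M\to\mathbb R$ such that $(s,x)\mapsto\phi_s(x)$ is smooth for $|s|<\delta$, $x\in M$, and - $\phi_0=0$, and the supports of all $\phi_s$, $|s|<\delta$, lie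 in one compact subset of $U$; - every neighbourhood of the zero function in $C^\infty(M)$ (topology of locally uniform convergence of all derivatives) contains $\phi_s$ for all sufficiently small $|s|$; - for $|s|<\delta$ the curve $\gamma_s(t)=\xi(t,u_s(t),0,\dots,0)$, $|t|\le2\eta$, lies in $\xi([-2\eta,2\eta]\times D^{n-1}(\epsilon))$ and is a geodesic parametrized by arc length of the conformally equivalent metric $\exp(\phi_s)F$. -/

import Mathlib

open Set Filter Topology
open scoped Manifold ContDiff UniformConvergence

noncomputable section

/-- The space `ℝⁿ` on which `n`-dimensional manifolds are modelled. -/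
abbrev Eucl (n : ℕ) : Type := EuclideanSpace ℝ (Fin n)

/-- The `i`-th standard basis vector of `ℝⁿ`. -/
abbrev stdVec {n : ℕ} (i : Fin n) : Eucl n := EuclideanSpace.single i 1

/-- For a function `f` on a real vector space, the symmetric bilinear form
`g_y(u, w) = 1/2 ∂²/∂s∂t f²(y + s u + t w)` at `s = t = 0`. -/
def fundTensor {V : Type*} [AddCommGroup V] [Module ℝ V] (f : V → ℝ) (y u w : V) : ℝ :=
  deriv (fun s : ℝ => deriv (fun t : ℝ => f (y + s • u + t • w) ^ 2) 0) 0 / 2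

section Finsler

variable {n : ℕ} {M : Type*} [TopologicalSpace M] [ChartedSpace (Eucl n) M]

/-- `F` is a (not necessarily reversible) Finsler metric on `M`. -/
structure IsFinslerMetric [IsManifold (𝓡 n) ∞ M] (F : ∀ x : M, TangentSpace (𝓡 n) x → ℝ) : Prop where
  continuous : Continuous fun q : TangentBundle (𝓡 n) M => F q.1 q.2
  smooth : ContMDiffOn (𝓡 n).tangent 𝓘(ℝ, ℝ) ∞
    (fun q : TangentBundle (𝓡 n) M => F q.1 q.2) {q | q.2 ≠ 0}
  pos : ∀ (x : M) (y : TangentSpace (𝓡 n) x), y ≠ 0 → 0 < F x y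
  homogeneous : ∀ (x : M) (y : TangentSpace (𝓡 n) x) (a : ℝ), 0 < a → F x (a • y) = a * F x y
  legendre : ∀ (x : M) (y u : TangentSpace (𝓡 n) x), y ≠ 0 → u ≠ 0 → 0 < fundTensor (F x) y u u

/-- The conformally equivalent metric `exp(φ) F`. -/
def conformalMetric (φ : M → ℝ) (F : ∀ x : M, TangentSpace (𝓡 n) x → ℝ) :
    ∀ x : M, TangentSpace (𝓡 n) x → ℝ :=
  fun x y => Real.exp (φ x) * F x y

/-- `F` in the coordinates given by the chart `e`: the value of `F` on `yⁱ ∂ᵢ` at the point with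
coordinates `x`. -/
def coordF (F : ∀ x : M, TangentSpace (𝓡 n) x → ℝ) (e : OpenPartialHomeomorph M (Eucl n))
    (x y : Eucl n) : ℝ :=
  F (e.symm x) (mfderiv (𝓡 n) (𝓡 n) e.symm x y)

/-- The metric coefficients `gᵢⱼ(x, y) = 1/2 ∂²F²/∂yⁱ∂yʲ` in the chart `e`. -/
def metricCoeff (F : ∀ x : M, TangentSpace (𝓡 n) x → ℝ) (e : OpenPartialHomeomorph M (Eucl n))
    (x y : Eucl n) : Matrix (Fin n) (Fin n) ℝ :=
  Matrix.of fun i j => fundTensor (coordF F e x) y (stdVec i) (stdVec j)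

/-- The partial derivative `∂gᵢⱼ/∂xᵏ (x, y)`. -/
def metricCoeffDeriv (F : ∀ x : M, TangentSpace (𝓡 n) x → ℝ)
    (e : OpenPartialHomeomorph M (Eucl n)) (k i j : Fin n) (x y : Eucl n) : ℝ :=
  deriv (fun t : ℝ => metricCoeff F e (x + t • stdVec k) y i j) 0

/-- The geodesic coefficients
`Gᵏ(x, y) = 1/4 gᵏˡ (2 ∂gₗᵢ/∂xʲ - ∂gᵢⱼ/∂xˡ) yⁱ yʲ` in the chart `e`. -/
def geodesicCoeff (F : ∀ x : M, TangentSpace (𝓡 n) x → ℝ)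
    (e : OpenPartialHomeomorph M (Eucl n)) (k : Fin n) (x y : Eucl n) : ℝ :=
  1 / 4 * ∑ l, (metricCoeff F e x y)⁻¹ k l * ∑ i, ∑ j,
    (2 * metricCoeffDeriv F e j l i x y - metricCoeffDeriv F e l i j x y) * y i * y j

/-- The smooth curve `c`, defined on the interval `I`, is a geodesic of `F`: in all local
coordinates, `ẍᵏ + 2 Gᵏ(x, ẋ) = 0`. -/
def IsGeodesicOn (F : ∀ x : M, TangentSpace (𝓡 n) x → ℝ) (c : ℝ → M) (I : Set ℝ) : Prop :=
  ContMDiffOn 𝓘(ℝ, ℝ) (𝓡 n) ∞ c I ∧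
  ∀ t ∈ I, ∀ e ∈ IsManifold.maximalAtlas (𝓡 n) ∞ M, c t ∈ e.source → ∀ k : Fin n,
    derivWithin (fun r => derivWithin (fun τ => e (c τ)) I r) I t k
      + 2 * geodesicCoeff F e k (e (c t)) (derivWithin (fun τ => e (c τ)) I t) = 0

/-- The curve `c` is parametrized by arc length on `I`: `F(c, ċ) = 1`. -/
def IsArcLengthOn (F : ∀ x : M, TangentSpace (𝓡 n) x → ℝ) (c : ℝ → M) (I : Set ℝ) : Prop :=
  ∀ t ∈ I, F (c t) (mfderivWithin 𝓘(ℝ, ℝ) (𝓡 n) c I t (1 : ℝ)) = 1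

/-- The `C^∞`-topology on the space of smooth functions: locally uniform convergence of all
derivatives in all charts. -/
@[reducible] def smoothTopology (n : ℕ) (M : Type*) [TopologicalSpace M] [ChartedSpace (Eucl n) M] :
    TopologicalSpace C^∞⟮𝓡 n, M; 𝓘(ℝ, ℝ), ℝ⟯ :=
  ⨅ (e : OpenPartialHomeomorph M (Eucl n)) (_ : e ∈ IsManifold.maximalAtlas (𝓡 n) ∞ M) (k : ℕ),
    TopologicalSpace.induced
      (fun f => UniformOnFun.ofFun {K : Set (Eucl n) | IsCompact K ∧ K ⊆ e.target}
        (iteratedFDeriv ℝ k (fun x => f (e.symm x))))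
      inferInstance

end Finsler

section Adapted

variable {m : ℕ} {M : Type*} [TopologicalSpace M] [ChartedSpace (Eucl (m + 2)) M]

/-- The box `[-2η, 2η] × D(ε)`, where `D(ε)` is the open `ε`-ball in the last `m + 1` coordinates;
the coordinates `x¹, …, xⁿ` are numbered from `0`, and `n = m + 2`. -/
def tubeBox (m : ℕ) (η ε : ℝ) : Set (Eucl (m + 2)) :=
  {x | |x 0| ≤ 2 * η ∧ ∑ i : Fin (m + 1), x i.succ ^ 2 < ε ^ 2}

/-- The chart `e` gives coordinates `x¹, …, xⁿ` around `p` adapted to `v, w`, defined on the box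
`[-2η, 2η] × D(ε)`. -/
structure IsAdaptedChart (F : ∀ x : M, TangentSpace (𝓡 (m + 2)) x → ℝ) (p : M)
    (v w : TangentSpace (𝓡 (m + 2)) p) (e : OpenPartialHomeomorph M (Eucl (m + 2)))
    (η ε : ℝ) : Prop where
  mem_atlas : e ∈ IsManifold.maximalAtlas (𝓡 (m + 2)) ∞ M
  box_subset : tubeBox m η ε ⊆ e.target
  /-- The origin is `p` and `∂₁ = v` there. -/
  first_vec : (⟨e.symm 0, mfderiv (𝓡 (m + 2)) (𝓡 (m + 2)) e.symm 0 (stdVec 0)⟩ :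
      TangentBundle (𝓡 (m + 2)) M) = ⟨p, v⟩
  /-- At the origin `∂₂` and `w` are linearly dependent. -/
  second_vec : ∃ a : ℝ, (⟨e.symm 0, mfderiv (𝓡 (m + 2)) (𝓡 (m + 2)) e.symm 0 (stdVec 1)⟩ :
      TangentBundle (𝓡 (m + 2)) M) = ⟨p, a • w⟩
  /-- At the origin `gᵢⱼ((0, …, 0), (1, 0, …, 0)) = δᵢⱼ`. -/
  normalized : metricCoeff F e 0 (stdVec 0) = 1
  /-- The curves `t ↦ (t, x², …, xⁿ)` are geodesics parametrized by arc length. -/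
  lines : ∀ x ∈ tubeBox m η ε, x 0 = 0 →
    IsGeodesicOn F (fun t : ℝ => e.symm (x + t • stdVec 0)) (Icc (-(2 * η)) (2 * η)) ∧
    IsArcLengthOn F (fun t : ℝ => e.symm (x + t • stdVec 0)) (Icc (-(2 * η)) (2 * η))
  /-- The curve `s ↦ (0, s, 0, …, 0)` is a geodesic. -/
  cross_line : IsGeodesicOn F (fun s : ℝ => e.symm (s • stdVec 1)) (Ioo (-ε) ε)

/-- The curve `t ↦ (t, f(t), 0, …, 0)` in the coordinates given by the chart `e`. -/
def shiftedCurve (e : OpenPartialHomeomorph M (Eucl (m + 2))) (f : ℝ → ℝ) (t : ℝ) : M :=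
  e.symm (t • stdVec 0 + f t • stdVec 1)

/-- The functions `u_s`, `|s| < δ`, form a smooth family with `u_0 = 0`, with `u_s(t) = s` for
`|t| ≤ η + 2ε` and `u_s(t) = 0` for `|t| > η + 4ε`. -/
structure IsShiftFamily (u : ℝ → ℝ → ℝ) (δ η ε : ℝ) : Prop where
  smooth : ContDiffOn ℝ ∞ (fun q : ℝ × ℝ => u q.1 q.2) (Ioo (-δ) δ ×ˢ univ)
  zero : ∀ t, u 0 t = 0
  inner : ∀ s t, |s| < δ → |t| ≤ η + 2 * ε → u s t = s
  outer : ∀ s t, |s| < δ → η + 4 * ε < |t| → u s t = 0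

end Adapted

end

/-!
A curve with nowhere vanishing velocity is a geodesic of `F` exactly if it is extremal for the
energy `L = F² / 2`. The Euler-Lagrange covector of a curve at a point depends only on the `2`-jet
`(x, y, a)` of the curve there, and is treated as a function `eulerLagrange L x y a` of three
vectors. In this form it is natural under changes of coordinates (`eulerLagrange_comp`), so that it
suffices to check the geodesic equation in one chart (`isGeodesicOn_of_eulerLagrange`), and it is
affine in `a` with the positive definite vertical Hessian as linear part, so that it can be solved
for `a` by a smooth `spray`.

*Adapted charts.* In a chart at `p` take the geodesic in direction `w`, thicken it to a hypersurface
in the directions of the remaining vectors of a `g^v`-orthonormal frame that starts with `v, w`,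
scale `v` to unit length along the hypersurface, and follow the geodesics with these initial
velocities. They keep their speed because the energy is constant along solutions, and at the origin
the derivative of the resulting map carries the standard basis to the frame, so that the map is a
local diffeomorphism (`exists_geodesic_coordinates`). This uses the smooth dependence of flows on
initial values. It is deduced from the inverse function theorem in Banach spaces: the Picard
operator `(l, α) ↦ (l, α - l ∫ f(α))` on `ℝ × C([0, 1], E)` is smooth and has an invertible
derivative wherever `l = 0`; by scaling time, the solution for the parameter `l` evaluated at time
`1` is the flow at time `l` (`exists_smooth_flow_of_contDiff`).

*The perturbation.* The energy of `exp(φ) F` is `exp(2φ) L`. A jet `(x, y, a)` has unit length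
and is extremal for it if `φ` has the value `-log(2 L(x, y)) / 2` at `x` and its differential
there is `conformalCovector L x y a` (`eulerLagrange_conformal`). Along the curve
`t ↦ (t, u_s(t), 0, …, 0)` these values and differentials are compatible: the differential, applied
to the velocity, is the derivative of the value (`conformalCovector_self`). So there is a function
with these data that is affine on the slices `x¹ = const` (`hasFDerivAt_affineFactor`).
Where `u_s` is constant in `t`, the curve runs along one of the coordinate lines, which are unit
speed geodesics of `F`, and the data vanish. Hence the function vanishes on all slices outside
`η + 2ε ≤ |x¹| ≤ η + 4ε`, and multiplied by a cutoff function that is `1` near the two corresponding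
pieces of `γ` it still has the right data, for all small `s`, and has compact support in `U`
(`exists_coordinate_factor`). It is jointly smooth in the parameter and the point and vanishes
for `s = 0`; this implies the convergence in `C^∞(M)` (`tendsto_smoothTopology`).
-/

noncomputable section

/-! ### The smooth inverse function theorem -/

/-- The inverse function theorem on an open set: a smooth map whose derivative at `a` is invertible
restricts to a homeomorphism between open sets that is smooth in both directions. -/
theorem exists_smooth_localInverse {E F : Type*} [NormedAddCommGroup E] [NormedSpace ℝ E]
    [CompleteSpace E] [NormedAddCommGroup F] [NormedSpace ℝ F] [CompleteSpace F]
    {f : E → F} {U : Set E} (hU : IsOpen U) {a : E} (ha : a ∈ U) (hf : ContDiffOn ℝ ∞ f U)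
    (f' : E ≃L[ℝ] F) (hf' : HasFDerivAt f (f' : E →L[ℝ] F) a) :
    ∃ h : OpenPartialHomeomorph E F, a ∈ h.source ∧ h.source ⊆ U ∧ (∀ x, h x = f x) ∧
      ContDiffOn ℝ ∞ h h.source ∧ ContDiffOn ℝ ∞ h.symm h.target := by
  have hfa : ContDiffAt ℝ ∞ f a := hf.contDiffAt (hU.mem_nhds ha)
  let h0 := hfa.toOpenPartialHomeomorph f hf' (by simp)
  let V : Set E := U ∩ fderiv ℝ f ⁻¹' range ((↑) : (E ≃L[ℝ] F) → E →L[ℝ] F)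
  have hV : IsOpen V :=
    (hf.continuousOn_fderiv_of_isOpen hU (by simp)).isOpen_inter_preimage hU
      (ContinuousLinearEquiv.isOpen)
  have haV : a ∈ V := ⟨ha, f', hf'.fderiv.symm⟩
  have hcoe : ∀ x, h0 x = f x := fun x => rfl
  refine ⟨h0.restrOpen V hV, ⟨hfa.mem_toOpenPartialHomeomorph_source hf' (by simp), haV⟩,
    fun x hx => hx.2.1, fun x => rfl, fun x hx => ?_, fun y hy => ?_⟩
  · exact (hf x hx.2.1).mono (fun y hy => hy.2.1)
  · have hx := (h0.restrOpen V hV).map_target hy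
    obtain ⟨g, hg⟩ := hx.2.2
    have hd : DifferentiableAt ℝ f ((h0.restrOpen V hV).symm y) :=
      (hf.contDiffAt (hU.mem_nhds hx.2.1)).differentiableAt (by simp)
    refine ((h0.restrOpen V hV).contDiffAt_symm (f₀' := g) hy ?_ ?_).contDiffWithinAt
    · rw [hg]; exact hd.hasFDerivAt
    · exact hf.contDiffAt (hU.mem_nhds hx.2.1)

/-! ### Composition operators on spaces of continuous maps -/

section Nemytskii

universe u

variable {K : Type*} [TopologicalSpace K] [CompactSpace K]

/-- Pointwise application of a continuous family of linear maps to a continuous family of vectors,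
as a continuous bilinear map. -/
def applyFamily (K : Type*) [TopologicalSpace K] [CompactSpace K] (E G : Type*)
    [NormedAddCommGroup E] [NormedSpace ℝ E] [NormedAddCommGroup G] [NormedSpace ℝ G] :
    C(K, E →L[ℝ] G) →L[ℝ] C(K, E) →L[ℝ] C(K, G) :=
  LinearMap.mkContinuous₂
    (LinearMap.mk₂ ℝ (fun (φ : C(K, E →L[ℝ] G)) (β : C(K, E)) =>
      (⟨fun t => φ t (β t), by fun_prop⟩ : C(K, G)))
      (fun _ _ _ => by ext; simp) (fun _ _ _ => by ext; simp)
      (fun _ _ _ => by ext; simp) (fun _ _ _ => by ext; simp)) 1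
    (fun φ β => by
      rw [one_mul]
      refine (ContinuousMap.norm_le _ (by positivity)).2 fun t => ?_
      exact ((φ t).le_opNorm _).trans
        (mul_le_mul (φ.norm_coe_le_norm t) (β.norm_coe_le_norm t) (norm_nonneg _) (norm_nonneg φ)))

/-- Composition with a `C¹` map is differentiable: the remainder is uniformly small because the
derivative is uniformly continuous near the compact range of `α`. -/
theorem hasFDerivAt_continuousMap_comp {E G : Type*}
    [NormedAddCommGroup E] [NormedSpace ℝ E] [NormedAddCommGroup G] [NormedSpace ℝ G]
    {f : E → G} (hf : ContDiff ℝ 1 f) (α : C(K, E)) :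
    HasFDerivAt (fun β : C(K, E) => (⟨f, hf.continuous⟩ : C(E, G)).comp β)
      (applyFamily K E G
        ((⟨fderiv ℝ f, hf.continuous_fderiv (by simp)⟩ : C(E, E →L[ℝ] G)).comp α)) α := by
  refine .of_isLittleO (Asymptotics.isLittleO_iff.2 fun ε hε => ?_)
  have huc := (isCompact_range α.continuous).uniformContinuousAt_of_continuousAt (fderiv ℝ f)
    (fun a _ => (hf.continuous_fderiv (by simp)).continuousAt) (Metric.dist_mem_uniformity hε)
  obtain ⟨δ, hδ, h⟩ := Metric.mem_uniformity_dist.1 huc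
  filter_upwards [Metric.ball_mem_nhds α hδ] with β hβ
  refine (ContinuousMap.norm_le _ (by positivity)).2 fun t => ?_
  have hst : ‖β t - α t‖ ≤ ‖β - α‖ := (β - α).norm_coe_le_norm t
  have hβ' : ‖β - α‖ < δ := by simpa [dist_eq_norm] using hβ
  have key := (convex_ball (α t) δ).norm_image_sub_le_of_norm_hasFDerivWithin_le'
    (f := f) (f' := fderiv ℝ f) (φ := fderiv ℝ f (α t)) (C := ε)
    (fun x _ => ((hf.differentiable (by simp)) x).hasFDerivAt.hasFDerivWithinAt)
    (fun x hx => by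
      have := h (a := α t) (b := x) (by rw [dist_comm]; exact hx) ⟨t, rfl⟩
      rw [← dist_eq_norm, dist_comm]; exact le_of_lt this)
    (Metric.mem_ball_self hδ) (y := β t)
    (by rw [Metric.mem_ball, dist_eq_norm]; exact hst.trans_lt hβ')
  exact key.trans (mul_le_mul_of_nonneg_left hst hε.le)

/-- The induction on `n` passes from `f : E → G` to `fderiv ℝ f : E → E →L[ℝ] G`, so the statement
quantifies over the target space, which therefore has to live in the universe of `E`. -/
theorem contDiff_nat_continuousMap_comp {E : Type u} [NormedAddCommGroup E] [NormedSpace ℝ E]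
    (n : ℕ) :
    ∀ {G : Type u} [NormedAddCommGroup G] [NormedSpace ℝ G] {f : E → G} (hc : Continuous f),
      ContDiff ℝ n f → ContDiff ℝ n (fun β : C(K, E) => (⟨f, hc⟩ : C(E, G)).comp β) := by
  induction n with
  | zero =>
    intro G _ _ f hc _
    exact contDiff_zero.2 (ContinuousMap.continuous_postcomp _)
  | succ n ih =>
    intro G _ _ f hc hf
    have h1 : ContDiff ℝ 1 f := hf.of_le (by exact_mod_cast Nat.le_add_left 1 n)
    have hd := hasFDerivAt_continuousMap_comp (K := K) h1
    push_cast
    refine contDiff_succ_iff_hasFDerivAt.2 ⟨_, ?_, hd⟩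
    refine (applyFamily K E G).contDiff.comp (ih _ ?_)
    push_cast at hf
    exact (contDiff_succ_iff_fderiv.1 hf).2.2

/-- Composition with a smooth map is a smooth operation on continuous maps with the sup norm. -/
theorem contDiff_continuousMap_comp {E G : Type u} [NormedAddCommGroup E] [NormedSpace ℝ E]
    [NormedAddCommGroup G] [NormedSpace ℝ G] {f : E → G} (hf : ContDiff ℝ ∞ f) :
    ContDiff ℝ ∞ (fun β : C(K, E) => (⟨f, hf.continuous⟩ : C(E, G)).comp β) :=
  contDiff_infty.2 fun n => contDiff_nat_continuousMap_comp n _ (contDiff_infty.1 hf n)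

end Nemytskii

/-! ### Smooth local flows of vector fields -/

section Flow

variable {E : Type*} [NormedAddCommGroup E]

/-- Composition of a path, defined on `[0, 1]`, with the projection of `ℝ` onto `[0, 1]`. -/
def extendPath (α : C(unitInterval, E)) (τ : ℝ) : E := α (projIcc 0 1 zero_le_one τ)

theorem continuous_extendPath (α : C(unitInterval, E)) : Continuous (extendPath α) :=
  α.continuous.comp continuous_projIcc

theorem norm_extendPath_le (α : C(unitInterval, E)) (τ : ℝ) : ‖extendPath α τ‖ ≤ ‖α‖ :=
  α.norm_coe_le_norm _

theorem extendPath_coe (α : C(unitInterval, E)) (t : unitInterval) : extendPath α t = α t := by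
  simp [extendPath]

variable [NormedSpace ℝ E]

/-- The operator `α ↦ (t ↦ ∫₀ᵗ α)` on continuous paths. -/
def pathPrimitive (E : Type*) [NormedAddCommGroup E] [NormedSpace ℝ E] :
    C(unitInterval, E) →L[ℝ] C(unitInterval, E) :=
  LinearMap.mkContinuous
    { toFun := fun α => ⟨fun t => ∫ τ in (0 : ℝ)..t, extendPath α τ,
        (intervalIntegral.continuous_primitive
          (fun a b => (continuous_extendPath α).intervalIntegrable a b) 0).comp
          continuous_subtype_val⟩
      map_add' := fun α β => by
        ext t
        exact intervalIntegral.integral_add ((continuous_extendPath α).intervalIntegrable _ _)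
          ((continuous_extendPath β).intervalIntegrable _ _)
      map_smul' := fun c α => by
        ext t
        exact intervalIntegral.integral_smul c (extendPath α) } 1
    (fun α => by
      rw [one_mul]
      refine (ContinuousMap.norm_le _ (norm_nonneg α)).2 fun t => ?_
      refine (intervalIntegral.norm_integral_le_of_norm_le_const
        (fun τ _ => norm_extendPath_le α τ)).trans ?_
      have h1 : |(t : ℝ) - 0| ≤ 1 := by
        rw [sub_zero, abs_of_nonneg t.2.1]; exact t.2.2
      exact mul_le_of_le_one_right (norm_nonneg α) h1)

theorem pathPrimitive_apply (α : C(unitInterval, E)) (t : unitInterval) :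
    pathPrimitive E α t = ∫ τ in (0 : ℝ)..t, extendPath α τ := rfl

/-- The Picard operator of the vector field `f`: `α` solves the equation `α' = l f(α)`,
`α(0) = z` on `[0, 1]` exactly if `(l, α)` is mapped to `(l, z)`. -/
def picardPair (f : E → E) (hf : Continuous f) (q : ℝ × C(unitInterval, E)) :
    ℝ × C(unitInterval, E) :=
  (q.1, q.2 - q.1 • pathPrimitive E ((⟨f, hf⟩ : C(E, E)).comp q.2))

theorem contDiff_picardPair {f : E → E} (hf : ContDiff ℝ ∞ f) :
    ContDiff ℝ ∞ (picardPair f hf.continuous) :=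
  contDiff_fst.prodMk (contDiff_snd.sub (contDiff_fst.smul
    ((pathPrimitive E).contDiff.comp ((contDiff_continuousMap_comp hf).comp contDiff_snd))))

/-- The shear `(μ, β) ↦ (μ, β - μ b)`. -/
def shearEquiv {B : Type*} [NormedAddCommGroup B] [NormedSpace ℝ B] (b : B) :
    (ℝ × B) ≃L[ℝ] (ℝ × B) :=
  ContinuousLinearEquiv.equivOfInverse
    ((ContinuousLinearMap.fst ℝ ℝ B).prod
      (ContinuousLinearMap.snd ℝ ℝ B - (ContinuousLinearMap.fst ℝ ℝ B).smulRight b))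
    ((ContinuousLinearMap.fst ℝ ℝ B).prod
      (ContinuousLinearMap.snd ℝ ℝ B + (ContinuousLinearMap.fst ℝ ℝ B).smulRight b))
    (fun q => by ext <;> simp) (fun q => by ext <;> simp)

/-- At parameter `0` the derivative of the Picard operator is a shear, so it is invertible. -/
theorem hasFDerivAt_picardPair {f : E → E} (hf : ContDiff ℝ ∞ f) (α : C(unitInterval, E)) :
    HasFDerivAt (picardPair f hf.continuous)
      (shearEquiv (pathPrimitive E ((⟨f, hf.continuous⟩ : C(E, E)).comp α)) :
        (ℝ × C(unitInterval, E)) →L[ℝ] (ℝ × C(unitInterval, E))) (0, α) := by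
  have hN : DifferentiableAt ℝ (fun q : ℝ × C(unitInterval, E) =>
      pathPrimitive E ((⟨f, hf.continuous⟩ : C(E, E)).comp q.2)) (0, α) :=
    (((pathPrimitive E).contDiff.comp ((contDiff_continuousMap_comp hf).comp
      contDiff_snd)).differentiable (by simp : (∞ : WithTop ℕ∞) ≠ 0)) _
  have h := (hasFDerivAt_fst (𝕜 := ℝ) (p := ((0 : ℝ), α))).prodMk
    ((hasFDerivAt_snd (𝕜 := ℝ) (p := ((0 : ℝ), α))).sub
      ((hasFDerivAt_fst (𝕜 := ℝ) (p := ((0 : ℝ), α))).smul hN.hasFDerivAt))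
  refine h.congr_fderiv ?_
  ext q <;> simp [shearEquiv]

/-- The path `τ ↦ α (r τ)`. -/
def rescalePath (α : C(unitInterval, E)) (r : unitInterval) : C(unitInterval, E) :=
  ⟨fun τ => α (r * τ), by fun_prop⟩

/-- The substitution `σ = r τ`, which turns a solution `α` of the Picard equation with parameter `l`
into the solution `τ ↦ α (r τ)` with parameter `r l`. -/
theorem pathPrimitive_rescalePath (f : E → E) (hf : Continuous f) (α : C(unitInterval, E))
    (r t : unitInterval) :
    (r : ℝ) • pathPrimitive E ((⟨f, hf⟩ : C(E, E)).comp (rescalePath α r)) t =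
      pathPrimitive E ((⟨f, hf⟩ : C(E, E)).comp α) (r * t) := by
  rw [pathPrimitive_apply, pathPrimitive_apply]
  have h1 : ∫ τ in (0 : ℝ)..t, extendPath ((⟨f, hf⟩ : C(E, E)).comp (rescalePath α r)) τ =
      ∫ τ in (0 : ℝ)..t, extendPath ((⟨f, hf⟩ : C(E, E)).comp α) (r * τ) := by
    refine intervalIntegral.integral_congr fun τ hτ => ?_
    rw [uIcc_of_le t.2.1] at hτ
    have hτ' : τ ∈ Icc (0 : ℝ) 1 := ⟨hτ.1, hτ.2.trans t.2.2⟩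
    lift τ to unitInterval using hτ'
    have := extendPath_coe ((⟨f, hf⟩ : C(E, E)).comp α) (r * τ)
    rw [Icc.coe_mul] at this
    rw [this, extendPath_coe]
    rfl
  rw [h1, intervalIntegral.smul_integral_comp_mul_left]
  simp

/-- **Smooth dependence on initial values**: a smooth vector field has a smooth local flow. -/
theorem exists_smooth_flow_of_contDiff [CompleteSpace E] {f : E → E} (hf : ContDiff ℝ ∞ f)
    (z₀ : E) :
    ∃ r : ℝ, 0 < r ∧ ∃ Θ : ℝ → E → E,
      ContDiffOn ℝ ∞ (fun q : ℝ × E => Θ q.1 q.2) (Ioo (-r) r ×ˢ Metric.ball z₀ r) ∧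
      ∀ z ∈ Metric.ball z₀ r, Θ 0 z = z ∧
        ∀ t ∈ Ioo (-r) r, HasDerivAt (fun τ => Θ τ z) (f (Θ t z)) t := by
  let cst : E →L[ℝ] C(unitInterval, E) := ContinuousLinearMap.const ℝ unitInterval
  have hcst : ∀ z t, cst z t = z := fun z t => rfl
  obtain ⟨h, ha, -, hcoe, -, hsymm⟩ := exists_smooth_localInverse isOpen_univ (mem_univ _)
    (contDiff_picardPair hf).contDiffOn _ (hasFDerivAt_picardPair hf (cst z₀))
  have hP0 : h (0, cst z₀) = (0, cst z₀) := by rw [hcoe]; simp [picardPair]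
  -- a product neighbourhood on which the inverse stays in a ball contained in the source
  obtain ⟨ρ, hρ, hball⟩ := Metric.isOpen_iff.1 h.open_source _ ha
  have hopen : IsOpen (h.target ∩ h.symm ⁻¹' Metric.ball (0, cst z₀) ρ) :=
    h.isOpen_inter_preimage_symm Metric.isOpen_ball
  let ι : ℝ × E → ℝ × C(unitInterval, E) := fun q => (q.1, cst q.2)
  have hι : ContDiff ℝ ∞ ι := contDiff_fst.prodMk (cst.contDiff.comp contDiff_snd)
  obtain ⟨r, hr, hrsub⟩ := Metric.isOpen_iff.1 (hopen.preimage hι.continuous) (0, z₀) (by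
    refine ⟨?_, ?_⟩
    · rw [show ι (0, z₀) = h (0, cst z₀) from hP0.symm]
      exact h.map_source ha
    · change h.symm (ι (0, z₀)) ∈ Metric.ball (0, cst z₀) ρ
      rw [show ι (0, z₀) = h (0, cst z₀) from hP0.symm, h.left_inv ha]
      exact Metric.mem_ball_self hρ)
  have hbox : ∀ t z, t ∈ Ioo (-r) r → z ∈ Metric.ball z₀ r →
      ι (t, z) ∈ h.target ∩ h.symm ⁻¹' Metric.ball (0, cst z₀) ρ := by
    intro t z ht hz
    apply hrsub
    rw [← ball_prod_same]
    refine ⟨?_, hz⟩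
    rw [Real.ball_eq_Ioo]; simpa using ht
  let A : ℝ → E → C(unitInterval, E) := fun t z => (h.symm (ι (t, z))).2
  -- the Picard equation
  have hA : ∀ t z, t ∈ Ioo (-r) r → z ∈ Metric.ball z₀ r → h.symm (ι (t, z)) = (t, A t z) ∧
      A t z = cst z + t • pathPrimitive E ((⟨f, hf.continuous⟩ : C(E, E)).comp (A t z)) := by
    intro t z ht hz
    have e1 := h.right_inv (hbox t z ht hz).1
    rw [hcoe] at e1
    have e2 := congrArg Prod.fst e1
    have e3 := congrArg Prod.snd e1
    simp only [picardPair, ι] at e2 e3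
    refine ⟨Prod.ext e2 rfl, ?_⟩
    rw [e2] at e3
    rw [← e3]; simp [A, ι]
  -- a rescaled solution is the solution for the rescaled parameter: it stays in the ball around
  -- `z₀`, on which the Picard operator is injective
  have hscale : ∀ t z (r' : unitInterval), t ∈ Ioo (-r) r → z ∈ Metric.ball z₀ r →
      A (r' * t) z = rescalePath (A t z) r' := by
    intro t z r' ht hz
    have hb := (hbox t z ht hz).2
    rw [mem_preimage, (hA t z ht hz).1, ← ball_prod_same] at hb
    have hmem : (r' * t, rescalePath (A t z) r') ∈ h.source := by
      apply hball
      rw [← ball_prod_same]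
      refine ⟨?_, ?_⟩
      · have h1 : |t| < ρ := by simpa using hb.1
        have : |r' * t| ≤ |t| := by
          rw [abs_mul, abs_of_nonneg r'.2.1]
          exact mul_le_of_le_one_left (abs_nonneg t) r'.2.2
        simpa using this.trans_lt h1
      · have h2 := hb.2
        rw [Metric.mem_ball] at h2 ⊢
        refine lt_of_le_of_lt ((ContinuousMap.dist_le dist_nonneg).2 fun τ => ?_) h2
        exact ContinuousMap.dist_apply_le_dist (f := A t z) (g := cst z₀) (r' * τ)
    have heq : h (r' * t, rescalePath (A t z) r') = ι (r' * t, z) := by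
      rw [hcoe]
      refine Prod.ext rfl ?_
      ext τ
      have h3 := pathPrimitive_rescalePath f hf.continuous (A t z) r' τ
      have h4 := congrArg (fun α : C(unitInterval, E) => α (r' * τ)) (hA t z ht hz).2
      simp only [ContinuousMap.add_apply, ContinuousMap.smul_apply, hcst] at h4
      simp only [picardPair, ι, ContinuousMap.sub_apply, ContinuousMap.smul_apply, hcst]
      rw [mul_comm, mul_smul, h3, sub_eq_iff_eq_add, ← h4]
      rfl
    have := h.left_inv hmem
    rw [heq] at this
    exact congrArg Prod.snd this
  refine ⟨r, hr, fun t z => A t z 1, ?_, fun z hz => ⟨?_, ?_⟩⟩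
  · have h1 : ContDiffOn ℝ ∞ (fun q : ℝ × E => h.symm (ι q)) (Ioo (-r) r ×ˢ Metric.ball z₀ r) :=
      hsymm.comp hι.contDiffOn (fun q hq => (hbox q.1 q.2 hq.1 hq.2).1)
    exact ((ContinuousMap.evalCLM ℝ (1 : unitInterval)).contDiff.comp
      contDiff_snd).comp_contDiffOn h1
  · have := (hA 0 z ⟨by linarith, hr⟩ hz).2
    rw [zero_smul, add_zero] at this
    change A 0 z 1 = z
    rw [this, hcst]
  · -- the flow satisfies the integral equation
    have hcont : ContinuousOn (fun t => A t z 1) (Ioo (-r) r) := by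
      have h1 : ContinuousOn (fun t : ℝ => h.symm (ι (t, z))) (Ioo (-r) r) :=
        hsymm.continuousOn.comp (hι.continuous.comp (by fun_prop)).continuousOn
          (fun t ht => (hbox t z ht hz).1)
      exact ((ContinuousMap.evalCLM ℝ (1 : unitInterval)).continuous.comp
        continuous_snd).comp_continuousOn h1
    have hint : ∀ t ∈ Ioo (-r) r, A t z 1 = z + ∫ σ in (0 : ℝ)..t, f (A σ z 1) := by
      intro t ht
      have h1 := congrArg (fun α : C(unitInterval, E) => α 1) (hA t z ht hz).2
      simp only [ContinuousMap.add_apply, ContinuousMap.smul_apply, hcst] at h1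
      rw [h1, pathPrimitive_apply]
      congr 1
      have h2 : ∫ τ in (0 : ℝ)..(1 : unitInterval),
          extendPath ((⟨f, hf.continuous⟩ : C(E, E)).comp (A t z)) τ =
          ∫ τ in (0 : ℝ)..1, f (A (t * τ) z 1) := by
        refine intervalIntegral.integral_congr fun τ hτ => ?_
        rw [Icc.coe_one, uIcc_of_le zero_le_one] at hτ
        lift τ to unitInterval using hτ
        rw [extendPath_coe, mul_comm t, hscale t z τ ht hz]
        simp [rescalePath]
      rw [h2, intervalIntegral.smul_integral_comp_mul_left (fun σ => f (A σ z 1)) t]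
      simp
    intro t ht
    have hfc : ContinuousOn (fun σ => f (A σ z 1)) (Ioo (-r) r) :=
      hf.continuous.comp_continuousOn hcont
    have h0r : (0 : ℝ) ∈ Ioo (-r) r := ⟨by linarith, hr⟩
    have hsub : uIcc 0 t ⊆ Ioo (-r) r := ordConnected_Ioo.uIcc_subset h0r ht
    have hd := intervalIntegral.integral_hasDerivAt_right
      ((hfc.mono hsub).intervalIntegrable)
      (hfc.stronglyMeasurableAtFilter isOpen_Ioo t ht)
      (hfc.continuousAt (isOpen_Ioo.mem_nhds ht))
    refine (hd.const_add z).congr_of_eventuallyEq ?_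
    filter_upwards [isOpen_Ioo.mem_nhds ht] with s hs using hint s hs

/-- The local flow of a smooth vector field on an open set, obtained from the flow of its product
with a bump function. -/
theorem exists_smooth_flow [FiniteDimensional ℝ E] {f : E → E} {O : Set E} (hO : IsOpen O)
    (hf : ContDiffOn ℝ ∞ f O) {z₀ : E} (hz₀ : z₀ ∈ O) :
    ∃ r : ℝ, 0 < r ∧ ∃ Θ : ℝ → E → E,
      ContDiffOn ℝ ∞ (fun q : ℝ × E => Θ q.1 q.2) (Ioo (-r) r ×ˢ Metric.ball z₀ r) ∧
      ∀ z ∈ Metric.ball z₀ r, Θ 0 z = z ∧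
        ∀ t ∈ Ioo (-r) r, Θ t z ∈ O ∧ HasDerivAt (fun τ => Θ τ z) (f (Θ t z)) t := by
  obtain ⟨R, hR, hRO⟩ := Metric.nhds_basis_closedBall.mem_iff.1 (hO.mem_nhds hz₀)
  let χ : ContDiffBump z₀ := ⟨R / 2, R, by positivity, by linarith⟩
  have hg : ContDiff ℝ ∞ (fun z => χ z • f z) := by
    rw [contDiff_iff_contDiffAt]
    intro z
    by_cases hz : z ∈ O
    · exact (χ.contDiff.contDiffAt).smul (hf.contDiffAt (hO.mem_nhds hz))
    · have hz' : z ∉ tsupport χ := fun h => hz (hRO (by rwa [χ.tsupport_eq] at h))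
      refine contDiffAt_const (c := (0 : E)) |>.congr_of_eventuallyEq ?_
      filter_upwards [(isClosed_tsupport χ).isOpen_compl.mem_nhds hz'] with y hy
      rw [image_eq_zero_of_notMem_tsupport hy, zero_smul]
  have : CompleteSpace E := FiniteDimensional.complete ℝ E
  obtain ⟨r, hr, Θ, hΘ, hΘ'⟩ := exists_smooth_flow_of_contDiff hg z₀
  have h0 : ((0 : ℝ), z₀) ∈ Ioo (-r) r ×ˢ Metric.ball z₀ r :=
    ⟨⟨by linarith, hr⟩, Metric.mem_ball_self hr⟩
  have hop : IsOpen (Ioo (-r) r ×ˢ Metric.ball z₀ r) := isOpen_Ioo.prod Metric.isOpen_ball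
  have hnhds := (hΘ.continuousOn.isOpen_inter_preimage hop
    (Metric.isOpen_ball (x := z₀) (ε := R / 2))).mem_nhds (x := ((0 : ℝ), z₀))
      ⟨h0, by simp [(hΘ' z₀ h0.2).1, hR]⟩
  obtain ⟨r', hr', hsub⟩ := Metric.mem_nhds_iff.1 hnhds
  have hbox : ∀ t z, t ∈ Ioo (-r') r' → z ∈ Metric.ball z₀ r' →
      (t, z) ∈ Ioo (-r) r ×ˢ Metric.ball z₀ r ∧ Θ t z ∈ Metric.ball z₀ (R / 2) := by
    intro t z ht hz
    refine hsub ?_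
    rw [← ball_prod_same]
    exact ⟨by rw [Real.ball_eq_Ioo]; simpa using ht, hz⟩
  refine ⟨r', hr', Θ, hΘ.mono fun q hq => (hbox q.1 q.2 hq.1 hq.2).1, fun z hz =>
    ⟨(hΘ' z (hbox 0 z ⟨by linarith, hr'⟩ hz).1.2).1, fun t ht => ?_⟩⟩
  obtain ⟨h1, h2⟩ := hbox t z ht hz
  refine ⟨hRO (Metric.ball_subset_closedBall (Metric.ball_subset_ball (by linarith) h2)), ?_⟩
  have h3 := (hΘ' z h1.2).2 t h1.1
  rwa [χ.one_of_mem_closedBall (Metric.ball_subset_closedBall h2), one_smul] at h3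

end Flow

/-! ### The Euler-Lagrange operator on jets -/

theorem natCast_le_smooth (k : ℕ) : (k : WithTop ℕ∞) ≤ ∞ := by
  exact_mod_cast (le_top : (k : ℕ∞) ≤ ⊤)

section Jets

variable {E : Type*} [NormedAddCommGroup E] [NormedSpace ℝ E]

/-- The Euler-Lagrange operator of the Lagrangian `L (x, y)`, as a function of a `2`-jet
`(x, y, a)` of curves: for a curve `c` and a constant vector `z`, the value at
`(c, c', c'')` is `d/dt (∂L/∂y (c, c') z) - ∂L/∂x (c, c') z`. -/
def eulerLagrange (L : E × E → ℝ) (x y a : E) : E →L[ℝ] ℝ :=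
  (fderiv ℝ (fderiv ℝ L) (x, y) (y, a)).comp (ContinuousLinearMap.inr ℝ E E)
    - (fderiv ℝ L (x, y)).comp (ContinuousLinearMap.inl ℝ E E)

theorem eulerLagrange_apply (L : E × E → ℝ) (x y a z : E) :
    eulerLagrange L x y a z =
      fderiv ℝ (fderiv ℝ L) (x, y) (y, a) (0, z) - fderiv ℝ L (x, y) (z, 0) := by
  simp [eulerLagrange]

/-- The vertical Hessian as a map to the dual space. -/
def verticalHessian (L : E × E → ℝ) (q : E × E) : E →L[ℝ] (E →L[ℝ] ℝ) :=
  ((ContinuousLinearMap.compL ℝ E (E × E) ℝ).flip (ContinuousLinearMap.inr ℝ E E)).comp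
    ((fderiv ℝ (fderiv ℝ L) q).comp (ContinuousLinearMap.inr ℝ E E))

theorem verticalHessian_apply (L : E × E → ℝ) (q : E × E) (u w : E) :
    verticalHessian L q u w = fderiv ℝ (fderiv ℝ L) q (0, u) (0, w) := by
  simp [verticalHessian]

theorem eulerLagrange_eq_add (L : E × E → ℝ) (x y a : E) :
    eulerLagrange L x y a = verticalHessian L (x, y) a + eulerLagrange L x y 0 := by
  ext z
  have : fderiv ℝ (fderiv ℝ L) (x, y) (y, a) =
      fderiv ℝ (fderiv ℝ L) (x, y) (y, 0) + fderiv ℝ (fderiv ℝ L) (x, y) (0, a) := by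
    rw [← map_add]; simp
  rw [add_apply, eulerLagrange_apply, eulerLagrange_apply,
    verticalHessian_apply, this, add_apply]
  ring

/-- The geodesic spray: the acceleration for which the Euler-Lagrange covector vanishes. -/
def spray (L : E × E → ℝ) (q : E × E) : E :=
  -(verticalHessian L q).inverse (eulerLagrange L q.1 q.2 0)

/-- A local Finsler Lagrangian `L = F²/2` on the open set `Ω` of a vector space: smooth away from
the zero section, positively homogeneous of degree two, positive, with positive definite vertical
second derivative. -/
structure IsFinslerLagrangian (L : E × E → ℝ) (Ω : Set E) : Prop where
  isOpen : IsOpen Ω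
  smooth : ContDiffOn ℝ ∞ L (Ω ×ˢ {0}ᶜ)
  homogeneous : ∀ x ∈ Ω, ∀ (y : E) (c : ℝ), 0 < c → L (x, c • y) = c ^ 2 * L (x, y)
  pos : ∀ x ∈ Ω, ∀ y : E, y ≠ 0 → 0 < L (x, y)
  legendre : ∀ x ∈ Ω, ∀ y u : E, y ≠ 0 → u ≠ 0 → 0 < fderiv ℝ (fderiv ℝ L) (x, y) (0, u) (0, u)

namespace IsFinslerLagrangian

variable {L : E × E → ℝ} {Ω : Set E}

theorem isOpen_slit (hL : IsFinslerLagrangian L Ω) : IsOpen (Ω ×ˢ ({0}ᶜ : Set E)) :=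
  hL.isOpen.prod isOpen_compl_singleton

theorem contDiffAt (hL : IsFinslerLagrangian L Ω) {x y : E} (hx : x ∈ Ω) (hy : y ≠ 0) :
    ContDiffAt ℝ ∞ L (x, y) :=
  hL.smooth.contDiffAt (hL.isOpen_slit.mem_nhds (mk_mem_prod hx hy))

theorem contDiffOn_fderiv (hL : IsFinslerLagrangian L Ω) :
    ContDiffOn ℝ ∞ (fderiv ℝ L) (Ω ×ˢ {0}ᶜ) :=
  hL.smooth.fderiv_of_isOpen hL.isOpen_slit (by simp)

theorem contDiffOn_fderiv_fderiv (hL : IsFinslerLagrangian L Ω) :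
    ContDiffOn ℝ ∞ (fderiv ℝ (fderiv ℝ L)) (Ω ×ˢ {0}ᶜ) :=
  hL.contDiffOn_fderiv.fderiv_of_isOpen hL.isOpen_slit (by simp)

theorem hasFDerivAt (hL : IsFinslerLagrangian L Ω) {x y : E} (hx : x ∈ Ω) (hy : y ≠ 0) :
    HasFDerivAt L (fderiv ℝ L (x, y)) (x, y) :=
  ((hL.contDiffAt hx hy).differentiableAt (by simp)).hasFDerivAt

theorem hasFDerivAt_fderiv (hL : IsFinslerLagrangian L Ω) {x y : E} (hx : x ∈ Ω) (hy : y ≠ 0) :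
    HasFDerivAt (fderiv ℝ L) (fderiv ℝ (fderiv ℝ L) (x, y)) (x, y) :=
  ((hL.contDiffOn_fderiv.contDiffAt (hL.isOpen_slit.mem_nhds (mk_mem_prod hx hy))).differentiableAt
    (by simp)).hasFDerivAt

/-- Euler's identity for functions that are homogeneous of degree two. -/
theorem fderiv_vertical_self (hL : IsFinslerLagrangian L Ω) {x y : E} (hx : x ∈ Ω) (hy : y ≠ 0) :
    fderiv ℝ L (x, y) (0, y) = 2 * L (x, y) := by
  have hc : HasDerivAt (fun c : ℝ => (x, c • y)) ((0 : E), (1 : ℝ) • y) 1 :=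
    (hasDerivAt_const _ x).prodMk ((hasDerivAt_id (1 : ℝ)).smul_const y)
  have h1 : HasDerivAt (fun c : ℝ => L (x, c • y)) (fderiv ℝ L (x, y) (0, y)) 1 := by
    have := (show HasFDerivAt L (fderiv ℝ L (x, y)) (x, (1 : ℝ) • y) by
      rw [one_smul]; exact hL.hasFDerivAt hx hy).comp_hasDerivAt (1 : ℝ) hc
    rwa [one_smul] at this
  have h2 : HasDerivAt (fun c : ℝ => c ^ 2 * L (x, y)) (2 * L (x, y)) 1 := by
    simpa using (hasDerivAt_pow 2 (1 : ℝ)).mul_const (L (x, y))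
  refine h1.unique (h2.congr_of_eventuallyEq ?_)
  filter_upwards [lt_mem_nhds (zero_lt_one (α := ℝ))] with c hc
  exact hL.homogeneous x hx y c hc

/-- Euler's identity, differentiated. -/
theorem fderiv_fderiv_vertical_self (hL : IsFinslerLagrangian L Ω) {x y : E} (hx : x ∈ Ω)
    (hy : y ≠ 0) (h : E × E) :
    fderiv ℝ (fderiv ℝ L) (x, y) h (0, y) + fderiv ℝ L (x, y) (0, h.2) =
      2 * fderiv ℝ L (x, y) h := by
  have h1 := (hL.hasFDerivAt_fderiv hx hy).clm_apply
    ((hasFDerivAt_const (0 : E) (x, y)).prodMk (hasFDerivAt_snd (𝕜 := ℝ) (p := (x, y))))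
  have h2 := (hL.hasFDerivAt hx hy).const_mul 2
  have heq : (fun q : E × E => fderiv ℝ L q (0, q.2)) =ᶠ[𝓝 (x, y)] fun q => 2 * L q := by
    filter_upwards [hL.isOpen_slit.mem_nhds (⟨hx, hy⟩ : (x, y) ∈ Ω ×ˢ ({0}ᶜ : Set E))] with q hq
    exact hL.fderiv_vertical_self hq.1 hq.2
  have := congrArg (fun T : E × E →L[ℝ] ℝ => T h) ((h1.congr_of_eventuallyEq heq.symm).unique h2)
  simp at this
  linarith

/-- The Euler-Lagrange covector, applied to the velocity, is the change of energy. -/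
theorem eulerLagrange_self (hL : IsFinslerLagrangian L Ω) {x y : E} (hx : x ∈ Ω) (hy : y ≠ 0)
    (a : E) : eulerLagrange L x y a y = fderiv ℝ L (x, y) (y, a) := by
  have h1 := hL.fderiv_fderiv_vertical_self hx hy (y, a)
  have h2 : fderiv ℝ L (x, y) (y, a) = fderiv ℝ L (x, y) (y, 0) + fderiv ℝ L (x, y) (0, a) := by
    rw [← map_add]; simp
  rw [eulerLagrange_apply]
  simp only at h1
  linarith

theorem fderiv_fderiv_vertical_comm (hL : IsFinslerLagrangian L Ω) {x y : E} (hx : x ∈ Ω)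
    (hy : y ≠ 0) (h k : E × E) :
    fderiv ℝ (fderiv ℝ L) (x, y) h k = fderiv ℝ (fderiv ℝ L) (x, y) k h :=
  ((hL.contDiffAt hx hy).isSymmSndFDerivAt (by simpa using natCast_le_smooth 2)) h k

/-- The vertical Hessian in the direction of the base vector itself. -/
theorem vertical_hessian_self (hL : IsFinslerLagrangian L Ω) {x y : E} (hx : x ∈ Ω)
    (hy : y ≠ 0) (z : E) :
    fderiv ℝ (fderiv ℝ L) (x, y) (0, z) (0, y) = fderiv ℝ L (x, y) (0, z) := by
  have h1 := hL.fderiv_fderiv_vertical_self hx hy (0, z)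
  simp only at h1
  linarith

theorem exists_verticalHessian_equiv [FiniteDimensional ℝ E] (hL : IsFinslerLagrangian L Ω)
    {x y : E} (hx : x ∈ Ω) (hy : y ≠ 0) :
    ∃ T : E ≃L[ℝ] (E →L[ℝ] ℝ), (T : E →L[ℝ] (E →L[ℝ] ℝ)) = verticalHessian L (x, y) := by
  have hinj : Function.Injective (verticalHessian L (x, y) : E →ₗ[ℝ] (E →L[ℝ] ℝ)) := by
    refine (injective_iff_map_eq_zero _).2 fun u hu => ?_
    by_contra hne
    have h1 := hL.legendre x hx y u hy hne
    have h2 := congrArg (fun T : E →L[ℝ] ℝ => T u) hu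
    simp only [ContinuousLinearMap.coe_coe, verticalHessian_apply] at h2
    simp [h2] at h1
  have hfin : Module.finrank ℝ E = Module.finrank ℝ (E →L[ℝ] ℝ) := by
    rw [← (LinearMap.toContinuousLinearMap : (E →ₗ[ℝ] ℝ) ≃ₗ[ℝ] (E →L[ℝ] ℝ)).finrank_eq]
    exact (Subspace.dual_finrank_eq (K := ℝ) (V := E)).symm
  refine ⟨(LinearEquiv.ofInjectiveOfFinrankEq _ hinj hfin).toContinuousLinearEquiv, ?_⟩
  ext u w
  rfl

theorem eulerLagrange_spray [FiniteDimensional ℝ E] (hL : IsFinslerLagrangian L Ω) {x y : E}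
    (hx : x ∈ Ω) (hy : y ≠ 0) :
    eulerLagrange L x y (spray L (x, y)) = 0 := by
  obtain ⟨T, hT⟩ := hL.exists_verticalHessian_equiv hx hy
  rw [eulerLagrange_eq_add, spray, ← hT, ContinuousLinearMap.inverse_equiv]
  simp

theorem contDiffOn_eulerLagrange (hL : IsFinslerLagrangian L Ω) :
    ContDiffOn ℝ ∞ (fun q : (E × E) × E => eulerLagrange L q.1.1 q.1.2 q.2)
      ((Ω ×ˢ {0}ᶜ) ×ˢ univ) := by
  have h1 : ContDiffOn ℝ ∞ (fun q : (E × E) × E => fderiv ℝ L q.1) ((Ω ×ˢ {0}ᶜ) ×ˢ univ) :=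
    hL.contDiffOn_fderiv.comp contDiff_fst.contDiffOn (fun q hq => hq.1)
  have h2 : ContDiffOn ℝ ∞ (fun q : (E × E) × E => fderiv ℝ (fderiv ℝ L) q.1)
      ((Ω ×ˢ {0}ᶜ) ×ˢ univ) :=
    hL.contDiffOn_fderiv_fderiv.comp contDiff_fst.contDiffOn (fun q hq => hq.1)
  have h3 : ContDiff ℝ ∞ (fun q : (E × E) × E => (q.1.2, q.2)) := by fun_prop
  exact ((h2.clm_apply h3.contDiffOn).clm_comp contDiffOn_const).sub
    (h1.clm_comp contDiffOn_const)

theorem contDiffOn_spray [FiniteDimensional ℝ E] (hL : IsFinslerLagrangian L Ω) :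
    ContDiffOn ℝ ∞ (spray L) (Ω ×ˢ {0}ᶜ) := by
  have hH : ContDiffOn ℝ ∞ (verticalHessian L) (Ω ×ˢ {0}ᶜ) :=
    contDiffOn_const.clm_comp (hL.contDiffOn_fderiv_fderiv.clm_comp contDiffOn_const)
  have hE : ContDiffOn ℝ ∞ (fun q : E × E => eulerLagrange L q.1 q.2 0) (Ω ×ˢ {0}ᶜ) :=
    hL.contDiffOn_eulerLagrange.comp (f := fun q : E × E => (q, (0 : E)))
      (contDiff_id.prodMk contDiff_const).contDiffOn (fun q hq => ⟨hq, mem_univ _⟩)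
  intro q hq
  obtain ⟨T, hT⟩ := hL.exists_verticalHessian_equiv hq.1 hq.2
  have hinv : ContDiffAt ℝ ∞ ContinuousLinearMap.inverse (verticalHessian L q) := by
    rw [show verticalHessian L q = T from hT.symm]
    have : CompleteSpace E := FiniteDimensional.complete ℝ E
    exact contDiffAt_map_inverse T
  exact ((hinv.comp_contDiffWithinAt q (hH q hq)).clm_apply (hE q hq)).neg

end IsFinslerLagrangian

/-! ### Behaviour under coordinate changes and conformal changes -/

/-- The Euler-Lagrange operator is natural under a change of coordinates `ψ`. -/
theorem eulerLagrange_comp {L L' : E × E → ℝ} {ψ : E → E} {x y : E}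
    (hψ : ContDiffAt ℝ ∞ ψ x) (hL' : ContDiffAt ℝ ∞ L' (ψ x, fderiv ℝ ψ x y))
    (h : L =ᶠ[𝓝 (x, y)] fun q => L' (ψ q.1, fderiv ℝ ψ q.1 q.2)) (a z : E) :
    eulerLagrange L x y a z =
      eulerLagrange L' (ψ x) (fderiv ℝ ψ x y) (fderiv ℝ (fderiv ℝ ψ) x y y + fderiv ℝ ψ x a)
        (fderiv ℝ ψ x z) := by
  have hψ2 : ContDiffAt ℝ 2 ψ x := hψ.of_le (natCast_le_smooth 2)
  have hL2 : ContDiffAt ℝ 2 L' (ψ x, fderiv ℝ ψ x y) := hL'.of_le (natCast_le_smooth 2)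
  have hψ' : ContDiffAt ℝ 1 (fderiv ℝ ψ) x := hψ2.fderiv_right (by norm_num)
  -- first derivatives at all nearby points
  let Ψ : E × E → E × E := fun q => (ψ q.1, fderiv ℝ ψ q.1 q.2)
  have hΨ : ∀ q : E × E, ContDiffAt ℝ 2 ψ q.1 → HasFDerivAt Ψ
      (((fderiv ℝ ψ q.1).comp (ContinuousLinearMap.fst ℝ E E)).prod
        ((fderiv ℝ ψ q.1).comp (ContinuousLinearMap.snd ℝ E E) +
          ((fderiv ℝ (fderiv ℝ ψ) q.1).comp (ContinuousLinearMap.fst ℝ E E)).flip q.2)) q := by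
    intro q hq
    have h1 : HasFDerivAt ψ (fderiv ℝ ψ q.1) q.1 := (hq.differentiableAt (by simp)).hasFDerivAt
    have h2 : HasFDerivAt (fderiv ℝ ψ) (fderiv ℝ (fderiv ℝ ψ) q.1) q.1 :=
      ((hq.fderiv_right (m := 1) (by norm_num)).differentiableAt (by simp)).hasFDerivAt
    exact (h1.comp q hasFDerivAt_fst).prodMk ((h2.comp q hasFDerivAt_fst).clm_apply hasFDerivAt_snd)
  have hev1 : ∀ᶠ q : E × E in 𝓝 (x, y), ContDiffAt ℝ 2 ψ q.1 :=
    continuous_fst.continuousAt.eventually (hψ2.eventually (by simp))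
  have hΨc : ContinuousAt Ψ (x, y) := (hΨ (x, y) hψ2).continuousAt
  have hev2 : ∀ᶠ q : E × E in 𝓝 (x, y), ContDiffAt ℝ 2 L' (Ψ q) :=
    hΨc.eventually (hL2.eventually (by simp))
  have hD : ∀ᶠ q : E × E in 𝓝 (x, y), ∀ k : E × E, fderiv ℝ L q k =
      fderiv ℝ L' (Ψ q) (fderiv ℝ ψ q.1 k.1,
        fderiv ℝ ψ q.1 k.2 + fderiv ℝ (fderiv ℝ ψ) q.1 k.1 q.2) := by
    filter_upwards [hev1, hev2, h.eventually_nhds] with q h1 h2 h3 k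
    have h4 := ((h2.differentiableAt (by simp)).hasFDerivAt.comp q (hΨ q h1)).congr_of_eventuallyEq
      (show L =ᶠ[𝓝 q] L' ∘ Ψ from h3)
    rw [h4.fderiv]
    simp
  -- the vertical derivative, differentiated once more
  have hDL' : HasFDerivAt (fderiv ℝ L') (fderiv ℝ (fderiv ℝ L') (Ψ (x, y))) (Ψ (x, y)) :=
    ((hL2.fderiv_right (m := 1) (by norm_num)).differentiableAt (by simp)).hasFDerivAt
  have hDψ : HasFDerivAt (fderiv ℝ ψ) (fderiv ℝ (fderiv ℝ ψ) x) x :=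
    (hψ'.differentiableAt (by simp)).hasFDerivAt
  have hu : HasFDerivAt (fun q : E × E => ((0 : E), fderiv ℝ ψ q.1 z)) _ (x, y) :=
    (hasFDerivAt_const (0 : E) (x, y)).prodMk
      ((hDψ.comp (x, y) hasFDerivAt_fst).clm_apply (hasFDerivAt_const z (x, y)))
  have hV := (hDL'.comp (x, y) (hΨ (x, y) hψ2)).clm_apply hu
  have hL2x : ContDiffAt ℝ 2 L (x, y) := by
    have hΨ2 : ContDiffAt ℝ 2 Ψ (x, y) := by
      have e1 : ContDiffAt ℝ 2 (fderiv ℝ ψ) x :=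
        (hψ.of_le (m := 3) (natCast_le_smooth 3)).fderiv_right (by norm_num)
      exact (hψ2.comp (x, y) contDiffAt_fst).prodMk
        ((e1.comp (x, y) contDiffAt_fst).clm_apply contDiffAt_snd)
    exact (ContDiffAt.comp (x, y) hL2 hΨ2).congr_of_eventuallyEq h
  have hDL : HasFDerivAt (fderiv ℝ L) (fderiv ℝ (fderiv ℝ L) (x, y)) (x, y) :=
    ((hL2x.fderiv_right (m := 1) (by norm_num)).differentiableAt (by simp)).hasFDerivAt
  have hV' := (hDL.clm_apply (hasFDerivAt_const ((0 : E), z) (x, y))).congr_of_eventuallyEq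
    (f₁ := fun q => fderiv ℝ L' (Ψ q) (0, fderiv ℝ ψ q.1 z))
    (by filter_upwards [hD] with q hq; rw [hq]; simp)
  have key := congrArg (fun T : E × E →L[ℝ] ℝ => T (y, a)) (hV'.unique hV)
  have hsym : fderiv ℝ (fderiv ℝ ψ) x z y = fderiv ℝ (fderiv ℝ ψ) x y z :=
    (hψ.isSymmSndFDerivAt (by simpa using natCast_le_smooth 2)) z y
  have hx0 := hD.self_of_nhds (z, 0)
  simp at key
  simp only [map_zero, zero_add, hsym] at hx0
  have hsplit : fderiv ℝ L' (Ψ (x, y)) (fderiv ℝ ψ x z, fderiv ℝ (fderiv ℝ ψ) x y z) =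
      fderiv ℝ L' (Ψ (x, y)) (fderiv ℝ ψ x z, 0) +
        fderiv ℝ L' (Ψ (x, y)) (0, fderiv ℝ (fderiv ℝ ψ) x y z) := by
    rw [← map_add]; simp
  rw [eulerLagrange_apply, eulerLagrange_apply, hx0, hsplit, key]
  change _ = fderiv ℝ (fderiv ℝ L') (Ψ (x, y)) _ _ - fderiv ℝ L' (Ψ (x, y)) _
  rw [add_comm (fderiv ℝ ψ x a)]
  ring

/-- The differential that a function `φ` must have at `x`, in order that curves with `2`-jet
`(x, y, a)` are extremal for `exp(2φ) L` and parametrized by arc length for `exp(φ) F`. -/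
def conformalCovector (L : E × E → ℝ) (x y a : E) : E →L[ℝ] ℝ :=
  (1 / (2 * L (x, y))) • eulerLagrange L x y a -
    (2 * (1 / (2 * L (x, y))) ^ 2 * fderiv ℝ L (x, y) (y, a)) •
      (fderiv ℝ L (x, y)).comp (ContinuousLinearMap.inr ℝ E E)

theorem conformalCovector_apply (L : E × E → ℝ) (x y a z : E) :
    conformalCovector L x y a z = (1 / (2 * L (x, y))) * eulerLagrange L x y a z -
      2 * (1 / (2 * L (x, y))) ^ 2 * fderiv ℝ L (x, y) (y, a) * fderiv ℝ L (x, y) (0, z) := by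
  simp [conformalCovector]

theorem contDiffOn_conformalCovector {L : E × E → ℝ} {Ω : Set E} (hL : IsFinslerLagrangian L Ω) :
    ContDiffOn ℝ ∞ (fun q : (E × E) × E => conformalCovector L q.1.1 q.1.2 q.2)
      ((Ω ×ˢ {0}ᶜ) ×ˢ univ) := by
  have h1 : ContDiffOn ℝ ∞ (fun q : (E × E) × E => fderiv ℝ L q.1) ((Ω ×ˢ {0}ᶜ) ×ˢ univ) :=
    hL.contDiffOn_fderiv.comp contDiff_fst.contDiffOn (fun q hq => hq.1)
  have h2 : ContDiffOn ℝ ∞ (fun q : (E × E) × E => 1 / (2 * L q.1)) ((Ω ×ˢ {0}ᶜ) ×ˢ univ) := by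
    refine contDiffOn_const.div (contDiffOn_const.mul
      (hL.smooth.comp contDiff_fst.contDiffOn (fun q hq => hq.1))) fun q hq => ?_
    have : 0 < L q.1 := hL.pos _ hq.1.1 _ hq.1.2
    positivity
  have h3 : ContDiff ℝ ∞ (fun q : (E × E) × E => (q.1.2, q.2)) := by fun_prop
  exact (h2.smul hL.contDiffOn_eulerLagrange).sub
    (((contDiffOn_const.mul (h2.pow 2)).mul (h1.clm_apply h3.contDiffOn)).smul
      (h1.clm_comp contDiffOn_const))

/-- The prescribed differential is compatible with the prescribed values `-log(2L)/2` of `φ` along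
the curve. -/
theorem conformalCovector_self {L : E × E → ℝ} {Ω : Set E} (hL : IsFinslerLagrangian L Ω)
    {x y : E} (hx : x ∈ Ω) (hy : y ≠ 0) (a : E) :
    conformalCovector L x y a y = -(1 / (2 * L (x, y)) * fderiv ℝ L (x, y) (y, a)) := by
  have hp := hL.pos x hx y hy
  rw [conformalCovector_apply, hL.eulerLagrange_self hx hy, hL.fderiv_vertical_self hx hy]
  field_simp
  ring

theorem conformalCovector_eq_zero {L : E × E → ℝ} {Ω : Set E} (hL : IsFinslerLagrangian L Ω)
    {x y a : E} (hx : x ∈ Ω) (hy : y ≠ 0) (h : eulerLagrange L x y a = 0) :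
    conformalCovector L x y a = 0 := by
  have h1 : fderiv ℝ L (x, y) (y, a) = 0 := by rw [← hL.eulerLagrange_self hx hy, h]; simp
  ext z
  rw [conformalCovector_apply, h, h1]
  simp

/-- A jet that is normalized for `exp(2φ) L` is extremal if `φ` has the prescribed differential. -/
theorem eulerLagrange_conformal {L : E × E → ℝ} {Ω : Set E} (hL : IsFinslerLagrangian L Ω)
    {x y a : E} (hx : x ∈ Ω) (hy : y ≠ 0) {φ : E → ℝ} (hφ : ContDiffAt ℝ ∞ φ x)
    (h1 : Real.exp (2 * φ x) * (2 * L (x, y)) = 1)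
    (h2 : fderiv ℝ φ x = conformalCovector L x y a) :
    eulerLagrange (fun q => Real.exp (2 * φ q.1) * L q) x y a = 0 := by
  have hφ1 : ∀ᶠ q : E × E in 𝓝 (x, y), ContDiffAt ℝ 1 φ q.1 :=
    continuous_fst.continuousAt.eventually
      ((hφ.of_le (m := 1) (natCast_le_smooth 1)).eventually (by simp))
  have hexp : ∀ q : E × E, ContDiffAt ℝ 1 φ q.1 →
      HasFDerivAt (fun q : E × E => Real.exp (2 * φ q.1))
        (Real.exp (2 * φ q.1) • (2 : ℝ) • (fderiv ℝ φ q.1).comp (ContinuousLinearMap.fst ℝ E E)) q := by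
    intro q hq
    have e1 : HasFDerivAt φ (fderiv ℝ φ q.1) q.1 := (hq.differentiableAt (by simp)).hasFDerivAt
    exact ((e1.comp q hasFDerivAt_fst).const_mul 2).exp
  have hD : ∀ᶠ q : E × E in 𝓝 (x, y), ∀ k : E × E,
      fderiv ℝ (fun q => Real.exp (2 * φ q.1) * L q) q k =
        Real.exp (2 * φ q.1) * (fderiv ℝ L q k + 2 * L q * fderiv ℝ φ q.1 k.1) := by
    filter_upwards [hφ1, hL.isOpen_slit.mem_nhds (⟨hx, hy⟩ : (x, y) ∈ Ω ×ˢ ({0}ᶜ : Set E))]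
      with q hq1 hq2 k
    have e1 := ((hexp q hq1).mul (hL.hasFDerivAt hq2.1 hq2.2)).fderiv
    change fderiv ℝ (fun q : E × E => Real.exp (2 * φ q.1) * L q) q = _ at e1
    rw [e1]
    simp
    ring
  have hsm : ContDiffAt ℝ 2 (fun q : E × E => Real.exp (2 * φ q.1) * L q) (x, y) :=
    ((contDiffAt_const.mul ((hφ.of_le (natCast_le_smooth 2)).comp (x, y)
      contDiffAt_fst)).exp).mul ((hL.contDiffAt hx hy).of_le (natCast_le_smooth 2))
  have hDL : HasFDerivAt (fderiv ℝ (fun q => Real.exp (2 * φ q.1) * L q)) _ (x, y) :=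
    ((hsm.fderiv_right (m := 1) (by norm_num)).differentiableAt (by simp)).hasFDerivAt
  ext z
  have hV' := (hDL.clm_apply (hasFDerivAt_const ((0 : E), z) (x, y))).congr_of_eventuallyEq
    (f₁ := fun q => Real.exp (2 * φ q.1) * fderiv ℝ L q (0, z))
    (by filter_upwards [hD] with q hq; rw [hq]; simp)
  have hV := (hexp (x, y) hφ1.self_of_nhds).mul
    ((hL.hasFDerivAt_fderiv hx hy).clm_apply (hasFDerivAt_const ((0 : E), z) (x, y)))
  have key := congrArg (fun T : E × E →L[ℝ] ℝ => T (y, a)) (hV'.unique hV)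
  simp only [add_apply, smul_apply, smul_eq_mul,
    ContinuousLinearMap.comp_apply, ContinuousLinearMap.flip_apply, ContinuousLinearMap.coe_fst',
    zero_apply, map_zero, zero_add, h2, conformalCovector_self hL hx hy] at key
  rw [eulerLagrange_apply, key, hD.self_of_nhds (z, 0), h2, conformalCovector_apply,
    eulerLagrange_apply]
  have hp := hL.pos x hx y hy
  have hexpv : Real.exp (2 * φ x) = 1 / (2 * L (x, y)) := by
    field_simp; linarith
  simp only [hexpv, zero_apply]
  field_simp
  ring

end Jets

/-! ### The metric coefficients and the geodesic coefficients in terms of the energy -/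

theorem HasFDerivAt.hasDerivAt_vertical {E G : Type*} [NormedAddCommGroup E] [NormedSpace ℝ E]
    [NormedAddCommGroup G] [NormedSpace ℝ G] {f : E × E → G} {f' : E × E →L[ℝ] G} {x y : E}
    (h : HasFDerivAt f f' (x, y)) (w : E) :
    HasDerivAt (fun t : ℝ => f (x, y + t • w)) (f' (0, w)) 0 := by
  have := h.hasLineDerivAt (0, w)
  simpa [HasLineDerivAt] using this

theorem HasFDerivAt.hasDerivAt_horizontal {E G : Type*} [NormedAddCommGroup E] [NormedSpace ℝ E]
    [NormedAddCommGroup G] [NormedSpace ℝ G] {f : E × E → G} {f' : E × E →L[ℝ] G} {x y : E}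
    (h : HasFDerivAt f f' (x, y)) (w : E) :
    HasDerivAt (fun t : ℝ => f (x + t • w, y)) (f' (w, 0)) 0 := by
  have := h.hasLineDerivAt (w, 0)
  simpa [HasLineDerivAt] using this

/-- The iterated derivative along lines in the definition of `fundTensor` is a value of the second
Fréchet derivative of the energy. -/
theorem fundTensor_eq_fderiv {E : Type*} [NormedAddCommGroup E] [NormedSpace ℝ E] {L : E × E → ℝ}
    {Ω : Set E} (hΩ : IsOpen Ω) (hL : ContDiffOn ℝ ∞ L (Ω ×ˢ {0}ᶜ)) {x : E} (hx : x ∈ Ω) {f : E → ℝ}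
    (hf : ∀ y, L (x, y) = f y ^ 2 / 2) {y : E} (hy : y ≠ 0) (u w : E) :
    fundTensor f y u w = fderiv ℝ (fderiv ℝ L) (x, y) (0, u) (0, w) := by
  have hO : IsOpen (Ω ×ˢ ({0}ᶜ : Set E)) := hΩ.prod isOpen_compl_singleton
  have hL1 : ∀ y', y' ≠ 0 → HasFDerivAt L (fderiv ℝ L (x, y')) (x, y') := fun y' hy' =>
    ((hL.contDiffAt (hO.mem_nhds (mk_mem_prod hx hy'))).differentiableAt (by simp)).hasFDerivAt
  have hL2 : HasFDerivAt (fderiv ℝ L) (fderiv ℝ (fderiv ℝ L) (x, y)) (x, y) :=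
    (((hL.contDiffAt (hO.mem_nhds (mk_mem_prod hx hy))).fderiv_right (m := ∞)
      (by simp)).differentiableAt (by simp)).hasFDerivAt
  have hf' : ∀ y, f y ^ 2 = 2 * L (x, y) := fun y => by rw [hf]; ring
  have h1 : ∀ y', y' ≠ 0 → deriv (fun t : ℝ => f (y' + t • w) ^ 2) 0 =
      2 * fderiv ℝ L (x, y') (0, w) := by
    intro y' hy'
    have hd := ((hL1 y' hy').hasDerivAt_vertical w).const_mul 2
    simp only [hf']
    exact hd.deriv
  have hcont : ∀ᶠ s : ℝ in 𝓝 0, y + s • u ≠ 0 := by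
    have : ContinuousAt (fun s : ℝ => y + s • u) 0 := by fun_prop
    exact this.eventually_ne (by simpa using hy)
  have h2 : (fun s : ℝ => deriv (fun t : ℝ => f (y + s • u + t • w) ^ 2) 0) =ᶠ[𝓝 0]
      fun s => 2 * fderiv ℝ L (x, y + s • u) (0, w) := by
    filter_upwards [hcont] with s hs using h1 _ hs
  have hd := ((hL2.hasDerivAt_vertical u).clm_apply
    (hasDerivAt_const (0 : ℝ) ((0 : E), w))).const_mul 2
  rw [fundTensor, h2.deriv_eq, hd.deriv]
  simp

section Coordinates

variable {n : ℕ} {M : Type*} [TopologicalSpace M] [ChartedSpace (Eucl n) M]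

/-- The energy `F²/2` in the chart `e`, as a function of position and velocity. -/
def chartLagrangian (F : ∀ x : M, TangentSpace (𝓡 n) x → ℝ) (e : OpenPartialHomeomorph M (Eucl n))
    (q : Eucl n × Eucl n) : ℝ :=
  coordF F e q.1 q.2 ^ 2 / 2

variable {F : ∀ x : M, TangentSpace (𝓡 n) x → ℝ} {e : OpenPartialHomeomorph M (Eucl n)}
  {Ω : Set (Eucl n)}

theorem sum_smul_stdVec (y : Eucl n) : ∑ i, y i • stdVec i = y := by
  ext j
  simp [Finset.sum_apply, Pi.single_apply]

theorem metricCoeff_eq (hL : IsFinslerLagrangian (chartLagrangian F e) Ω) {x y : Eucl n}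
    (hx : x ∈ Ω) (hy : y ≠ 0) (i j : Fin n) :
    metricCoeff F e x y i j =
      fderiv ℝ (fderiv ℝ (chartLagrangian F e)) (x, y) (0, stdVec i) (0, stdVec j) :=
  fundTensor_eq_fderiv hL.isOpen hL.smooth hx (fun _ => rfl) hy _ _

theorem hasDerivAt_metricCoeff (hL : IsFinslerLagrangian (chartLagrangian F e) Ω) {x y : Eucl n}
    (hx : x ∈ Ω) (hy : y ≠ 0) (k i j : Fin n) :
    HasDerivAt (fun t : ℝ => metricCoeff F e (x + t • stdVec k) y i j)
      (metricCoeffDeriv F e k i j x y) 0 := by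
  have hc : Continuous fun t : ℝ => x + t • (stdVec k : Eucl n) := by fun_prop
  have hev : ∀ᶠ t : ℝ in 𝓝 0, x + t • (stdVec k : Eucl n) ∈ Ω :=
    hc.continuousAt.eventually_mem (by simpa using hL.isOpen.mem_nhds hx)
  have h1 : (fun t : ℝ => metricCoeff F e (x + t • stdVec k) y i j) =ᶠ[𝓝 0] fun t =>
      fderiv ℝ (fderiv ℝ (chartLagrangian F e)) (x + t • stdVec k, y) (0, stdVec i)
        (0, stdVec j) := by
    filter_upwards [hev] with t ht using metricCoeff_eq hL ht hy i j
  refine DifferentiableAt.hasDerivAt (DifferentiableAt.congr_of_eventuallyEq ?_ h1)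
  have h2 : DifferentiableAt ℝ (fderiv ℝ (fderiv ℝ (chartLagrangian F e)))
      (x + (0 : ℝ) • (stdVec k : Eucl n), y) := by
    rw [zero_smul, add_zero]
    exact (hL.contDiffOn_fderiv_fderiv.contDiffAt
      (hL.isOpen_slit.mem_nhds (mk_mem_prod hx hy))).differentiableAt (by simp)
  have h3 : DifferentiableAt ℝ (fun t : ℝ => (x + t • (stdVec k : Eucl n), y)) 0 := by fun_prop
  exact ((h2.comp (0 : ℝ) h3).clm_apply (differentiableAt_const _)).clm_apply
    (differentiableAt_const _)

theorem sum_metricCoeff_mul (hL : IsFinslerLagrangian (chartLagrangian F e) Ω) {x y : Eucl n}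
    (hx : x ∈ Ω) (hy : y ≠ 0) (l : Fin n) (a : Eucl n) :
    ∑ i, metricCoeff F e x y l i * a i =
      fderiv ℝ (fderiv ℝ (chartLagrangian F e)) (x, y) (0, stdVec l) (0, a) := by
  have h : ((0 : Eucl n), a) = ∑ i, a i • ((0 : Eucl n), (stdVec i : Eucl n)) := by
    ext1
    · simp [Prod.fst_sum]
    · simp only [Prod.snd_sum, Prod.smul_snd]
      exact (sum_smul_stdVec a).symm
  rw [h, map_sum]
  refine Finset.sum_congr rfl fun i _ => ?_
  rw [metricCoeff_eq hL hx hy, map_smul, smul_eq_mul, mul_comm]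

/-- Contracted with the velocity, the derivatives of the metric coefficients become first
derivatives of the energy. -/
theorem sum_metricCoeffDeriv (hL : IsFinslerLagrangian (chartLagrangian F e) Ω) {x y : Eucl n}
    (hx : x ∈ Ω) (hy : y ≠ 0) (l : Fin n) :
    ∑ i, ∑ j, (2 * metricCoeffDeriv F e j l i x y - metricCoeffDeriv F e l i j x y) * y i * y j =
      2 * eulerLagrange (chartLagrangian F e) x y 0 (stdVec l) := by
  set L := chartLagrangian F e with hLdef
  have hev : ∀ k : Fin n, ∀ᶠ t : ℝ in 𝓝 0, x + t • (stdVec k : Eucl n) ∈ Ω := fun k => by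
    have hc : Continuous fun t : ℝ => x + t • (stdVec k : Eucl n) := by fun_prop
    exact hc.continuousAt.eventually_mem (by simpa using hL.isOpen.mem_nhds hx)
  have h1 : ∀ k, ∑ i, metricCoeffDeriv F e k l i x y * y i =
      fderiv ℝ (fderiv ℝ L) (x, y) (stdVec k, 0) (0, stdVec l) := by
    intro k
    have hs := HasDerivAt.fun_sum (u := Finset.univ)
      (fun i _ => (hasDerivAt_metricCoeff hL hx hy k l i).mul_const (y i))
    have hd := ((hL.hasFDerivAt_fderiv hx hy).hasDerivAt_horizontal (stdVec k)).clm_apply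
      (hasDerivAt_const (0 : ℝ) ((0 : Eucl n), (stdVec l : Eucl n)))
    simp only [map_zero, add_zero] at hd
    refine hs.unique (hd.congr_of_eventuallyEq ?_)
    filter_upwards [hev k] with t ht
    rw [sum_metricCoeff_mul hL ht hy, hL.vertical_hessian_self ht hy]
  have h2 : ∑ i, ∑ j, metricCoeffDeriv F e l i j x y * y i * y j =
      2 * fderiv ℝ L (x, y) (stdVec l, 0) := by
    have hs := HasDerivAt.fun_sum (u := Finset.univ) fun i _ =>
      HasDerivAt.fun_sum (u := Finset.univ) fun j _ =>
        ((hasDerivAt_metricCoeff hL hx hy l i j).mul_const (y i)).mul_const (y j)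
    have hd := ((hL.hasFDerivAt hx hy).hasDerivAt_horizontal (stdVec l)).const_mul 2
    refine hs.unique (hd.congr_of_eventuallyEq ?_)
    filter_upwards [hev l] with t ht
    have e1 : ∀ i, ∑ j, metricCoeff F e (x + t • stdVec l) y i j * y i * y j =
        y i * fderiv ℝ L (x + t • stdVec l, y) (0, stdVec i) := by
      intro i
      rw [← hL.vertical_hessian_self ht hy, ← sum_metricCoeff_mul hL ht hy, Finset.mul_sum]
      exact Finset.sum_congr rfl fun j _ => by ring
    have e2 : ((0 : Eucl n), y) = ∑ i, y i • ((0 : Eucl n), (stdVec i : Eucl n)) := by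
      ext1
      · simp [Prod.fst_sum]
      · simp only [Prod.snd_sum, Prod.smul_snd]
        exact (sum_smul_stdVec y).symm
    simp only [e1]
    rw [← hL.fderiv_vertical_self ht hy]
    conv_rhs => rw [e2, map_sum]
    exact Finset.sum_congr rfl fun i _ => by rw [map_smul, smul_eq_mul]
  have h3 : ((y : Eucl n), (0 : Eucl n)) = ∑ j, y j • ((stdVec j : Eucl n), (0 : Eucl n)) := by
    ext1
    · simp only [Prod.fst_sum, Prod.smul_fst]
      exact (sum_smul_stdVec y).symm
    · simp [Prod.snd_sum]
  rw [eulerLagrange_apply, h3, map_sum, sum_apply]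
  simp only [map_smul, smul_apply, smul_eq_mul, ← h1]
  rw [mul_sub, ← h2, Finset.mul_sum]
  simp only [sub_mul, Finset.sum_sub_distrib]
  congr 1
  rw [Finset.sum_comm]
  refine Finset.sum_congr rfl fun j _ => ?_
  rw [Finset.mul_sum, Finset.mul_sum]
  exact Finset.sum_congr rfl fun i _ => by ring

theorem isUnit_det_metricCoeff (hL : IsFinslerLagrangian (chartLagrangian F e) Ω) {x y : Eucl n}
    (hx : x ∈ Ω) (hy : y ≠ 0) : IsUnit (metricCoeff F e x y).det := by
  rw [isUnit_iff_ne_zero]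
  intro h0
  obtain ⟨a, ha, hva⟩ := Matrix.exists_mulVec_eq_zero_iff.2 h0
  have ha' : (WithLp.toLp 2 a : Eucl n) ≠ 0 := fun h => ha (by simpa using h)
  have hpos := hL.legendre x hx y _ hy ha'
  have hzero : ∀ l, fderiv ℝ (fderiv ℝ (chartLagrangian F e)) (x, y) (0, stdVec l)
      (0, (WithLp.toLp 2 a : Eucl n)) = 0 := by
    intro l
    rw [← sum_metricCoeff_mul hL hx hy]
    exact congrFun hva l
  have h : ((0 : Eucl n), (WithLp.toLp 2 a : Eucl n)) =
      ∑ i, a i • ((0 : Eucl n), (stdVec i : Eucl n)) := by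
    ext1
    · simp [Prod.fst_sum]
    · simp only [Prod.snd_sum, Prod.smul_snd]
      exact (sum_smul_stdVec (WithLp.toLp 2 a : Eucl n)).symm
  have : fderiv ℝ (fderiv ℝ (chartLagrangian F e)) (x, y) (0, (WithLp.toLp 2 a : Eucl n))
      (0, (WithLp.toLp 2 a : Eucl n)) = 0 := by
    conv_lhs => enter [1]; rw [h, map_sum]
    rw [sum_apply]
    exact Finset.sum_eq_zero fun i _ => by rw [map_smul, smul_apply, hzero, smul_zero]
  exact hpos.ne' this

/-- The geodesic equation `a + 2 G(x, y) = 0` is the Euler-Lagrange equation of the energy. -/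
theorem geodesic_equation_iff (hL : IsFinslerLagrangian (chartLagrangian F e) Ω) {x y : Eucl n}
    (hx : x ∈ Ω) (hy : y ≠ 0) (a : Eucl n) :
    (∀ k, a k + 2 * geodesicCoeff F e k x y = 0) ↔ eulerLagrange (chartLagrangian F e) x y a = 0 := by
  have hdet := isUnit_det_metricCoeff hL hx hy
  set g := metricCoeff F e x y with hg
  set b : Fin n → ℝ := fun l => eulerLagrange (chartLagrangian F e) x y 0 (stdVec l) with hb
  have hG : ∀ k, 2 * geodesicCoeff F e k x y = (g⁻¹.mulVec b) k := by
    intro k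
    simp only [geodesicCoeff, sum_metricCoeffDeriv hL hx hy]
    simp only [Matrix.mulVec, dotProduct, Finset.mul_sum]
    exact Finset.sum_congr rfl fun l _ => by ring
  have h1 : ∀ l, eulerLagrange (chartLagrangian F e) x y a (stdVec l) = (g.mulVec a) l + b l := by
    intro l
    rw [eulerLagrange_eq_add, add_apply, verticalHessian_apply,
      hL.fderiv_fderiv_vertical_comm hx hy, ← sum_metricCoeff_mul hL hx hy]
    rfl
  have h2 : eulerLagrange (chartLagrangian F e) x y a = 0 ↔ g.mulVec a + b = 0 := by
    constructor
    · intro h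
      ext l
      rw [Pi.add_apply, ← h1, h]
      rfl
    · intro h
      ext z
      rw [← sum_smul_stdVec z, map_sum]
      refine (Finset.sum_eq_zero fun l _ => ?_).trans (by simp)
      rw [map_smul, h1]
      have := congrFun h l
      rw [Pi.add_apply] at this
      rw [this, Pi.zero_apply, smul_zero]
  rw [h2]
  simp only [hG]
  constructor
  · intro h
    have h3 : (a : Fin n → ℝ) = -(g⁻¹.mulVec b) := by
      ext k
      have := h k
      rw [Pi.neg_apply]
      linarith
    rw [h3, Matrix.mulVec_neg, Matrix.mulVec_mulVec, Matrix.mul_nonsing_inv _ hdet,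
      Matrix.one_mulVec, neg_add_cancel]
  · intro h k
    have h3 : b = -(g.mulVec a) := by
      rw [eq_neg_iff_add_eq_zero, add_comm]; exact h
    rw [h3, Matrix.mulVec_neg, Matrix.mulVec_mulVec, Matrix.nonsing_inv_mul _ hdet,
      Matrix.one_mulVec, Pi.neg_apply]
    ring

end Coordinates

/-! ### Finsler metrics in charts -/

section Charts

variable {n : ℕ} {M : Type*} [TopologicalSpace M] [ChartedSpace (Eucl n) M]
  {F : ∀ x : M, TangentSpace (𝓡 n) x → ℝ} {e e' : OpenPartialHomeomorph M (Eucl n)}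

theorem mdifferentiable_of_mem_maximalAtlas (he : e ∈ IsManifold.maximalAtlas (𝓡 n) ∞ M) :
    e.MDifferentiable (𝓡 n) (𝓡 n) :=
  ⟨(contMDiffOn_of_mem_maximalAtlas he).mdifferentiableOn (by simp),
    (contMDiffOn_symm_of_mem_maximalAtlas he).mdifferentiableOn (by simp)⟩

theorem mfderiv_chart_symm_ne_zero (he : e ∈ IsManifold.maximalAtlas (𝓡 n) ∞ M) {x y : Eucl n}
    (hx : x ∈ e.target) (hy : y ≠ 0) : mfderiv (𝓡 n) (𝓡 n) e.symm x y ≠ 0 := by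
  intro h
  refine hy ((mdifferentiable_of_mem_maximalAtlas he).symm.mfderiv_injective hx ?_)
  exact h.trans (map_zero (mfderiv (𝓡 n) (𝓡 n) e.symm x)).symm

/-- Transport of the value of `F` along an equality of base points. -/
theorem finsler_congr (F : ∀ x : M, TangentSpace (𝓡 n) x → ℝ) {a b : M} (h : a = b) (z : Eucl n) :
    F a z = F b z := by
  subst h; rfl

/-- The change of coordinates from `e` to `e'`. -/
def transition (e e' : OpenPartialHomeomorph M (Eucl n)) (x : Eucl n) : Eucl n := e' (e.symm x)

theorem contDiffAt_transition (he : e ∈ IsManifold.maximalAtlas (𝓡 n) ∞ M)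
    (he' : e' ∈ IsManifold.maximalAtlas (𝓡 n) ∞ M) {x : Eucl n} (hx : x ∈ e.target)
    (hx' : e.symm x ∈ e'.source) : ContDiffAt ℝ ∞ (transition e e') x :=
  contMDiffAt_iff_contDiffAt.1 (ContMDiffAt.comp x (contMDiffAt_of_mem_maximalAtlas he' hx')
    (contMDiffAt_symm_of_mem_maximalAtlas he hx))

theorem mem_domain_nhds {M : Type*} [TopologicalSpace M]
    {e e' : OpenPartialHomeomorph M (Eucl n)} {x : Eucl n} (hx : x ∈ e.target)
    (hx' : e.symm x ∈ e'.source) :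
    ∀ᶠ z in 𝓝 x, z ∈ e.target ∧ e.symm z ∈ e'.source :=
  (e.isOpen_inter_preimage_symm e'.open_source).mem_nhds ⟨hx, hx'⟩

theorem mfderiv_symm_transition (he : e ∈ IsManifold.maximalAtlas (𝓡 n) ∞ M)
    (he' : e' ∈ IsManifold.maximalAtlas (𝓡 n) ∞ M) {x : Eucl n} (hx : x ∈ e.target)
    (hx' : e.symm x ∈ e'.source) (y : Eucl n) :
    (mfderiv (𝓡 n) (𝓡 n) e.symm x y : Eucl n) =
      (mfderiv (𝓡 n) (𝓡 n) e'.symm (transition e e' x)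
        (fderiv ℝ (transition e e') x y) : Eucl n) := by
  have h1 : e.symm =ᶠ[𝓝 x] e'.symm ∘ transition e e' := by
    filter_upwards [mem_domain_nhds hx hx'] with z hz
    exact (e'.left_inv hz.2).symm
  have h2 : MDifferentiableAt (𝓡 n) (𝓡 n) (transition e e') x :=
    ((contDiffAt_transition he he' hx hx').differentiableAt (by simp)).mdifferentiableAt
  have h3 : MDifferentiableAt (𝓡 n) (𝓡 n) e'.symm (transition e e' x) :=
    (mdifferentiable_of_mem_maximalAtlas he').mdifferentiableAt_symm (e'.map_source hx')
  have h4 := (h3.hasMFDerivAt.comp x h2.hasMFDerivAt).congr_of_eventuallyEq h1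
  rw [h4.mfderiv, ← mfderiv_eq_fderiv]
  rfl

theorem coordF_transition (he : e ∈ IsManifold.maximalAtlas (𝓡 n) ∞ M)
    (he' : e' ∈ IsManifold.maximalAtlas (𝓡 n) ∞ M) {x : Eucl n} (hx : x ∈ e.target)
    (hx' : e.symm x ∈ e'.source) (y : Eucl n) :
    coordF F e x y = coordF F e' (transition e e' x) (fderiv ℝ (transition e e') x y) := by
  unfold coordF
  exact (congrArg (F (e.symm x)) (mfderiv_symm_transition he he' hx hx' y)).trans
    (finsler_congr F (e'.left_inv hx').symm _)

theorem fderiv_transition_comp (he : e ∈ IsManifold.maximalAtlas (𝓡 n) ∞ M)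
    (he' : e' ∈ IsManifold.maximalAtlas (𝓡 n) ∞ M) {x : Eucl n} (hx : x ∈ e.target)
    (hx' : e.symm x ∈ e'.source) (z : Eucl n) :
    fderiv ℝ (transition e' e) (transition e e' x) (fderiv ℝ (transition e e') x z) = z := by
  have h1 : HasFDerivAt (transition e e') (fderiv ℝ (transition e e') x) x :=
    ((contDiffAt_transition he he' hx hx').differentiableAt (by simp)).hasFDerivAt
  have hy : transition e e' x ∈ e'.target := e'.map_source hx'
  have hy' : e'.symm (transition e e' x) ∈ e.source := by
    rw [transition, e'.left_inv hx']; exact e.map_target hx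
  have h2 : HasFDerivAt (transition e' e) _ (transition e e' x) :=
    ((contDiffAt_transition he' he hy hy').differentiableAt (by simp)).hasFDerivAt
  have h3 : transition e' e ∘ transition e e' =ᶠ[𝓝 x] id := by
    filter_upwards [mem_domain_nhds hx hx'] with z hz
    simp only [Function.comp_apply, transition, id]
    rw [e'.left_inv hz.2, e.right_inv hz.1]
  have h4 := ((h2.comp x h1).congr_of_eventuallyEq h3.symm).unique (hasFDerivAt_id x)
  simpa using congrArg (fun T : Eucl n →L[ℝ] Eucl n => T z) h4

/-- The fundamental tensor of `F` in coordinates. -/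
theorem fundTensor_coordF (x y u w : Eucl n) :
    fundTensor (coordF F e x) y u w = fundTensor (F (e.symm x)) (mfderiv (𝓡 n) (𝓡 n) e.symm x y)
      (mfderiv (𝓡 n) (𝓡 n) e.symm x u) (mfderiv (𝓡 n) (𝓡 n) e.symm x w) := by
  have h : ∀ s t : ℝ, coordF F e x (y + s • u + t • w) =
      F (e.symm x) (mfderiv (𝓡 n) (𝓡 n) e.symm x y + s • mfderiv (𝓡 n) (𝓡 n) e.symm x u +
        t • mfderiv (𝓡 n) (𝓡 n) e.symm x w) := by
    intro s t
    refine congrArg (F (e.symm x)) ?_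
    refine (map_add (mfderiv (𝓡 n) (𝓡 n) e.symm x) (y + s • u) (t • w)).trans ?_
    refine congrArg₂ _ ?_ (map_smul _ _ _)
    refine (map_add (mfderiv (𝓡 n) (𝓡 n) e.symm x) y (s • u)).trans ?_
    exact congrArg₂ _ rfl (map_smul _ _ _)
  unfold fundTensor
  simp only [h]

theorem fundTensor_const_mul {V : Type*} [AddCommGroup V] [Module ℝ V] (c : ℝ) (f : V → ℝ)
    (y u w : V) : fundTensor (fun z => c * f z) y u w = c ^ 2 * fundTensor f y u w := by
  simp only [fundTensor, mul_pow, deriv_const_mul_field]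
  ring

variable {x : ℝ → Eucl n} {I : Set ℝ}

theorem isArcLengthOn_iff (he : e ∈ IsManifold.maximalAtlas (𝓡 n) ∞ M) (hI : UniqueDiffOn ℝ I)
    (hx : ContDiffOn ℝ ∞ x I) (hmem : ∀ t ∈ I, x t ∈ e.target) :
    IsArcLengthOn F (fun t => e.symm (x t)) I ↔ ∀ t ∈ I, coordF F e (x t) (derivWithin x I t) = 1 := by
  refine forall₂_congr fun t ht => ?_
  have h1 : MDifferentiableAt (𝓡 n) (𝓡 n) e.symm (x t) :=
    (mdifferentiable_of_mem_maximalAtlas he).mdifferentiableAt_symm (hmem t ht)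
  have h2 : HasMFDerivWithinAt 𝓘(ℝ, ℝ) (𝓡 n) x I t (fderivWithin ℝ x I t) :=
    (((hx.differentiableOn (by simp)) t ht).hasFDerivWithinAt).hasMFDerivWithinAt
  have h3 := (h1.hasMFDerivAt.comp_hasMFDerivWithinAt t h2).mfderivWithin
    (uniqueMDiffWithinAt_iff_uniqueDiffWithinAt.2 (hI t ht))
  change F (e.symm (x t)) (mfderivWithin 𝓘(ℝ, ℝ) (𝓡 n) (e.symm ∘ x) I t (1 : ℝ)) = 1 ↔ _
  rw [h3, coordF, ← fderivWithin_derivWithin]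
  rfl

variable [IsManifold (𝓡 n) ∞ M]

theorem contDiffOn_coordF (hF : IsFinslerMetric F)
    (he : e ∈ IsManifold.maximalAtlas (𝓡 n) ∞ M) :
    ContDiffOn ℝ ∞ (fun q : Eucl n × Eucl n => coordF F e q.1 q.2) (e.target ×ˢ {0}ᶜ) := by
  have h1 := (contMDiffOn_symm_of_mem_maximalAtlas he).contMDiffOn_tangentMapWithin
    (m := ∞) (by simp) e.open_target.uniqueMDiffOn
  have h2 := contMDiff_tangentBundleModelSpaceHomeomorph_symm (I := 𝓡 n) (n := ∞)
  have h3 := (hF.smooth.comp (t := {q : TangentBundle (𝓡 n) M | q.2 ≠ 0})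
    (s := {q : TangentBundle (𝓡 n) (Eucl n) | q.1 ∈ e.target ∧ q.2 ≠ 0})
    (h1.mono fun q hq => hq.1) (fun q hq => by
      change mfderivWithin (𝓡 n) (𝓡 n) e.symm e.target q.1 q.2 ≠ 0
      rw [mfderivWithin_of_isOpen e.open_target hq.1]
      exact mfderiv_chart_symm_ne_zero he hq.1 hq.2)).comp
    (s := {q : ModelProd (Eucl n) (Eucl n) | q.1 ∈ e.target ∧ q.2 ≠ 0}) h2.contMDiffOn
    (fun q hq => ⟨hq.1, hq.2⟩)
  have h4 : ContMDiffOn 𝓘(ℝ, Eucl n × Eucl n) 𝓘(ℝ, ℝ) ∞ (fun q : Eucl n × Eucl n =>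
      F (e.symm q.1) (mfderivWithin (𝓡 n) (𝓡 n) e.symm e.target q.1 q.2)) (e.target ×ˢ {0}ᶜ) := by
    rw [modelWithCornersSelf_prod]
    exact h3
  refine (contMDiffOn_iff_contDiffOn.1 h4).congr fun q hq => ?_
  rw [mfderivWithin_of_isOpen e.open_target hq.1]
  rfl

theorem isFinslerLagrangian_chartLagrangian (hF : IsFinslerMetric F)
    (he : e ∈ IsManifold.maximalAtlas (𝓡 n) ∞ M) :
    IsFinslerLagrangian (chartLagrangian F e) e.target := by
  have hsm : ContDiffOn ℝ ∞ (chartLagrangian F e) (e.target ×ˢ {0}ᶜ) :=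
    ((contDiffOn_coordF hF he).pow 2).div_const 2
  have hhom : ∀ (x y : Eucl n) (c : ℝ), 0 < c → coordF F e x (c • y) = c * coordF F e x y := by
    intro x y c hc
    rw [coordF, coordF, ← hF.homogeneous _ _ _ hc]
    exact congrArg _ (map_smul (mfderiv (𝓡 n) (𝓡 n) e.symm x) c y)
  have hpos : ∀ x ∈ e.target, ∀ y : Eucl n, y ≠ 0 → 0 < coordF F e x y := fun x hx y hy =>
    hF.pos _ _ (mfderiv_chart_symm_ne_zero he hx hy)
  refine ⟨e.open_target, hsm, fun x _ y c hc => ?_, fun x hx y hy => ?_, fun x hx y u hy hu => ?_⟩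
  · simp only [chartLagrangian, hhom x y c hc]; ring
  · have := hpos x hx y hy
    simp only [chartLagrangian]; positivity
  · -- the vertical Hessian is the fundamental tensor, transported by the chart
    have h1 := hF.legendre _ _ _ (mfderiv_chart_symm_ne_zero he hx hy)
      (mfderiv_chart_symm_ne_zero he hx hu)
    rw [← fundTensor_eq_fderiv e.open_target hsm hx (fun _ => rfl) hy u u, fundTensor_coordF]
    exact h1

theorem IsFinslerMetric.conformal (hF : IsFinslerMetric F) {φ : M → ℝ}
    (hφ : ContMDiff (𝓡 n) 𝓘(ℝ, ℝ) ∞ φ) : IsFinslerMetric (conformalMetric φ F) where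
  continuous := by
    have h1 : Continuous fun q : TangentBundle (𝓡 n) M => Real.exp (φ q.1) :=
      Real.continuous_exp.comp (hφ.continuous.comp (FiberBundle.continuous_proj _ _))
    exact h1.mul hF.continuous
  smooth := by
    have h1 : ContMDiff (𝓡 n).tangent 𝓘(ℝ, ℝ) ∞
        fun q : TangentBundle (𝓡 n) M => Real.exp (φ q.1) :=
      Real.contDiff_exp.contMDiff.comp (hφ.comp (Bundle.contMDiff_proj _))
    exact h1.contMDiffOn.mul hF.smooth
  pos := fun x y hy => mul_pos (Real.exp_pos _) (hF.pos x y hy)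
  homogeneous := fun x y a ha => by
    simp only [conformalMetric, hF.homogeneous x y a ha]; ring
  legendre := fun x y u hy hu => by
    have h1 := hF.legendre x y u hy hu
    have h2 : fundTensor (conformalMetric φ F x) y u u = _ :=
      fundTensor_const_mul (Real.exp (φ x)) (F x) y u u
    rw [h2]
    positivity

/-! ### Geodesics in charts -/

/-- A curve is a geodesic if it solves the Euler-Lagrange equation of the energy in one chart. -/
theorem isGeodesicOn_of_eulerLagrange (hF : IsFinslerMetric F)
    (he : e ∈ IsManifold.maximalAtlas (𝓡 n) ∞ M) (hI : UniqueDiffOn ℝ I)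
    (hx : ContDiffOn ℝ ∞ x I) (hmem : ∀ t ∈ I, x t ∈ e.target)
    (hne : ∀ t ∈ I, derivWithin x I t ≠ 0)
    (hEL : ∀ t ∈ I, eulerLagrange (chartLagrangian F e) (x t) (derivWithin x I t)
      (derivWithin (derivWithin x I) I t) = 0) :
    IsGeodesicOn F (fun t => e.symm (x t)) I := by
  refine ⟨(contMDiffOn_symm_of_mem_maximalAtlas he).comp (contMDiffOn_iff_contDiffOn.2 hx) hmem,
    fun t ht e' he' hte' => ?_⟩
  have hx1 : ContDiffOn ℝ ∞ (derivWithin x I) I := hx.derivWithin hI (by simp)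
  have hd : ∀ τ ∈ I, HasDerivWithinAt x (derivWithin x I τ) I τ := fun τ hτ =>
    ((hx.differentiableOn (by simp)) τ hτ).hasDerivWithinAt
  have hd1 : HasDerivWithinAt (derivWithin x I) (derivWithin (derivWithin x I) I t) I t :=
    ((hx1.differentiableOn (by simp)) t ht).hasDerivWithinAt
  have hev : ∀ᶠ τ in 𝓝[I] t, x τ ∈ e.target ∧ e.symm (x τ) ∈ e'.source :=
    (hx.continuousOn t ht).eventually (mem_domain_nhds (hmem t ht) hte')
  have hfirst : ∀ τ ∈ I, x τ ∈ e.target → e.symm (x τ) ∈ e'.source →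
      derivWithin (fun τ => e' (e.symm (x τ))) I τ =
        fderiv ℝ (transition e e') (x τ) (derivWithin x I τ) := by
    intro τ hτ h1 h2
    have h3 : HasFDerivAt (transition e e') (fderiv ℝ (transition e e') (x τ)) (x τ) :=
      ((contDiffAt_transition he he' h1 h2).differentiableAt (by simp)).hasFDerivAt
    exact (h3.comp_hasDerivWithinAt τ (hd τ hτ)).derivWithin (hI τ hτ)
  have hψ := contDiffAt_transition he he' (hmem t ht) hte'
  have hsecond : derivWithin (fun r => derivWithin (fun τ => e' (e.symm (x τ))) I r) I t =
      fderiv ℝ (fderiv ℝ (transition e e')) (x t) (derivWithin x I t) (derivWithin x I t) +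
        fderiv ℝ (transition e e') (x t) (derivWithin (derivWithin x I) I t) := by
    have h1 : (fun r => derivWithin (fun τ => e' (e.symm (x τ))) I r) =ᶠ[𝓝[I] t]
        fun r => fderiv ℝ (transition e e') (x r) (derivWithin x I r) := by
      filter_upwards [hev, self_mem_nhdsWithin] with r hr hrI using hfirst r hrI hr.1 hr.2
    rw [h1.derivWithin_eq_of_mem ht]
    have h2 : HasFDerivAt (fderiv ℝ (transition e e'))
        (fderiv ℝ (fderiv ℝ (transition e e')) (x t)) (x t) :=
      ((hψ.fderiv_right (m := ∞) (by simp)).differentiableAt (by simp)).hasFDerivAt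
    exact ((h2.comp_hasDerivWithinAt t (hd t ht)).clm_apply hd1).derivWithin (hI t ht)
  have hL' := isFinslerLagrangian_chartLagrangian hF he'
  have hty : transition e e' (x t) ∈ e'.target := e'.map_source hte'
  have hne' : fderiv ℝ (transition e e') (x t) (derivWithin x I t) ≠ 0 := by
    intro h0
    have := fderiv_transition_comp he he' (hmem t ht) hte' (derivWithin x I t)
    rw [h0, map_zero] at this
    exact hne t ht this.symm
  rw [hfirst t ht (hmem t ht) hte', hsecond]
  refine (geodesic_equation_iff hL' hty hne' _).2 ?_
  have hcomp := eulerLagrange_comp (L := chartLagrangian F e) (L' := chartLagrangian F e')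
    (y := derivWithin x I t) hψ (hL'.contDiffAt hty hne') (by
      have hc : ∀ᶠ q : Eucl n × Eucl n in 𝓝 (x t, derivWithin x I t),
          q.1 ∈ e.target ∧ e.symm q.1 ∈ e'.source :=
        continuous_fst.continuousAt.eventually (mem_domain_nhds (hmem t ht) hte')
      filter_upwards [hc] with q hq
      simp only [chartLagrangian, coordF_transition he he' hq.1 hq.2])
    (derivWithin (derivWithin x I) I t)
  ext z
  have hz : fderiv ℝ (transition e e') (x t)
      (fderiv ℝ (transition e' e) (transition e e' (x t)) z) = z := by
    have h5 : e'.symm (transition e e' (x t)) = e.symm (x t) := e'.left_inv hte'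
    have := fderiv_transition_comp he' he hty (by rw [h5]; exact e.map_target (hmem t ht)) z
    rwa [show transition e' e (transition e e' (x t)) = x t by
      rw [transition, h5, e.right_inv (hmem t ht)]] at this
  have := hcomp (fderiv ℝ (transition e' e) (transition e e' (x t)) z)
  rw [hz, hEL t ht] at this
  exact this.symm

/-- A geodesic satisfies the Euler-Lagrange equation of the energy in every chart. -/
theorem IsGeodesicOn.eulerLagrange_eq_zero (hF : IsFinslerMetric F)
    (he : e ∈ IsManifold.maximalAtlas (𝓡 n) ∞ M) (hmem : ∀ t ∈ I, x t ∈ e.target)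
    (h : IsGeodesicOn F (fun t => e.symm (x t)) I) {t : ℝ} (ht : t ∈ I)
    (hne : derivWithin x I t ≠ 0) :
    eulerLagrange (chartLagrangian F e) (x t) (derivWithin x I t)
      (derivWithin (derivWithin x I) I t) = 0 := by
  have hev : EqOn (fun τ => e (e.symm (x τ))) x I := fun τ hτ => e.right_inv (hmem τ hτ)
  have h1 : EqOn (derivWithin (fun τ => e (e.symm (x τ))) I) (derivWithin x I) I := fun τ hτ =>
    derivWithin_congr hev (hev hτ)
  have h2 := h.2 t ht e he (e.map_target (hmem t ht))
  rw [← geodesic_equation_iff (isFinslerLagrangian_chartLagrangian hF he) (hmem t ht) hne]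
  intro k
  have h3 := h2 k
  rw [h1 ht, derivWithin_congr h1 (h1 ht), e.right_inv (hmem t ht)] at h3
  exact h3

end Charts

/-! ### Families of shifted lines -/

section Shift

theorem hasDerivAt_slice {f : ℝ × ℝ → ℝ} {δ : ℝ} (hf : ContDiffOn ℝ ∞ f (Ioo (-δ) δ ×ˢ univ))
    {s : ℝ} (hs : |s| < δ) (t : ℝ) :
    HasDerivAt (fun τ => f (s, τ)) (fderiv ℝ f (s, t) (0, 1)) t := by
  have h1 : HasFDerivAt f (fderiv ℝ f (s, t)) (s, t) :=
    ((hf.contDiffAt ((isOpen_Ioo.prod isOpen_univ).mem_nhds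
      (mk_mem_prod (abs_lt.1 hs) (mem_univ t)))).differentiableAt (by simp)).hasFDerivAt
  exact h1.comp_hasDerivAt t ((hasDerivAt_const t s).prodMk (hasDerivAt_id t))

/-- The first derivative `∂u/∂t` of a family of functions `u_s(t)`. -/
def shiftVel (u : ℝ → ℝ → ℝ) (q : ℝ × ℝ) : ℝ := fderiv ℝ (fun q : ℝ × ℝ => u q.1 q.2) q (0, 1)

/-- The second derivative `∂²u/∂t²` of a family of functions `u_s(t)`. -/
def shiftAcc (u : ℝ → ℝ → ℝ) (q : ℝ × ℝ) : ℝ := fderiv ℝ (shiftVel u) q (0, 1)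

variable {u : ℝ → ℝ → ℝ} {δ η ε : ℝ}

theorem IsShiftFamily.contDiffOn_shiftVel (hu : IsShiftFamily u δ η ε) :
    ContDiffOn ℝ ∞ (shiftVel u) (Ioo (-δ) δ ×ˢ univ) :=
  (hu.smooth.fderiv_of_isOpen (isOpen_Ioo.prod isOpen_univ) (by simp)).clm_apply contDiffOn_const

theorem IsShiftFamily.contDiffOn_shiftAcc (hu : IsShiftFamily u δ η ε) :
    ContDiffOn ℝ ∞ (shiftAcc u) (Ioo (-δ) δ ×ˢ univ) :=
  (hu.contDiffOn_shiftVel.fderiv_of_isOpen (isOpen_Ioo.prod isOpen_univ) (by simp)).clm_apply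
    contDiffOn_const

theorem IsShiftFamily.hasDerivAt (hu : IsShiftFamily u δ η ε) {s : ℝ} (hs : |s| < δ) (t : ℝ) :
    HasDerivAt (u s) (shiftVel u (s, t)) t :=
  hasDerivAt_slice hu.smooth hs t

theorem IsShiftFamily.hasDerivAt_shiftVel (hu : IsShiftFamily u δ η ε) {s : ℝ} (hs : |s| < δ)
    (t : ℝ) : HasDerivAt (fun τ => shiftVel u (s, τ)) (shiftAcc u (s, t)) t :=
  hasDerivAt_slice hu.contDiffOn_shiftVel hs t

theorem IsShiftFamily.flat_of_eventually_const (hu : IsShiftFamily u δ η ε) {s t c : ℝ}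
    (hs : |s| < δ) (h : ∀ᶠ τ in 𝓝 t, u s τ = c) : shiftVel u (s, t) = 0 ∧ shiftAcc u (s, t) = 0 := by
  have h1 : ∀ᶠ τ in 𝓝 t, shiftVel u (s, τ) = 0 := by
    filter_upwards [h.eventually_nhds] with τ hτ
    exact (hu.hasDerivAt hs τ).unique ((hasDerivAt_const τ c).congr_of_eventuallyEq hτ)
  exact ⟨h1.self_of_nhds, (hu.hasDerivAt_shiftVel hs t).unique
    ((hasDerivAt_const t (0 : ℝ)).congr_of_eventuallyEq h1)⟩

theorem IsShiftFamily.flat (hu : IsShiftFamily u δ η ε) {s t : ℝ} (hs : |s| < δ)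
    (ht : |t| < η + 2 * ε ∨ η + 4 * ε < |t|) : shiftVel u (s, t) = 0 ∧ shiftAcc u (s, t) = 0 := by
  rcases ht with ht | ht
  · refine hu.flat_of_eventually_const (c := s) hs ?_
    filter_upwards [continuous_abs.continuousAt.eventually_lt_const ht] with τ hτ
    exact hu.inner s τ hs hτ.le
  · refine hu.flat_of_eventually_const (c := 0) hs ?_
    filter_upwards [continuous_abs.continuousAt.eventually_const_lt ht] with τ hτ
    exact hu.outer s τ hs hτ

theorem IsShiftFamily.flat_zero (hu : IsShiftFamily u δ η ε) (hδ : 0 < δ) (t : ℝ) :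
    shiftVel u (0, t) = 0 ∧ shiftAcc u (0, t) = 0 :=
  hu.flat_of_eventually_const (c := 0) (by simpa using hδ) (Eventually.of_forall hu.zero)

/-- For small `s` the shift `u_s` is uniformly small on compact intervals. -/
theorem IsShiftFamily.eventually_small (hu : IsShiftFamily u δ η ε) (hδ : 0 < δ)
    {V : Set (ℝ × ℝ)} (hV : IsOpen V) {T : Set ℝ} (hT : IsCompact T) (hTV : ∀ t ∈ T, (t, (0 : ℝ)) ∈ V) :
    ∀ᶠ s in 𝓝 (0 : ℝ), ∀ t ∈ T, (t, u s t) ∈ V := by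
  refine hT.eventually_forall_of_forall_eventually fun t ht => ?_
  have h1 : ContinuousAt (fun q : ℝ × ℝ => u q.1 q.2) (0, t) :=
    hu.smooth.continuousOn.continuousAt ((isOpen_Ioo.prod isOpen_univ).mem_nhds
      (mk_mem_prod ⟨by linarith, hδ⟩ (mem_univ t)))
  have h2 : ContinuousAt (fun q : ℝ × ℝ => (q.2, u q.1 q.2)) (0, t) :=
    continuousAt_snd.prodMk h1
  exact h2.eventually_mem (hV.mem_nhds (by simpa [hu.zero] using hTV t ht))

variable {m : ℕ}

/-- The point `(t, u_s(t), 0, …, 0)`. -/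
def shiftPoint (m : ℕ) (u : ℝ → ℝ → ℝ) (q : ℝ × ℝ) : Eucl (m + 2) :=
  q.2 • stdVec 0 + u q.1 q.2 • stdVec 1

/-- The velocity of the curve `t ↦ (t, u_s(t), 0, …, 0)`. -/
def shiftPointVel (m : ℕ) (u : ℝ → ℝ → ℝ) (q : ℝ × ℝ) : Eucl (m + 2) :=
  stdVec 0 + shiftVel u q • stdVec 1

/-- The acceleration of the curve `t ↦ (t, u_s(t), 0, …, 0)`. -/
def shiftPointAcc (m : ℕ) (u : ℝ → ℝ → ℝ) (q : ℝ × ℝ) : Eucl (m + 2) :=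
  shiftAcc u q • stdVec 1

theorem shiftPoint_zero_coord (u : ℝ → ℝ → ℝ) (q : ℝ × ℝ) : shiftPoint m u q 0 = q.2 := by
  simp [shiftPoint]

theorem shiftPointVel_zero_coord (u : ℝ → ℝ → ℝ) (q : ℝ × ℝ) : shiftPointVel m u q 0 = 1 := by
  simp [shiftPointVel]

theorem shiftPointVel_ne_zero (u : ℝ → ℝ → ℝ) (q : ℝ × ℝ) : shiftPointVel m u q ≠ 0 := by
  intro h
  have := shiftPointVel_zero_coord (m := m) u q
  rw [h] at this
  simp at this

theorem add_mem_tubeBox {t σ : ℝ} (ht : |t| ≤ 2 * η) (hσ : |σ| < ε) :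
    t • stdVec 0 + σ • stdVec 1 ∈ tubeBox m η ε := by
  refine ⟨by simpa using ht, ?_⟩
  have h1 : ∀ i : Fin (m + 1), (t • stdVec 0 + σ • stdVec 1 : Eucl (m + 2)) i.succ ^ 2 =
      if i = 0 then σ ^ 2 else 0 := by
    intro i
    have : (i.succ = (1 : Fin (m + 2))) ↔ i = 0 := by
      rw [← Fin.succ_zero_eq_one, Fin.succ_inj]
    by_cases hi : i = 0 <;> simp [this, hi]
  simp only [h1, Finset.sum_ite_eq', Finset.mem_univ, if_true]
  exact sq_lt_sq.2 (by rwa [abs_of_pos ((abs_nonneg σ).trans_lt hσ)])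

theorem IsShiftFamily.contDiffOn_shiftPoint (hu : IsShiftFamily u δ η ε) :
    ContDiffOn ℝ ∞ (shiftPoint m u) (Ioo (-δ) δ ×ˢ univ) :=
  (contDiffOn_snd.smul contDiffOn_const).add (hu.smooth.smul contDiffOn_const)

theorem IsShiftFamily.contDiffOn_shiftPointVel (hu : IsShiftFamily u δ η ε) :
    ContDiffOn ℝ ∞ (shiftPointVel m u) (Ioo (-δ) δ ×ˢ univ) :=
  contDiffOn_const.add (hu.contDiffOn_shiftVel.smul contDiffOn_const)

theorem IsShiftFamily.contDiffOn_shiftPointAcc (hu : IsShiftFamily u δ η ε) :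
    ContDiffOn ℝ ∞ (shiftPointAcc m u) (Ioo (-δ) δ ×ˢ univ) :=
  hu.contDiffOn_shiftAcc.smul contDiffOn_const

theorem IsShiftFamily.hasDerivAt_shiftPoint (hu : IsShiftFamily u δ η ε) {s : ℝ} (hs : |s| < δ)
    (t : ℝ) : HasDerivAt (fun τ => shiftPoint m u (s, τ)) (shiftPointVel m u (s, t)) t := by
  have := ((hasDerivAt_id t).smul_const (stdVec 0 : Eucl (m + 2))).add
    ((hu.hasDerivAt hs t).smul_const (stdVec 1 : Eucl (m + 2)))
  rwa [one_smul] at this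

theorem IsShiftFamily.hasDerivAt_shiftPointVel (hu : IsShiftFamily u δ η ε) {s : ℝ} (hs : |s| < δ)
    (t : ℝ) : HasDerivAt (fun τ => shiftPointVel m u (s, τ)) (shiftPointAcc m u (s, t)) t :=
  ((hu.hasDerivAt_shiftVel hs t).smul_const _).const_add _

/-! ### The conformal factor in coordinates -/

/-- The value that the conformal factor has to take at `(t, u_s(t), 0, …, 0)`. -/
def factorValue (L : Eucl (m + 2) × Eucl (m + 2) → ℝ) (u : ℝ → ℝ → ℝ) (q : ℝ × ℝ) : ℝ :=
  -(Real.log (2 * L (shiftPoint m u q, shiftPointVel m u q)) / 2)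

/-- The differential that the conformal factor has to take at `(t, u_s(t), 0, …, 0)`. -/
def factorCovector (L : Eucl (m + 2) × Eucl (m + 2) → ℝ) (u : ℝ → ℝ → ℝ) (q : ℝ × ℝ) :
    Eucl (m + 2) →L[ℝ] ℝ :=
  conformalCovector L (shiftPoint m u q) (shiftPointVel m u q) (shiftPointAcc m u q)

/-- The function with the prescribed values and differentials along the curves
`t ↦ (t, u_s(t), 0, …, 0)` that is affine on the slices on which the first coordinate `x 0` is
constant. -/
def affineFactor (L : Eucl (m + 2) × Eucl (m + 2) → ℝ) (u : ℝ → ℝ → ℝ)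
    (q : ℝ × Eucl (m + 2)) : ℝ :=
  factorValue L u (q.1, q.2 0) +
    factorCovector L u (q.1, q.2 0) (q.2 - shiftPoint m u (q.1, q.2 0))

variable {L : Eucl (m + 2) × Eucl (m + 2) → ℝ} {Ω : Set (Eucl (m + 2))}

/-- The parameters of the points of the shifted lines that lie in `Ω`. -/
def shiftDomain (u : ℝ → ℝ → ℝ) (δ : ℝ) (Ω : Set (Eucl (m + 2))) : Set (ℝ × ℝ) :=
  Ioo (-δ) δ ×ˢ univ ∩ shiftPoint m u ⁻¹' Ω

theorem IsShiftFamily.isOpen_shiftDomain (hu : IsShiftFamily u δ η ε) (hΩ : IsOpen Ω) :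
    IsOpen (shiftDomain u δ Ω) :=
  hu.contDiffOn_shiftPoint.continuousOn.isOpen_inter_preimage (isOpen_Ioo.prod isOpen_univ) hΩ

theorem contDiffOn_factorValue (hL : IsFinslerLagrangian L Ω) (hu : IsShiftFamily u δ η ε) :
    ContDiffOn ℝ ∞ (factorValue L u) (shiftDomain u δ Ω) := by
  have h1 : ContDiffOn ℝ ∞ (fun q => L (shiftPoint m u q, shiftPointVel m u q))
      (shiftDomain u δ Ω) :=
    hL.smooth.comp ((hu.contDiffOn_shiftPoint.prodMk hu.contDiffOn_shiftPointVel).mono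
      inter_subset_left) (fun q hq => ⟨hq.2, shiftPointVel_ne_zero u q⟩)
  refine (((contDiffOn_const.mul h1).log fun q hq => ?_).div_const 2).neg
  have := hL.pos _ hq.2 _ (shiftPointVel_ne_zero u q)
  positivity

theorem contDiffOn_factorCovector (hL : IsFinslerLagrangian L Ω) (hu : IsShiftFamily u δ η ε) :
    ContDiffOn ℝ ∞ (factorCovector L u) (shiftDomain u δ Ω) := by
  have h0 : ContDiffOn ℝ ∞ (fun q => (shiftPoint m u q, shiftPointVel m u q))
      (shiftDomain u δ Ω) :=
    (hu.contDiffOn_shiftPoint.prodMk hu.contDiffOn_shiftPointVel).mono inter_subset_left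
  have hm : MapsTo (fun q => (shiftPoint m u q, shiftPointVel m u q)) (shiftDomain u δ Ω)
      (Ω ×ˢ {0}ᶜ) := fun q hq => ⟨hq.2, shiftPointVel_ne_zero u q⟩
  have hacc : ContDiffOn ℝ ∞ (shiftPointAcc m u) (shiftDomain u δ Ω) :=
    hu.contDiffOn_shiftPointAcc.mono inter_subset_left
  have hpair := h0.prodMk hacc
  have hm' : MapsTo (fun q => ((shiftPoint m u q, shiftPointVel m u q), shiftPointAcc m u q))
      (shiftDomain u δ Ω) ((Ω ×ˢ {0}ᶜ) ×ˢ univ) := fun q hq => mk_mem_prod (hm hq) (mem_univ _)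
  have hfin := (contDiffOn_conformalCovector hL).comp hpair hm'
  exact hfin

theorem contDiff_coord (i : Fin (m + 2)) : ContDiff ℝ ∞ fun x : Eucl (m + 2) => x i :=
  (EuclideanSpace.proj (𝕜 := ℝ) i).contDiff

theorem contDiffOn_affineFactor (hL : IsFinslerLagrangian L Ω) (hu : IsShiftFamily u δ η ε) :
    ContDiffOn ℝ ∞ (affineFactor L u) {q | (q.1, q.2 0) ∈ shiftDomain u δ Ω} := by
  have hp : ContDiff ℝ ∞ fun q : ℝ × Eucl (m + 2) => (q.1, q.2 0) :=
    contDiff_fst.prodMk ((contDiff_coord 0).comp contDiff_snd)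
  have h1 := (contDiffOn_factorValue hL hu).comp hp.contDiffOn
    (s := {q : ℝ × Eucl (m + 2) | (q.1, q.2 0) ∈ shiftDomain u δ Ω}) (fun q hq => hq)
  have h2 := (contDiffOn_factorCovector hL hu).comp hp.contDiffOn
    (s := {q : ℝ × Eucl (m + 2) | (q.1, q.2 0) ∈ shiftDomain u δ Ω}) (fun q hq => hq)
  have h3 := (hu.contDiffOn_shiftPoint (m := m)).comp hp.contDiffOn
    (s := {q : ℝ × Eucl (m + 2) | (q.1, q.2 0) ∈ shiftDomain u δ Ω}) (fun q hq => hq.1)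
  exact h1.add (h2.clm_apply (contDiffOn_snd.sub h3))

theorem affineFactor_shiftPoint (L : Eucl (m + 2) × Eucl (m + 2) → ℝ) (u : ℝ → ℝ → ℝ) (s t : ℝ) :
    affineFactor L u (s, shiftPoint m u (s, t)) = factorValue L u (s, t) := by
  simp [affineFactor, shiftPoint_zero_coord]

/-- The affine factor has the prescribed differential, also in the direction of the curve. -/
theorem hasFDerivAt_affineFactor (hL : IsFinslerLagrangian L Ω) (hu : IsShiftFamily u δ η ε)
    {s t : ℝ} (h : (s, t) ∈ shiftDomain u δ Ω) :
    HasFDerivAt (fun x => affineFactor L u (s, x)) (factorCovector L u (s, t))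
      (shiftPoint m u (s, t)) := by
  have hs : |s| < δ := abs_lt.2 h.1.1
  have hopen := (hu.isOpen_shiftDomain hL.isOpen).mem_nhds h
  have hy := shiftPointVel_ne_zero (m := m) u (s, t)
  have hpos := hL.pos _ h.2 _ hy
  -- derivatives along the curve
  have hval : HasDerivAt (fun τ => factorValue L u (s, τ))
      (factorCovector L u (s, t) (shiftPointVel m u (s, t))) t := by
    have h1 := (hL.hasFDerivAt h.2 hy).comp_hasDerivAt t
      ((hu.hasDerivAt_shiftPoint hs t).prodMk (hu.hasDerivAt_shiftPointVel hs t))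
    have h2 := (((h1.const_mul 2).log (by simp only [Function.comp_apply]; positivity)).div_const
      2).neg
    refine h2.congr_deriv ?_
    rw [factorCovector, conformalCovector_self hL h.2 hy]
    simp only [Function.comp_apply]
    field_simp
  have hcov : ∃ A', HasDerivAt (fun τ => factorCovector L u (s, τ)) A' t := by
    have h1 : DifferentiableAt ℝ (factorCovector L u) (s, t) :=
      ((contDiffOn_factorCovector hL hu).contDiffAt hopen).differentiableAt (by simp)
    exact ⟨_, h1.hasFDerivAt.comp_hasDerivAt t ((hasDerivAt_const t s).prodMk (hasDerivAt_id t))⟩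
  obtain ⟨A', hA'⟩ := hcov
  have h0 : HasFDerivAt (fun x : Eucl (m + 2) => x 0) (EuclideanSpace.proj (𝕜 := ℝ) 0)
      (shiftPoint m u (s, t)) := (EuclideanSpace.proj (𝕜 := ℝ) (0 : Fin (m + 2))).hasFDerivAt
  have ht : t = shiftPoint m u (s, t) 0 := (shiftPoint_zero_coord u (s, t)).symm
  have hval' := (show HasDerivAt (fun τ => factorValue L u (s, τ)) _
    (shiftPoint m u (s, t) 0) from ht ▸ hval).comp_hasFDerivAt (shiftPoint m u (s, t)) h0
  have hA'' := (show HasDerivAt (fun τ => factorCovector L u (s, τ)) _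
    (shiftPoint m u (s, t) 0) from ht ▸ hA').hasFDerivAt.comp (shiftPoint m u (s, t)) h0
  have hX := (show HasDerivAt (fun τ => shiftPoint m u (s, τ)) (shiftPointVel m u (s, t))
    (shiftPoint m u (s, t) 0) from ht ▸ hu.hasDerivAt_shiftPoint hs t).hasFDerivAt.comp
      (shiftPoint m u (s, t)) h0
  have hfin := hval'.add (hA''.clm_apply ((hasFDerivAt_id (shiftPoint m u (s, t))).sub hX))
  refine hfin.congr_fderiv ?_
  ext z
  simp [shiftPoint_zero_coord]
  ring

end Shift

section Factor

variable {m : ℕ} {L : Eucl (m + 2) × Eucl (m + 2) → ℝ} {Ω : Set (Eucl (m + 2))}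
  {u : ℝ → ℝ → ℝ} {δ₀ η ε : ℝ}

/-- Where the shifted line coincides with a coordinate line to second order, the conformal factor
has to vanish to first order. -/
theorem factor_eq_zero_of_flat (hL : IsFinslerLagrangian L Ω) (hbox : tubeBox m η ε ⊆ Ω)
    (hlines : ∀ σ t : ℝ, |σ| < ε → |t| ≤ 2 * η →
      2 * L (t • stdVec 0 + σ • stdVec 1, stdVec 0) = 1 ∧
        eulerLagrange L (t • stdVec 0 + σ • stdVec 1) (stdVec 0) 0 = 0)
    {s t : ℝ} (ht : |t| ≤ 2 * η) (hσ : |u s t| < ε)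
    (hflat : shiftVel u (s, t) = 0 ∧ shiftAcc u (s, t) = 0) :
    factorValue L u (s, t) = 0 ∧ factorCovector L u (s, t) = 0 := by
  have hvel : shiftPointVel m u (s, t) = stdVec 0 := by simp [shiftPointVel, hflat.1]
  have hacc : shiftPointAcc m u (s, t) = 0 := by simp [shiftPointAcc, hflat.2]
  have hne : (stdVec 0 : Eucl (m + 2)) ≠ 0 := hvel ▸ shiftPointVel_ne_zero u (s, t)
  obtain ⟨h1, h2⟩ := hlines (u s t) t hσ ht
  refine ⟨?_, ?_⟩
  · rw [factorValue, hvel, shiftPoint, h1]; simp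
  · rw [factorCovector, hvel, hacc]
    exact conformalCovector_eq_zero hL (hbox (add_mem_tubeBox ht hσ)) hne h2

/-- The conformal factor in adapted coordinates: a smooth family of functions, supported near the
places where the line is bent, with the values and differentials that make the shifted lines
extremal and normalized. -/
theorem exists_coordinate_factor (hL : IsFinslerLagrangian L Ω) (hε : 0 < ε) (h7 : 7 * ε < η)
    (hbox : tubeBox m η ε ⊆ Ω)
    (hlines : ∀ σ t : ℝ, |σ| < ε → |t| ≤ 2 * η →
      2 * L (t • stdVec 0 + σ • stdVec 1, stdVec 0) = 1 ∧
        eulerLagrange L (t • stdVec 0 + σ • stdVec 1) (stdVec 0) 0 = 0)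
    (hδ₀ : 0 < δ₀) (hu : IsShiftFamily u δ₀ η ε) {V : Set (Eucl (m + 2))} (hV : IsOpen V)
    (hTV : ∀ t : ℝ, η ≤ |t| → |t| ≤ η + 4 * ε → t • stdVec 0 ∈ V) :
    ∃ δ : ℝ, 0 < δ ∧ δ ≤ δ₀ ∧ ∃ K : Set (Eucl (m + 2)), IsCompact K ∧ K ⊆ V ∧
      ∃ Φ : ℝ × Eucl (m + 2) → ℝ, ContDiffOn ℝ ∞ Φ (Ioo (-δ) δ ×ˢ univ) ∧
        (∀ x, Φ (0, x) = 0) ∧ (∀ s, |s| < δ → ∀ x ∉ K, Φ (s, x) = 0) ∧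
        ∀ s t, |s| < δ → |t| ≤ 2 * η → shiftPoint m u (s, t) ∈ tubeBox m η ε ∧
          Φ (s, shiftPoint m u (s, t)) = factorValue L u (s, t) ∧
          fderiv ℝ (fun x => Φ (s, x)) (shiftPoint m u (s, t)) = factorCovector L u (s, t) := by
  -- a cutoff function around the two bent pieces of the line
  let T : Set ℝ := {t | η + 2 * ε ≤ |t| ∧ |t| ≤ η + 4 * ε}
  have hT : IsCompact T := by
    refine Metric.isCompact_of_isClosed_isBounded
      ((isClosed_le continuous_const continuous_abs).inter
        (isClosed_le continuous_abs continuous_const)) ?_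
    refine (Metric.isBounded_Icc (-(η + 4 * ε)) (η + 4 * ε)).subset fun t ht => ?_
    exact abs_le.1 ht.2
  have hline : Continuous fun t : ℝ => t • (stdVec 0 : Eucl (m + 2)) := by fun_prop
  let V' : Set (Eucl (m + 2)) := V ∩ {x | |x 0| < η + 5 * ε}
  have hV' : IsOpen V' := hV.inter
    (isOpen_lt (continuous_abs.comp (contDiff_coord 0).continuous) continuous_const)
  have hTV' : (fun t : ℝ => t • (stdVec 0 : Eucl (m + 2))) '' T ⊆ V' := by
    rintro _ ⟨t, ht, rfl⟩
    refine ⟨hTV t (by linarith [ht.1]) ht.2, ?_⟩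
    simpa using ht.2.trans_lt (by linarith)
  obtain ⟨K, hK, hTK, hKV⟩ := exists_compact_between (hT.image hline) hV' hTV'
  obtain ⟨χ, hχ1, hχ0, -⟩ := exists_contMDiffMap_one_nhds_of_subset_interior
    (n := ⊤) 𝓘(ℝ, Eucl (m + 2)) (hT.image hline).isClosed hTK
  have hχ : ContDiff ℝ ∞ χ := χ.contMDiff.contDiff
  obtain ⟨N, hN, hTN, hχN⟩ := eventually_nhdsSet_iff_exists.1 hχ1
  -- for small `s` the shifted line stays in the tube, and its bent pieces stay where `χ = 1`
  have hsmall1 := hu.eventually_small hδ₀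
    (V := {q | |q.2| < ε}) (isOpen_lt (continuous_abs.comp continuous_snd) continuous_const)
    (isCompact_Icc (a := -(2 * η)) (b := 2 * η)) (fun t _ => by simpa using hε)
  have hsmall2 := hu.eventually_small hδ₀
    (V := (fun q : ℝ × ℝ => q.1 • (stdVec 0 : Eucl (m + 2)) + q.2 • stdVec 1) ⁻¹' N)
    (hN.preimage (by fun_prop)) hT (fun t ht => by
      simpa using hTN ⟨t, ht, rfl⟩)
  obtain ⟨δ₁, hδ₁, hball⟩ := Metric.eventually_nhds_iff.1 (hsmall1.and hsmall2)
  have hδ : ∀ s, |s| < min δ₀ δ₁ → |s| < δ₀ ∧ (∀ t, |t| ≤ 2 * η → |u s t| < ε) ∧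
      ∀ t ∈ T, shiftPoint m u (s, t) ∈ N := fun s hs => by
    have h1 := hball (y := s) (by simpa using hs.trans_le (min_le_right _ _))
    exact ⟨hs.trans_le (min_le_left _ _), fun t ht => h1.1 t (abs_le.1 ht), h1.2⟩
  have hdom : ∀ s t, |s| < min δ₀ δ₁ → |t| ≤ 2 * η → (s, t) ∈ shiftDomain u δ₀ Ω := by
    intro s t hs ht
    obtain ⟨h1, h2, -⟩ := hδ s hs
    exact ⟨mk_mem_prod (abs_lt.1 h1) (mem_univ _), hbox (add_mem_tubeBox ht (h2 t ht))⟩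
  have hKη : ∀ x ∈ K, |x 0| ≤ 2 * η := fun x hx => by
    have : |x 0| < η + 5 * ε := (hKV hx).2
    linarith
  refine ⟨min δ₀ δ₁, lt_min hδ₀ hδ₁, min_le_left _ _, K, hK, fun x hx => (hKV hx).1,
    fun q => χ q.2 * affineFactor L u q, fun q hq => ?_, fun x => ?_, fun s _ x hx => ?_,
    fun s t hs ht => ?_⟩
  · refine ContDiffAt.contDiffWithinAt ?_
    by_cases hqK : q.2 ∈ K
    · have hs : |q.1| < min δ₀ δ₁ := abs_lt.2 hq.1
      have hopen : IsOpen {q : ℝ × Eucl (m + 2) | (q.1, q.2 0) ∈ shiftDomain u δ₀ Ω} :=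
        (hu.isOpen_shiftDomain hL.isOpen).preimage
          (continuous_fst.prodMk ((contDiff_coord 0).continuous.comp continuous_snd))
      exact (hχ.contDiffAt.comp q contDiffAt_snd).mul ((contDiffOn_affineFactor hL hu).contDiffAt
        (hopen.mem_nhds (hdom _ _ hs (hKη _ hqK))))
    · refine (contDiffAt_const (c := (0 : ℝ))).congr_of_eventuallyEq ?_
      filter_upwards [continuous_snd.continuousAt.eventually_mem
        (hK.isClosed.isOpen_compl.mem_nhds hqK)] with q' hq'
      rw [hχ0 _ hq', zero_mul]
  · by_cases hxK : x ∈ K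
    · obtain ⟨h1, h2⟩ := factor_eq_zero_of_flat hL hbox hlines (s := 0) (t := x 0) (hKη x hxK)
        (by simpa [hu.zero] using hε) (hu.flat_zero hδ₀ _)
      simp [affineFactor, h1, h2]
    · simp only [hχ0 _ hxK, zero_mul]
  · simp only [hχ0 _ hx, zero_mul]
  · obtain ⟨hs0, hsu, hsN⟩ := hδ s hs
    have hcoord : shiftPoint m u (s, t) 0 = t := shiftPoint_zero_coord u (s, t)
    refine ⟨add_mem_tubeBox ht (hsu t ht), ?_⟩
    by_cases htT : t ∈ T
    · -- near the bent pieces the cutoff function is `1`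
      have hev : (fun x => χ x * affineFactor L u (s, x)) =ᶠ[𝓝 (shiftPoint m u (s, t))]
          fun x => affineFactor L u (s, x) := by
        filter_upwards [hN.mem_nhds (hsN t htT)] with x hx
        rw [hχN x hx, one_mul]
      exact ⟨hev.self_of_nhds.trans (affineFactor_shiftPoint L u s t), hev.fderiv_eq.trans
        (hasFDerivAt_affineFactor hL hu (hdom s t hs ht)).fderiv⟩
    · -- elsewhere both the prescribed data and the function vanish
      have hor : ∀ τ, τ ∉ T → |τ| < η + 2 * ε ∨ η + 4 * ε < |τ| := fun τ hτ => by
        by_contra! hcon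
        exact hτ hcon
      have hflat := fun τ (hτ : τ ∉ T) (hτ' : |τ| ≤ 2 * η) =>
        factor_eq_zero_of_flat hL hbox hlines hτ' (hsu τ hτ') (hu.flat hs0 (hor τ hτ))
      obtain ⟨hv, hc⟩ := hflat t htT ht
      have hev : (fun x => χ x * affineFactor L u (s, x)) =ᶠ[𝓝 (shiftPoint m u (s, t))]
          fun _ => (0 : ℝ) := by
        have hnear : ∀ᶠ x in 𝓝 (shiftPoint m u (s, t)), x 0 ∉ T :=
          (contDiff_coord 0).continuous.continuousAt.eventually_mem
            (hT.isClosed.isOpen_compl.mem_nhds (by rw [hcoord]; exact htT))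
        filter_upwards [hnear] with x hx
        by_cases hxK : x ∈ K
        · obtain ⟨h1, h2⟩ := hflat (x 0) hx (hKη x hxK)
          simp [affineFactor, h1, h2]
        · rw [hχ0 _ hxK, zero_mul]
      refine ⟨hev.self_of_nhds.trans hv.symm, ?_⟩
      rw [hc]
      exact hev.fderiv_eq.trans (fderiv_const_apply 0)

end Factor

/-! ### Convergence of smooth families in the `C^∞`-topology -/

section SmoothTopology

/-- The derivatives in the second variable of a jointly smooth function are jointly smooth. -/
theorem contDiffOn_iteratedFDeriv_slice {E : Type*} [NormedAddCommGroup E] [NormedSpace ℝ E]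
    {G : ℝ × E → ℝ} {Q : Set (ℝ × E)} (hQ : IsOpen Q) (hG : ContDiffOn ℝ ∞ G Q) (k : ℕ) :
    ContDiffOn ℝ ∞ (fun q : ℝ × E => iteratedFDeriv ℝ k (fun x => G (q.1, x)) q.2) Q := by
  induction k with
  | zero =>
    simp only [iteratedFDeriv_zero_eq_comp]
    exact (continuousMultilinearCurryFin0 ℝ E ℝ).symm.contDiff.comp_contDiffOn hG
  | succ k ih =>
    simp only [iteratedFDeriv_succ_eq_comp_left]
    intro q hq
    refine ContDiffAt.contDiffWithinAt ?_
    have h1 : ContDiffAt ℝ ∞ (Function.uncurry fun (q' : ℝ × E) (x : E) =>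
        iteratedFDeriv ℝ k (fun x => G (q'.1, x)) x) (q, q.2) :=
      ContDiffAt.comp (f := fun r : (ℝ × E) × E => (r.1.1, r.2)) (q, q.2)
        (ih.contDiffAt (hQ.mem_nhds hq)) (by fun_prop)
    have h2 : ContDiffAt ℝ ∞ (fun q' : ℝ × E =>
        fderiv ℝ (iteratedFDeriv ℝ k fun x => G (q'.1, x)) q'.2) q :=
      h1.fderiv contDiffAt_snd (by simp)
    exact h2.continuousLinearMap_comp
      ((continuousMultilinearCurryLeftEquiv ℝ (fun _ : Fin (k + 1) => E) ℝ).symm :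
        _ →L[ℝ] E [×(k + 1)]→L[ℝ] ℝ)

variable {n : ℕ} {M : Type*} [TopologicalSpace M] [ChartedSpace (Eucl n) M]

/-- A family of functions that is jointly smooth in the parameter and the point is continuous as a
map to `C^∞(M)`. -/
theorem tendsto_smoothTopology {φ : ℝ → C^∞⟮𝓡 n, M; 𝓘(ℝ, ℝ), ℝ⟯} {δ : ℝ} (hδ : 0 < δ)
    (hφ : ContMDiffOn (𝓘(ℝ, ℝ).prod (𝓡 n)) 𝓘(ℝ, ℝ) ∞ (fun q : ℝ × M => φ q.1 q.2)
      (Ioo (-δ) δ ×ˢ univ)) :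
    Tendsto φ (𝓝 0) (@nhds _ (smoothTopology n M) (φ 0)) := by
  simp only [nhds_iInf, tendsto_iInf]
  intro e he k
  rw [nhds_induced, tendsto_comap_iff, UniformOnFun.tendsto_iff_tendstoUniformlyOn]
  rintro K ⟨hK, hKe⟩
  have hG : ContDiffOn ℝ ∞ (fun q : ℝ × Eucl n => φ q.1 (e.symm q.2))
      (Ioo (-δ) δ ×ˢ e.target) := by
    rw [← contMDiffOn_iff_contDiffOn]
    refine hφ.comp (g := fun q : ℝ × M => φ q.1 q.2)
      (f := fun q : ℝ × Eucl n => (q.1, e.symm q.2)) ?_ (fun q hq => ⟨hq.1, mem_univ _⟩)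
    exact contDiff_fst.contMDiff.contMDiffOn.prodMk
      ((contMDiffOn_symm_of_mem_maximalAtlas he).comp contDiff_snd.contMDiff.contMDiffOn
        (fun q hq => hq.2))
  have hopen : IsOpen (Ioo (-δ) δ ×ˢ e.target) := isOpen_Ioo.prod e.open_target
  have hD := (contDiffOn_iteratedFDeriv_slice hopen hG k).continuousOn
  rw [Metric.tendstoUniformlyOn_iff]
  intro ε hε
  refine hK.eventually_forall_of_forall_eventually fun x hx => ?_
  have h0 : (0 : ℝ) ∈ Ioo (-δ) δ := ⟨by linarith, hδ⟩
  have h1 := hD.continuousAt (hopen.mem_nhds (mk_mem_prod h0 (hKe hx)))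
  have h2 := (ContinuousAt.comp (f := fun q : ℝ × Eucl n => ((0 : ℝ), q.2)) (x := ((0 : ℝ), x)) h1
    (by fun_prop)).dist h1
  have h3 := h2.eventually_lt_const (u := ε) (by simpa using hε)
  exact h3

end SmoothTopology

/-! ### The conformal change making the shifted lines geodesics -/

section Perturbation

theorem eulerLagrange_congr {E : Type*} [NormedAddCommGroup E] [NormedSpace ℝ E]
    {L L' : E × E → ℝ} {x y : E} (h : L =ᶠ[𝓝 (x, y)] L') (a : E) :
    eulerLagrange L x y a = eulerLagrange L' x y a := by
  rw [eulerLagrange, eulerLagrange, h.fderiv_eq, h.fderiv.fderiv_eq]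

variable {m : ℕ} {M : Type*} [TopologicalSpace M] [ChartedSpace (Eucl (m + 2)) M]
  [IsManifold (𝓡 (m + 2)) ∞ M] {F : ∀ x : M, TangentSpace (𝓡 (m + 2)) x → ℝ} {p : M}
  {v w : TangentSpace (𝓡 (m + 2)) p} {e : OpenPartialHomeomorph M (Eucl (m + 2))}
  {η ε δ₀ : ℝ} {u : ℝ → ℝ → ℝ}

/-- The coordinate lines of an adapted chart are normalized and extremal for the energy. -/
theorem IsAdaptedChart.lines_eulerLagrange (hF : IsFinslerMetric F)
    (h : IsAdaptedChart F p v w e η ε) (hη : 0 < η) {σ t : ℝ} (hσ : |σ| < ε) (ht : |t| ≤ 2 * η) :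
    2 * chartLagrangian F e (t • stdVec 0 + σ • stdVec 1, stdVec 0) = 1 ∧
      eulerLagrange (chartLagrangian F e) (t • stdVec 0 + σ • stdVec 1) (stdVec 0) 0 = 0 := by
  let x : ℝ → Eucl (m + 2) := fun t => σ • stdVec 1 + t • stdVec 0
  have hI : UniqueDiffOn ℝ (Icc (-(2 * η)) (2 * η)) := uniqueDiffOn_Icc (by linarith)
  have hx : ContDiffOn ℝ ∞ x (Icc (-(2 * η)) (2 * η)) :=
    (contDiff_const.add (contDiff_id.smul contDiff_const)).contDiffOn
  have hmem : ∀ τ ∈ Icc (-(2 * η)) (2 * η), x τ ∈ e.target := fun τ hτ => by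
    rw [show x τ = τ • stdVec 0 + σ • stdVec 1 from add_comm _ _]
    exact h.box_subset (add_mem_tubeBox (abs_le.2 hτ) hσ)
  have hx' : ∀ τ ∈ Icc (-(2 * η)) (2 * η), derivWithin x (Icc (-(2 * η)) (2 * η)) τ = stdVec 0 := by
    intro τ hτ
    have := (((hasDerivAt_id τ).smul_const (stdVec 0 : Eucl (m + 2))).const_add
      (σ • stdVec 1)).hasDerivWithinAt.derivWithin (hI τ hτ)
    rwa [one_smul] at this
  have ht' : t ∈ Icc (-(2 * η)) (2 * η) := abs_le.1 ht
  have hx'' : derivWithin (derivWithin x (Icc (-(2 * η)) (2 * η))) (Icc (-(2 * η)) (2 * η)) t = 0 := by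
    rw [derivWithin_congr hx' (hx' t ht')]
    simp
  have hne : (stdVec 0 : Eucl (m + 2)) ≠ 0 := by simp
  have hbox0 : (σ • stdVec 1 : Eucl (m + 2)) ∈ tubeBox m η ε := by
    have := add_mem_tubeBox (m := m) (t := 0) (η := η) (by simpa using hη.le) hσ
    rwa [zero_smul, zero_add] at this
  obtain ⟨h1, h2⟩ := h.lines _ hbox0 (by simp)
  have h3 := IsGeodesicOn.eulerLagrange_eq_zero hF h.mem_atlas hmem h1 ht' (by rwa [hx' t ht'])
  have h4 := (isArcLengthOn_iff h.mem_atlas hI hx hmem).1 h2 t ht'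
  rw [hx' t ht', hx''] at h3
  rw [hx' t ht'] at h4
  rw [show x t = t • stdVec 0 + σ • stdVec 1 from add_comm _ _] at h3 h4
  exact ⟨by simp [chartLagrangian, h4], h3⟩

/-- If a function has the prescribed values and differentials along a shifted line, then this line
is a unit speed geodesic of the corresponding conformal metric. -/
theorem isGeodesicOn_conformal (hF : IsFinslerMetric F)
    (he : e ∈ IsManifold.maximalAtlas (𝓡 (m + 2)) ∞ M) (hη : 0 < η)
    (hu : IsShiftFamily u δ₀ η ε) {s : ℝ} (hs : |s| < δ₀)
    (hmem : ∀ t ∈ Icc (-(2 * η)) (2 * η), shiftPoint m u (s, t) ∈ e.target)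
    {φ : C^∞⟮𝓡 (m + 2), M; 𝓘(ℝ, ℝ), ℝ⟯} {f : Eucl (m + 2) → ℝ} (hf : ContDiff ℝ ∞ f)
    (hφ : ∀ x ∈ e.target, φ (e.symm x) = f x)
    (hval : ∀ t ∈ Icc (-(2 * η)) (2 * η),
      f (shiftPoint m u (s, t)) = factorValue (chartLagrangian F e) u (s, t))
    (hcov : ∀ t ∈ Icc (-(2 * η)) (2 * η),
      fderiv ℝ f (shiftPoint m u (s, t)) = factorCovector (chartLagrangian F e) u (s, t)) :
    IsGeodesicOn (conformalMetric φ F) (shiftedCurve e (u s)) (Icc (-(2 * η)) (2 * η)) ∧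
      IsArcLengthOn (conformalMetric φ F) (shiftedCurve e (u s)) (Icc (-(2 * η)) (2 * η)) := by
  set I := Icc (-(2 * η)) (2 * η) with hIdef
  have hI : UniqueDiffOn ℝ I := uniqueDiffOn_Icc (by linarith)
  have hL := isFinslerLagrangian_chartLagrangian hF he
  let x : ℝ → Eucl (m + 2) := fun t => shiftPoint m u (s, t)
  have hx : ContDiffOn ℝ ∞ x I :=
    hu.contDiffOn_shiftPoint.comp (f := fun t => (s, t)) (contDiff_prodMk_right s).contDiffOn
      (fun t _ => mk_mem_prod (abs_lt.1 hs) (mem_univ t))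
  have hx1 : ∀ t ∈ I, derivWithin x I t = shiftPointVel m u (s, t) := fun t ht =>
    (hu.hasDerivAt_shiftPoint hs t).hasDerivWithinAt.derivWithin (hI t ht)
  have hx2 : ∀ t ∈ I, derivWithin (derivWithin x I) I t = shiftPointAcc m u (s, t) := by
    intro t ht
    rw [derivWithin_congr hx1 (hx1 t ht)]
    exact (hu.hasDerivAt_shiftPointVel hs t).hasDerivWithinAt.derivWithin (hI t ht)
  have hlag : ∀ q : Eucl (m + 2) × Eucl (m + 2), q.1 ∈ e.target →
      chartLagrangian (conformalMetric φ F) e q =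
        Real.exp (2 * f q.1) * chartLagrangian F e q := by
    intro q hq
    have h1 : coordF (conformalMetric φ F) e q.1 q.2 = Real.exp (φ (e.symm q.1)) *
      coordF F e q.1 q.2 := rfl
    rw [chartLagrangian, chartLagrangian, h1, hφ _ hq, two_mul, Real.exp_add]
    ring
  have hnorm : ∀ t ∈ I, Real.exp (2 * f (x t)) *
      (2 * chartLagrangian F e (x t, shiftPointVel m u (s, t))) = 1 := by
    intro t ht
    have hpos := hL.pos _ (hmem t ht) _ (shiftPointVel_ne_zero u (s, t))
    rw [show f (x t) = _ from hval t ht, factorValue, mul_neg, mul_div_cancel₀ _ two_ne_zero,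
      Real.exp_neg, Real.exp_log (by positivity)]
    exact inv_mul_cancel₀ (by positivity)
  refine ⟨isGeodesicOn_of_eulerLagrange (x := x) (hF.conformal φ.contMDiff) he hI hx hmem
    (fun t ht => ?_) (fun t ht => ?_), (isArcLengthOn_iff he hI hx hmem).2 fun t ht => ?_⟩
  · rw [hx1 t ht]; exact shiftPointVel_ne_zero u (s, t)
  · rw [hx1 t ht, hx2 t ht]
    have hev : chartLagrangian (conformalMetric φ F) e =ᶠ[𝓝 (x t, shiftPointVel m u (s, t))]
        fun q => Real.exp (2 * f q.1) * chartLagrangian F e q := by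
      filter_upwards [continuous_fst.continuousAt.eventually_mem
        (e.open_target.mem_nhds (hmem t ht))] with q hq using hlag q hq
    rw [eulerLagrange_congr hev]
    exact eulerLagrange_conformal hL (hmem t ht) (shiftPointVel_ne_zero u (s, t)) hf.contDiffAt
      (hnorm t ht) (hcov t ht)
  · rw [hx1 t ht]
    have h1 : coordF (conformalMetric φ F) e (x t) (shiftPointVel m u (s, t)) ^ 2 = 1 := by
      have h2 := hlag (x t, shiftPointVel m u (s, t)) (hmem t ht)
      have h3 := hnorm t ht
      have h4 : chartLagrangian (conformalMetric φ F) e (x t, shiftPointVel m u (s, t)) =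
        coordF (conformalMetric φ F) e (x t) (shiftPointVel m u (s, t)) ^ 2 / 2 := rfl
      linarith
    have h5 : 0 < coordF (conformalMetric φ F) e (x t) (shiftPointVel m u (s, t)) :=
      (hF.conformal φ.contMDiff).pos _ _
        (mfderiv_chart_symm_ne_zero he (hmem t ht) (shiftPointVel_ne_zero u (s, t)))
    exact (pow_eq_one_iff_of_nonneg h5.le two_ne_zero).1 h1

variable [T2Space M]

/-- For every adapted chart, the shifted lines are unit speed geodesics of small conformal
perturbations of the metric that are supported near the bent pieces of the line. -/
theorem exists_conformal_perturbation (hF : IsFinslerMetric F) (hε : 0 < ε) (h7 : 7 * ε < η)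
    (h : IsAdaptedChart F p v w e η ε) (hδ₀ : 0 < δ₀) (hu : IsShiftFamily u δ₀ η ε) {U : Set M}
    (hU : IsOpen U)
    (hsub : shiftedCurve e (fun _ => 0) '' (Icc (-η - 4 * ε) (-η) ∪ Icc η (η + 4 * ε)) ⊆ U) :
    ∃ δ : ℝ, 0 < δ ∧ δ ≤ δ₀ ∧ ∃ φ : ℝ → C^∞⟮𝓡 (m + 2), M; 𝓘(ℝ, ℝ), ℝ⟯,
      φ 0 = 0 ∧
      ContMDiffOn (𝓘(ℝ, ℝ).prod (𝓡 (m + 2))) 𝓘(ℝ, ℝ) ∞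
        (fun q : ℝ × M => φ q.1 q.2) (Ioo (-δ) δ ×ˢ univ) ∧
      (∃ K : Set M, IsCompact K ∧ K ⊆ U ∧ ∀ s, |s| < δ → tsupport (φ s) ⊆ K) ∧
      ∀ s, |s| < δ →
        (∀ t ∈ Icc (-(2 * η)) (2 * η),
          shiftedCurve e (u s) t ∈ e.symm '' tubeBox m η ε) ∧
        IsGeodesicOn (conformalMetric (φ s) F) (shiftedCurve e (u s))
          (Icc (-(2 * η)) (2 * η)) ∧
        IsArcLengthOn (conformalMetric (φ s) F) (shiftedCurve e (u s))
          (Icc (-(2 * η)) (2 * η)) := by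
  classical
  have hη : 0 < η := by linarith
  have he := h.mem_atlas
  have hL := isFinslerLagrangian_chartLagrangian hF he
  have hV : IsOpen (e.target ∩ e.symm ⁻¹' U) := e.isOpen_inter_preimage_symm hU
  obtain ⟨δ, hδ, hδδ, K, hK, hKV, Φ, hΦ, hΦ0, hΦK, hΦc⟩ := exists_coordinate_factor hL hε h7
    h.box_subset (fun σ t hσ ht => h.lines_eulerLagrange hF hη hσ ht) hδ₀ hu hV (by
      intro t ht1 ht2
      have hmem := add_mem_tubeBox (m := m) (t := t) (σ := 0) (η := η) (ε := ε) (by linarith)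
        (by simpa using hε)
      have hUt : shiftedCurve e (fun _ => 0) t ∈ U := by
        refine hsub ⟨t, ?_, rfl⟩
        rcases abs_cases t with ⟨h1, _⟩ | ⟨h1, _⟩
        · exact Or.inr ⟨by linarith, by linarith⟩
        · exact Or.inl ⟨by linarith, by linarith⟩
      rw [shiftedCurve] at hUt
      rw [zero_smul, add_zero] at hmem hUt
      exact ⟨h.box_subset hmem, hUt⟩)
  have hKM : IsCompact (e.symm '' K) :=
    hK.image_of_continuousOn (e.continuousOn_symm.mono fun x hx => (hKV hx).1)
  -- extension of the coordinate functions by zero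
  let φM : ℝ × M → ℝ := fun q => if q.2 ∈ e.source then Φ (q.1, e q.2) else 0
  have hφM0 : ∀ s, |s| < δ → ∀ x ∉ e.symm '' K, φM (s, x) = 0 := by
    intro s hs x hx
    by_cases hxe : x ∈ e.source
    · have : e x ∉ K := fun hK' => hx ⟨e x, hK', e.left_inv hxe⟩
      simp only [φM, if_pos hxe, hΦK s hs _ this]
    · simp only [φM, if_neg hxe]
  have hsm : ContMDiffOn (𝓘(ℝ, ℝ).prod (𝓡 (m + 2))) 𝓘(ℝ, ℝ) ∞ φM (Ioo (-δ) δ ×ˢ univ) := by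
    intro q hq
    refine ContMDiffAt.contMDiffWithinAt ?_
    have hnhds : ∀ᶠ q' : ℝ × M in 𝓝 q, q'.1 ∈ Ioo (-δ) δ :=
      continuous_fst.continuousAt.eventually_mem (isOpen_Ioo.mem_nhds hq.1)
    by_cases hqe : q.2 ∈ e.source
    · have h1 : ContMDiffAt (𝓘(ℝ, ℝ).prod (𝓡 (m + 2))) 𝓘(ℝ, ℝ × Eucl (m + 2)) ∞
          (fun q : ℝ × M => (q.1, e q.2)) q :=
        contMDiffAt_fst.prodMk_space
          ((contMDiffAt_of_mem_maximalAtlas he hqe).comp q contMDiffAt_snd)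
      have h2 : ContMDiffAt 𝓘(ℝ, ℝ × Eucl (m + 2)) 𝓘(ℝ, ℝ) ∞ Φ (q.1, e q.2) :=
        (hΦ.contDiffAt ((isOpen_Ioo.prod isOpen_univ).mem_nhds
          (mk_mem_prod hq.1 (mem_univ _)))).contMDiffAt
      refine (ContMDiffAt.comp q h2 h1).congr_of_eventuallyEq ?_
      filter_upwards [continuous_snd.continuousAt.eventually_mem (e.open_source.mem_nhds hqe)]
        with q' hq'
      simp only [φM, if_pos hq', Function.comp_apply]
    · have hqK : q.2 ∉ e.symm '' K := by
        rintro ⟨x, hx, hxq⟩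
        exact hqe (hxq ▸ e.map_target (hKV hx).1)
      refine (contMDiffAt_const (c := (0 : ℝ))).congr_of_eventuallyEq ?_
      filter_upwards [hnhds, continuous_snd.continuousAt.eventually_mem
        (hKM.isClosed.isOpen_compl.mem_nhds hqK)] with q' hq1 hq2
      exact hφM0 q'.1 (abs_lt.2 hq1) q'.2 hq2
  have hslice : ∀ s, |s| < δ → ContMDiff (𝓡 (m + 2)) 𝓘(ℝ, ℝ) ∞ fun x => φM (s, x) := by
    intro s hs
    rw [← contMDiffOn_univ]
    exact hsm.comp (f := fun x : M => (s, x)) (contMDiff_const.prodMk contMDiff_id).contMDiffOn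
      (fun x _ => mk_mem_prod (abs_lt.1 hs) (mem_univ x))
  let φ : ℝ → C^∞⟮𝓡 (m + 2), M; 𝓘(ℝ, ℝ), ℝ⟯ := fun s =>
    if hs : |s| < δ then ⟨fun x => φM (s, x), hslice s hs⟩ else 0
  have hφ : ∀ s, |s| < δ → ∀ x, φ s x = φM (s, x) := fun s hs x => by
    have : φ s = ⟨fun x => φM (s, x), hslice s hs⟩ := dif_pos hs
    rw [this]; rfl
  refine ⟨δ, hδ, hδδ, φ, ?_, ?_, ⟨e.symm '' K, hKM, ?_, fun s hs => ?_⟩, fun s hs => ?_⟩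
  · ext x
    rw [hφ 0 (by simpa using hδ)]
    simp only [φM, hΦ0, ite_self]
    rfl
  · exact hsm.congr fun q hq => hφ q.1 (abs_lt.2 hq.1) q.2
  · rintro _ ⟨x, hx, rfl⟩
    exact (hKV hx).2
  · refine closure_minimal (fun x hx => ?_) hKM.isClosed
    by_contra hxK
    exact hx ((hφ s hs x).trans (hφM0 s hs x hxK))
  · have hc := fun t (ht : t ∈ Icc (-(2 * η)) (2 * η)) => hΦc s t hs (abs_le.2 ht)
    refine ⟨fun t ht => ⟨_, (hc t ht).1, rfl⟩, ?_⟩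
    refine isGeodesicOn_conformal hF he hη hu (hs.trans_le hδδ)
      (fun t ht => h.box_subset (hc t ht).1) (f := fun x => Φ (s, x)) ?_ (fun x hx => ?_)
      (fun t ht => (hc t ht).2.1) (fun t ht => (hc t ht).2.2)
    · rw [← contDiffOn_univ]
      exact hΦ.comp (f := fun x => (s, x)) (contDiff_prodMk_right s).contDiffOn
        (fun x _ => mk_mem_prod (abs_lt.1 hs) (mem_univ x))
    · rw [hφ s hs]
      simp only [φM, if_pos (e.map_target hx), e.right_inv hx]

end Perturbation

/-! ### Geodesic coordinates along a hypersurface -/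

section GeodesicCoordinates

/-- Two vectors that are orthonormal for an inner product `B` extend to an orthonormal basis. The
form `B` is not the inner product of an instance on `V`, so the basis is a plain `Module.Basis`. -/
theorem exists_basis_of_bilinear {V : Type*} [AddCommGroup V] [Module ℝ V] {m : ℕ}
    (hV : Module.finrank ℝ V = m + 2) (B : V →ₗ[ℝ] V →ₗ[ℝ] ℝ)
    (hsymm : ∀ x y, B x y = B y x) (hpos : ∀ x, x ≠ 0 → 0 < B x x) {v w : V}
    (hv : B v v = 1) (hw : B w w = 1) (hvw : B v w = 0) :
    ∃ b : Module.Basis (Fin (m + 2)) ℝ V, b 0 = v ∧ b 1 = w ∧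
      ∀ i j, B (b i) (b j) = if i = j then 1 else 0 := by
  let core : InnerProductSpace.Core ℝ V :=
    { inner := fun x y => B x y
      conj_inner_symm := fun x y => by simpa using hsymm y x
      re_inner_nonneg := fun x => by
        by_cases hx : x = 0
        · simp [hx]
        · simpa using (hpos x hx).le
      add_left := fun x y z => by simp
      smul_left := fun x y r => by simp
      definite := fun x hx => by
        by_contra hne
        exact (hpos x hne).ne' hx }
  let : NormedAddCommGroup V := core.toNormedAddCommGroup
  let : InnerProductSpace ℝ V := InnerProductSpace.ofCore core.toCore
  have hinner : ∀ x y : V, inner ℝ x y = B x y := fun x y => rfl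
  have hfin : FiniteDimensional ℝ V := Module.finite_of_finrank_pos (by omega)
  let z : Fin (m + 2) → V := fun i => if i = 0 then v else w
  have hz : Orthonormal ℝ (({0, 1} : Set (Fin (m + 2))).domRestrict z) := by
    rw [orthonormal_iff_ite]
    rintro ⟨i, hi⟩ ⟨j, hj⟩
    change B (z i) (z j) = _
    rcases hi with rfl | rfl <;> rcases hj with rfl | rfl <;>
      simp [z, hv, hw, hvw, hsymm w v, Subtype.ext_iff]
  obtain ⟨b, hb⟩ := hz.exists_orthonormalBasis_extension_of_card_eq (by simp [hV])
  refine ⟨b.toBasis, ?_, ?_, fun i j => ?_⟩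
  · simpa [z] using hb 0 (by simp)
  · simpa [z] using hb 1 (by simp)
  · have := (orthonormal_iff_ite.1 b.orthonormal) i j
    simpa [hinner] using this

variable {E : Type*} [NormedAddCommGroup E] [NormedSpace ℝ E] [FiniteDimensional ℝ E]
  {L : E × E → ℝ} {Ω : Set E}

/-- The local flow of the geodesic spray, which preserves the energy. -/
theorem exists_geodesic_flow (hL : IsFinslerLagrangian L Ω) {x₀ v₀ : E} (hx₀ : x₀ ∈ Ω)
    (hv₀ : v₀ ≠ 0) :
    ∃ r : ℝ, 0 < r ∧ ∃ Θ : ℝ → E × E → E × E,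
      ContDiffOn ℝ ∞ (fun q : ℝ × (E × E) => Θ q.1 q.2)
        (Ioo (-r) r ×ˢ Metric.ball (x₀, v₀) r) ∧
      ∀ z ∈ Metric.ball (x₀, v₀) r, Θ 0 z = z ∧
        ∀ t ∈ Ioo (-r) r, Θ t z ∈ Ω ×ˢ ({0}ᶜ : Set E) ∧
          HasDerivAt (fun τ => Θ τ z) ((Θ t z).2, spray L (Θ t z)) t ∧ L (Θ t z) = L z := by
  have hf : ContDiffOn ℝ ∞ (fun q : E × E => (q.2, spray L q)) (Ω ×ˢ {0}ᶜ) :=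
    contDiffOn_snd.prodMk hL.contDiffOn_spray
  obtain ⟨r, hr, Θ, hΘ, hflow⟩ := exists_smooth_flow hL.isOpen_slit hf
    (mk_mem_prod hx₀ hv₀ : (x₀, v₀) ∈ Ω ×ˢ ({0}ᶜ : Set E))
  refine ⟨r, hr, Θ, hΘ, fun z hz => ⟨(hflow z hz).1, fun t ht => ?_⟩⟩
  refine ⟨((hflow z hz).2 t ht).1, ((hflow z hz).2 t ht).2, ?_⟩
  -- the energy is constant along solutions
  have hd : ∀ τ ∈ Ioo (-r) r, HasDerivAt (fun τ => L (Θ τ z)) 0 τ := by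
    intro τ hτ
    obtain ⟨h1, h2⟩ := (hflow z hz).2 τ hτ
    have h3 := (hL.hasFDerivAt h1.1 h1.2).comp_hasDerivAt τ h2
    have h4 : fderiv ℝ L ((Θ τ z).1, (Θ τ z).2) ((Θ τ z).2, spray L (Θ τ z)) = 0 := by
      rw [← hL.eulerLagrange_self h1.1 h1.2,
        show spray L (Θ τ z) = spray L ((Θ τ z).1, (Θ τ z).2) from rfl,
        hL.eulerLagrange_spray h1.1 h1.2]
      rfl
    exact h3.congr_deriv h4
  have h0 : (0 : ℝ) ∈ Ioo (-r) r := ⟨by linarith, hr⟩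
  have := isOpen_Ioo.is_const_of_deriv_eq_zero isPreconnected_Ioo
    (fun τ hτ => (hd τ hτ).differentiableAt.differentiableWithinAt)
    (fun τ hτ => (hd τ hτ).deriv) ht h0
  simpa [(hflow z hz).1] using this

variable {m : ℕ} {L : Eucl (m + 2) × Eucl (m + 2) → ℝ} {Ω : Set (Eucl (m + 2))}

/-- Coordinates built from the geodesics that start, with unit speed and direction `b 0`, on the
hypersurface spanned by the geodesic in direction `b 1` and the remaining directions `b i`. -/
theorem exists_geodesic_coordinates (hL : IsFinslerLagrangian L Ω) {x₀ : Eucl (m + 2)}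
    (hx₀ : x₀ ∈ Ω) {b : Fin (m + 2) → Eucl (m + 2)} (hb0 : b 0 ≠ 0) (hb1 : b 1 ≠ 0)
    (hunit : 2 * L (x₀, b 0) = 1) :
    ∃ ρ : ℝ, 0 < ρ ∧ ∃ ξ : Eucl (m + 2) → Eucl (m + 2),
      ContDiffOn ℝ ∞ ξ (Metric.ball 0 ρ) ∧ ξ 0 = x₀ ∧ (∀ i, fderiv ℝ ξ 0 (stdVec i) = b i) ∧
      (∀ x ∈ Metric.ball 0 ρ, ξ x ∈ Ω) ∧
      (∀ x : Eucl (m + 2), x 0 = 0 → ∃ c : ℝ → Eucl (m + 2) × Eucl (m + 2),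
        ∀ t : ℝ, x + t • stdVec 0 ∈ Metric.ball 0 ρ → ξ (x + t • stdVec 0) = (c t).1 ∧
          c t ∈ Ω ×ˢ {0}ᶜ ∧ HasDerivAt c ((c t).2, spray L (c t)) t ∧ 2 * L (c t) = 1) ∧
      ∃ c : ℝ → Eucl (m + 2) × Eucl (m + 2),
        ∀ t : ℝ, t • stdVec 1 ∈ Metric.ball (0 : Eucl (m + 2)) ρ → ξ (t • stdVec 1) = (c t).1 ∧
          c t ∈ Ω ×ˢ {0}ᶜ ∧ HasDerivAt c ((c t).2, spray L (c t)) t := by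
  obtain ⟨r, hr, Θ, hΘ, hflow⟩ := exists_geodesic_flow hL hx₀ hb0
  obtain ⟨r₁, hr₁, Θ₁, hΘ₁, hflow₁⟩ := exists_geodesic_flow hL hx₀ hb1
  have hz₁ : (x₀, b 1) ∈ Metric.ball (x₀, b 1) r₁ := Metric.mem_ball_self hr₁
  let κ : ℝ → Eucl (m + 2) := fun s => (Θ₁ s (x₀, b 1)).1
  have hκ : ContDiffOn ℝ ∞ κ (Ioo (-r₁) r₁) :=
    contDiff_fst.comp_contDiffOn (hΘ₁.comp (f := fun s : ℝ => (s, (x₀, b 1)))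
      (contDiff_id.prodMk contDiff_const).contDiffOn (fun s hs => mk_mem_prod hs hz₁))
  have hκ0 : κ 0 = x₀ := by simp only [κ, (hflow₁ _ hz₁).1]
  -- the hypersurface and the unit initial velocities
  let h : Eucl (m + 2) → Eucl (m + 2) := fun x => κ (x 1) + ∑ j : Fin m, x j.succ.succ • b j.succ.succ
  let V : Eucl (m + 2) → Eucl (m + 2) := fun x => (1 / √(2 * L (h x, b 0))) • b 0
  let D₁ : Set (Eucl (m + 2)) := (fun x => x 1) ⁻¹' Ioo (-r₁) r₁
  have hD₁ : IsOpen D₁ := isOpen_Ioo.preimage (contDiff_coord 1).continuous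
  have hh : ContDiffOn ℝ ∞ h D₁ :=
    (hκ.comp (contDiff_coord 1).contDiffOn (fun x hx => hx)).add
      (ContDiff.contDiffOn (ContDiff.sum fun j _ => (contDiff_coord _).smul contDiff_const))
  let D₂ : Set (Eucl (m + 2)) := D₁ ∩ h ⁻¹' Ω
  have hD₂ : IsOpen D₂ := hh.continuousOn.isOpen_inter_preimage hD₁ hL.isOpen
  have hLpos : ∀ x ∈ D₂, 0 < 2 * L (h x, b 0) := fun x hx => by
    have := hL.pos _ hx.2 _ hb0
    positivity
  have hV : ContDiffOn ℝ ∞ V D₂ := by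
    have h1 : ContDiffOn ℝ ∞ (fun x => 2 * L (h x, b 0)) D₂ :=
      contDiffOn_const.mul (hL.smooth.comp ((hh.mono inter_subset_left).prodMk contDiffOn_const)
        (fun x hx => mk_mem_prod hx.2 hb0))
    exact (contDiffOn_const.div (h1.sqrt fun x hx => (hLpos x hx).ne')
      (fun x hx => (Real.sqrt_pos.2 (hLpos x hx)).ne')).smul contDiffOn_const
  have hVunit : ∀ x ∈ D₂, 2 * L (h x, V x) = 1 := fun x hx => by
    have hp := hLpos x hx
    have hp' : L (h x, b 0) ≠ 0 := by intro h0; simp [h0] at hp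
    rw [hL.homogeneous _ hx.2 _ _ (one_div_pos.2 (Real.sqrt_pos.2 hp)), one_div, inv_pow,
      Real.sq_sqrt hp.le]
    field_simp
  let Z : Eucl (m + 2) → ℝ × (Eucl (m + 2) × Eucl (m + 2)) := fun x => (x 0, (h x, V x))
  have hZ : ContDiffOn ℝ ∞ Z D₂ :=
    (contDiff_coord 0).contDiffOn.prodMk ((hh.mono inter_subset_left).prodMk hV)
  let D : Set (Eucl (m + 2)) := D₂ ∩ Z ⁻¹' (Ioo (-r) r ×ˢ Metric.ball (x₀, b 0) r)
  have hD : IsOpen D :=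
    hZ.continuousOn.isOpen_inter_preimage hD₂ (isOpen_Ioo.prod Metric.isOpen_ball)
  have hh0 : h 0 = x₀ := by simp [h, hκ0]
  have hV0 : V 0 = b 0 := by
    simp only [V, hh0, hunit]; simp
  have h0D : (0 : Eucl (m + 2)) ∈ D := by
    refine ⟨⟨?_, ?_⟩, ?_⟩
    · simpa [D₁] using hr₁
    · rw [mem_preimage, hh0]; exact hx₀
    · refine mk_mem_prod ?_ ?_
      · simpa [Z] using hr
      · simpa [Z, hh0, hV0] using hr
  let ξ : Eucl (m + 2) → Eucl (m + 2) := fun x => (Θ (x 0) (h x, V x)).1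
  have hξ : ContDiffOn ℝ ∞ ξ D :=
    contDiff_fst.comp_contDiffOn (hΘ.comp (hZ.mono inter_subset_left) (fun x hx => hx.2))
  obtain ⟨ρ, hρ, hball⟩ := Metric.isOpen_iff.1 hD 0 h0D
  have hξ0 : ∀ x ∈ D, x 0 = 0 → ξ x = h x := fun x hx hx0 => by
    simp only [ξ, hx0, (hflow (h x, V x) hx.2.2).1]
  -- the hypersurface map does not depend on the first coordinate
  have hshift : ∀ (x : Eucl (m + 2)) (t : ℝ), h (x + t • stdVec 0) = h x := fun x t => by
    simp [h]
  have hshiftV : ∀ (x : Eucl (m + 2)) (t : ℝ), V (x + t • stdVec 0) = V x := fun x t => by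
    simp only [V, hshift]
  have hline : ∀ (x : Eucl (m + 2)) (t : ℝ), x 0 = 0 →
      ξ (x + t • stdVec 0) = (Θ t (h x, V x)).1 := fun x t hx => by
    simp only [ξ, hshift, hshiftV]
    simp [hx]
  have hcross : ∀ t : ℝ, h (t • stdVec 1) = κ t := fun t => by
    have : ∀ j : Fin m, (j.succ.succ : Fin (m + 2)) ≠ 1 := fun j => by
      rw [← Fin.succ_zero_eq_one, Ne, Fin.succ_inj]; exact Fin.succ_ne_zero j
    simp [h, this]
  refine ⟨ρ, hρ, ξ, hξ.mono hball, (hξ0 0 h0D rfl).trans hh0, fun i => ?_, fun x hx => ?_,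
    fun x hx0 => ⟨fun t => Θ t (h x, V x), fun t ht => ?_⟩,
    fun t => Θ₁ t (x₀, b 1), fun t ht => ?_⟩
  · -- the partial derivatives at the origin
    have hdiff : HasFDerivAt ξ (fderiv ℝ ξ 0) 0 :=
      ((hξ.contDiffAt (hD.mem_nhds h0D)).differentiableAt (by simp)).hasFDerivAt
    have hld : HasDerivAt (fun t : ℝ => ξ (t • stdVec i)) (fderiv ℝ ξ 0 (stdVec i)) 0 := by
      simpa [HasLineDerivAt] using hdiff.hasLineDerivAt (stdVec i)
    have hnear : ∀ᶠ t : ℝ in 𝓝 0, t • (stdVec i : Eucl (m + 2)) ∈ D := by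
      have hc : ContinuousAt (fun t : ℝ => t • (stdVec i : Eucl (m + 2))) 0 := by fun_prop
      exact hc.eventually_mem (by rw [zero_smul]; exact hD.mem_nhds h0D)
    refine hld.unique ?_
    clear hld
    revert hnear
    refine Fin.cases (fun hnear => ?_) (fun i => Fin.cases (fun hnear => ?_) (fun j hnear => ?_) i) i
    · have hz : (x₀, b 0) ∈ Metric.ball (x₀, b 0) r := Metric.mem_ball_self hr
      have h1 := ((hflow _ hz).2 0 ⟨by linarith, hr⟩).2.1
      rw [(hflow _ hz).1] at h1
      have h2 : HasDerivAt (fun t => (Θ t (x₀, b 0)).1) (b 0) 0 := h1.fst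
      refine h2.congr_of_eventuallyEq (Eventually.of_forall fun t => ?_)
      have := hline 0 t rfl
      rwa [zero_add, hh0, hV0] at this
    · have h1 := ((hflow₁ _ hz₁).2 0 ⟨by linarith, hr₁⟩).2.1
      rw [(hflow₁ _ hz₁).1] at h1
      have h2 : HasDerivAt κ (b 1) 0 := h1.fst
      refine h2.congr_of_eventuallyEq ?_
      filter_upwards [hnear] with t ht
      exact (hξ0 _ ht (by simp)).trans (hcross t)
    · have h2 : HasDerivAt (fun t : ℝ => x₀ + t • b j.succ.succ) (b j.succ.succ) 0 := by
        simpa using ((hasDerivAt_id (0 : ℝ)).smul_const (b j.succ.succ)).const_add x₀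
      refine h2.congr_of_eventuallyEq ?_
      filter_upwards [hnear] with t ht
      have hj : (1 : Fin (m + 2)) ≠ j.succ.succ := by
        rw [← Fin.succ_zero_eq_one, Ne, Fin.succ_inj]; exact (Fin.succ_ne_zero j).symm
      refine (hξ0 _ ht (by simp [(Fin.succ_ne_zero _).symm])).trans ?_
      simp [h, hj, hκ0, ite_smul]
  · exact ((hflow _ (hball hx).2.2).2 _ (hball hx).2.1).1.1
  · have hxD := hball ht
    have hx1 := hxD.1
    have hx2 := hxD.2.1
    have hx3 := hxD.2.2
    simp only [Z, hshift, hshiftV] at hx2 hx3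
    have hxt : (x + t • stdVec 0 : Eucl (m + 2)) 0 = t := by simp [hx0]
    rw [hxt] at hx2
    obtain ⟨h1, h2, h3⟩ := (hflow _ hx3).2 t hx2
    refine ⟨hline x t hx0, h1, h2, ?_⟩
    have h4 := hVunit _ hx1
    rw [hshift, hshiftV] at h4
    rw [h3, h4]
  · have hxD := hball ht
    have ht1 : t ∈ Ioo (-r₁) r₁ := by simpa [D₁] using hxD.1.1
    obtain ⟨h1, h2, -⟩ := (hflow₁ _ hz₁).2 t ht1
    exact ⟨(hξ0 _ hxD (by simp)).trans (hcross t), h1, h2⟩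

end GeodesicCoordinates

/-! ### Existence of adapted charts -/

section AdaptedChart

/-- Solutions of the geodesic spray equation are geodesics. -/
theorem isGeodesicOn_of_spray {n : ℕ} {M : Type*} [TopologicalSpace M] [ChartedSpace (Eucl n) M]
    [IsManifold (𝓡 n) ∞ M] {F : ∀ x : M, TangentSpace (𝓡 n) x → ℝ}
    {e : OpenPartialHomeomorph M (Eucl n)} (hF : IsFinslerMetric F)
    (he : e ∈ IsManifold.maximalAtlas (𝓡 n) ∞ M) {I : Set ℝ} (hI : UniqueDiffOn ℝ I)
    {x : ℝ → Eucl n} (hx : ContDiffOn ℝ ∞ x I) {c : ℝ → Eucl n × Eucl n}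
    (hxc : ∀ t ∈ I, x t = (c t).1) (hc : ∀ t ∈ I, c t ∈ e.target ×ˢ ({0}ᶜ : Set (Eucl n)))
    (hd : ∀ t ∈ I, HasDerivAt c ((c t).2, spray (chartLagrangian F e) (c t)) t) :
    (∀ t ∈ I, derivWithin x I t = (c t).2) ∧ IsGeodesicOn F (fun t => e.symm (x t)) I := by
  have hL := isFinslerLagrangian_chartLagrangian hF he
  have hx1 : ∀ t ∈ I, derivWithin x I t = (c t).2 := fun t ht => by
    have h1 : HasDerivAt (fun τ => (c τ).1) (c t).2 t := (hd t ht).fst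
    exact (h1.hasDerivWithinAt.congr hxc (hxc t ht)).derivWithin (hI t ht)
  have hx2 : ∀ t ∈ I, derivWithin (derivWithin x I) I t =
      spray (chartLagrangian F e) ((c t).1, (c t).2) := fun t ht => by
    have h1 : HasDerivAt (fun τ => (c τ).2) (spray (chartLagrangian F e) (c t)) t := (hd t ht).snd
    exact (h1.hasDerivWithinAt.congr hx1 (hx1 t ht)).derivWithin (hI t ht)
  refine ⟨hx1, isGeodesicOn_of_eulerLagrange hF he hI hx (fun t ht => ?_) (fun t ht => ?_)
    (fun t ht => ?_)⟩
  · rw [hxc t ht]; exact (hc t ht).1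
  · rw [hx1 t ht]; exact (hc t ht).2
  · rw [hx2 t ht, hx1 t ht, hxc t ht]
    exact hL.eulerLagrange_spray (hc t ht).1 (hc t ht).2

/-- Tangent vectors at equal points that agree as vectors of the model space are equal. -/
theorem totalSpace_mk_congr {n : ℕ} {M : Type*} [TopologicalSpace M] [ChartedSpace (Eucl n) M]
    {a b : M} (h : a = b) {y : TangentSpace (𝓡 n) a} {z : TangentSpace (𝓡 n) b}
    (hyz : (y : Eucl n) = (z : Eucl n)) :
    (⟨a, y⟩ : TangentBundle (𝓡 n) M) = ⟨b, z⟩ := by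
  subst h
  exact congrArg _ hyz

variable {m : ℕ}

theorem norm_lt_of_mem_tubeBox {η ε ρ : ℝ} (hη : 0 < η) (hε : 0 < ε) (hη' : η ≤ ρ / 3)
    (hε' : ε ≤ ρ / 3) {x : Eucl (m + 2)} (hx : x ∈ tubeBox m η ε) : x ∈ Metric.ball 0 ρ := by
  have hρ : 0 < ρ := by linarith
  rw [mem_ball_zero_iff, EuclideanSpace.norm_eq, Real.sqrt_lt' hρ, Fin.sum_univ_succ]
  have h1 : ‖x 0‖ ^ 2 ≤ (2 * η) ^ 2 := by
    rw [Real.norm_eq_abs]; exact pow_le_pow_left₀ (abs_nonneg _) hx.1 2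
  have h2 : ∑ i : Fin (m + 1), ‖x i.succ‖ ^ 2 < ε ^ 2 := by
    simpa only [Real.norm_eq_abs, sq_abs] using hx.2
  nlinarith

variable {M : Type*} [TopologicalSpace M] [ChartedSpace (Eucl (m + 2)) M]
  [IsManifold (𝓡 (m + 2)) ∞ M] {F : ∀ x : M, TangentSpace (𝓡 (m + 2)) x → ℝ}

/-- Adapted charts exist around the point with coordinates `x₀` in a given chart. -/
theorem exists_isAdaptedChart_of_chart (hF : IsFinslerMetric F)
    {e₀ : OpenPartialHomeomorph M (Eucl (m + 2))}
    (he₀ : e₀ ∈ IsManifold.maximalAtlas (𝓡 (m + 2)) ∞ M) {x₀ : Eucl (m + 2)} (hx₀ : x₀ ∈ e₀.target)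
    (v w : TangentSpace (𝓡 (m + 2)) (e₀.symm x₀)) (hv : F (e₀.symm x₀) v = 1)
    (hw : fundTensor (F (e₀.symm x₀)) v w w = 1) (hvw : fundTensor (F (e₀.symm x₀)) v v w = 0) :
    ∃ e : OpenPartialHomeomorph M (Eucl (m + 2)), ∃ r : ℝ, 0 < r ∧
      ∀ η ε : ℝ, 0 < η → η ≤ r → 0 < ε → ε ≤ r → IsAdaptedChart F (e₀.symm x₀) v w e η ε := by
  set L := chartLagrangian F e₀ with hLdef
  have hL : IsFinslerLagrangian L e₀.target := isFinslerLagrangian_chartLagrangian hF he₀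
  -- coordinates of `v` and `w`
  have hsurj := (mdifferentiable_of_mem_maximalAtlas he₀).symm.mfderiv_surjective hx₀
  obtain ⟨v₀, rfl⟩ := hsurj v
  obtain ⟨w₀, rfl⟩ := hsurj w
  change Eucl (m + 2) at v₀ w₀
  rw [← fundTensor_coordF] at hw hvw
  change coordF F e₀ x₀ v₀ = 1 at hv
  have hv₀ : v₀ ≠ 0 := by
    rintro rfl
    have h1 := hL.homogeneous x₀ hx₀ 0 2 two_pos
    rw [smul_zero, hLdef, chartLagrangian, hv] at h1
    norm_num at h1
  have hw₀ : w₀ ≠ 0 := by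
    rintro rfl
    simp [fundTensor] at hw
  have hB : ∀ u w, fundTensor (coordF F e₀ x₀) v₀ u w = fderiv ℝ (fderiv ℝ L) (x₀, v₀) (0, u) (0, w) :=
    fundTensor_eq_fderiv hL.isOpen hL.smooth hx₀ (fun _ => rfl) hv₀
  have hunit : 2 * L (x₀, v₀) = 1 := by simp [hLdef, chartLagrangian, hv]
  -- an orthonormal frame that extends `v, w`
  let B : Eucl (m + 2) →ₗ[ℝ] Eucl (m + 2) →ₗ[ℝ] ℝ :=
    LinearMap.mk₂ ℝ (fun u w => verticalHessian L (x₀, v₀) u w) (fun _ _ _ => by simp)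
      (fun _ _ _ => by simp) (fun _ _ _ => by simp) (fun _ _ _ => by simp)
  have hBapp : ∀ u w, B u w = fderiv ℝ (fderiv ℝ L) (x₀, v₀) (0, u) (0, w) := fun u w =>
    verticalHessian_apply L (x₀, v₀) u w
  obtain ⟨b, hb0, hb1, hb⟩ := exists_basis_of_bilinear (m := m) (V := Eucl (m + 2)) (by simp) B
    (fun x y => by rw [hBapp, hBapp, hL.fderiv_fderiv_vertical_comm hx₀ hv₀])
    (fun x hx => by rw [hBapp]; exact hL.legendre x₀ hx₀ v₀ x hv₀ hx) (v := v₀) (w := w₀)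
    (by rw [hBapp, hL.vertical_hessian_self hx₀ hv₀, hL.fderiv_vertical_self hx₀ hv₀, hunit])
    (by rw [hBapp, ← hB, hw]) (by rw [hBapp, ← hB, hvw])
  obtain ⟨ρ, hρ, ξ, hξ, hξ0, hξd, hξΩ, hξl, hξc⟩ := exists_geodesic_coordinates hL hx₀ (b := b)
    (by rwa [hb0]) (by rwa [hb1]) (by rwa [hb0])
  -- the geodesic coordinates form a chart
  let T : Eucl (m + 2) ≃L[ℝ] Eucl (m + 2) :=
    ((EuclideanSpace.basisFun (Fin (m + 2)) ℝ).toBasis.equiv b (Equiv.refl _)).toContinuousLinearEquiv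
  have hT : ∀ i, T (stdVec i) = b i := fun i => by
    have := (EuclideanSpace.basisFun (Fin (m + 2)) ℝ).toBasis.equiv_apply i b (Equiv.refl _)
    simpa [T] using this
  have hfd : fderiv ℝ ξ 0 = T := by
    ext1 z
    rw [← sum_smul_stdVec z, map_sum, map_sum]
    refine Finset.sum_congr rfl fun i _ => ?_
    rw [map_smul, map_smul, hξd i]
    congr 1
    exact (hT i).symm
  have h0ball : (0 : Eucl (m + 2)) ∈ Metric.ball 0 ρ := Metric.mem_ball_self hρ
  have hξdiff : HasFDerivAt ξ (T : Eucl (m + 2) →L[ℝ] Eucl (m + 2)) 0 := by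
    rw [← hfd]
    exact ((hξ.contDiffAt (Metric.isOpen_ball.mem_nhds h0ball)).differentiableAt
      (by simp)).hasFDerivAt
  obtain ⟨k, h0k, hkball, hkξ, hk, hksymm⟩ :=
    exists_smooth_localInverse Metric.isOpen_ball h0ball hξ T hξdiff
  let e : OpenPartialHomeomorph M (Eucl (m + 2)) := e₀.trans k.symm
  have hesymm : ∀ x, e.symm x = e₀.symm (ξ x) := fun x => by
    change e₀.symm (k x) = _; rw [hkξ]
  have htarget : e.target = k.source := by
    ext x
    simp only [e, OpenPartialHomeomorph.trans_target, OpenPartialHomeomorph.symm_target, mem_inter_iff,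
      mem_preimage, OpenPartialHomeomorph.symm_symm, and_iff_left_iff_imp]
    intro hx
    rw [hkξ]; exact hξΩ x (hkball hx)
  have he : e ∈ IsManifold.maximalAtlas (𝓡 (m + 2)) ∞ M := by
    refine e.mem_maximalAtlas_of_contMDiffOn ?_ ?_
    · exact (contMDiffOn_iff_contDiffOn.2 hksymm).comp
        ((contMDiffOn_of_mem_maximalAtlas he₀).mono fun x hx => hx.1) (fun x hx => hx.2)
    · refine ((contMDiffOn_symm_of_mem_maximalAtlas he₀).comp (contMDiffOn_iff_contDiffOn.2
        (hξ.mono hkball)) (fun x hx => hξΩ x (hkball hx))).mono htarget.le |>.congr fun x _ => ?_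
      exact hesymm x
  have h0e : (0 : Eucl (m + 2)) ∈ e.target := by rw [htarget]; exact h0k
  have h0e' : e.symm 0 ∈ e₀.source := by rw [hesymm, hξ0]; exact e₀.map_target hx₀
  have htr : ∀ x ∈ e.target, transition e e₀ x = ξ x := fun x hx => by
    rw [transition, hesymm, e₀.right_inv (hξΩ x (hkball (htarget ▸ hx)))]
  have htr0 : transition e e₀ 0 = x₀ := (htr 0 h0e).trans hξ0
  have htrd : fderiv ℝ (transition e e₀) 0 = T := by
    have : transition e e₀ =ᶠ[𝓝 0] ξ := by
      filter_upwards [e.open_target.mem_nhds h0e] with x hx using htr x hx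
    rw [this.fderiv_eq, hfd]
  have hvec : ∀ i, (⟨e.symm 0, mfderiv (𝓡 (m + 2)) (𝓡 (m + 2)) e.symm 0 (stdVec i)⟩ :
      TangentBundle (𝓡 (m + 2)) M) =
        ⟨e₀.symm x₀, mfderiv (𝓡 (m + 2)) (𝓡 (m + 2)) e₀.symm x₀ (b i)⟩ := fun i => by
    refine totalSpace_mk_congr (by rw [hesymm, hξ0]) ?_
    have h1 := mfderiv_symm_transition he he₀ h0e h0e' (stdVec i)
    rw [htrd, htr0] at h1
    rw [← hT i]
    exact h1
  obtain ⟨ρ', hρ', hball'⟩ := Metric.isOpen_iff.1 e.open_target 0 h0e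
  refine ⟨e, ρ' / 3, by positivity, fun η ε hη hηr hε hεr => ?_⟩
  have hbox : tubeBox m η ε ⊆ e.target := fun x hx =>
    hball' (norm_lt_of_mem_tubeBox hη hε hηr hεr hx)
  have hbox' : tubeBox m η ε ⊆ Metric.ball 0 ρ := fun x hx => hkball (htarget ▸ hbox hx)
  refine ⟨he, hbox, ?_, ⟨1, ?_⟩, ?_, fun x hx hx0 => ?_, ?_⟩
  · rw [hvec 0, hb0]
  · rw [hvec 1, hb1, one_smul]
  · ext i j
    have h1 : ∀ y, coordF F e 0 y = coordF F e₀ x₀ (T y) := fun y => by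
      have := coordF_transition (F := F) he he₀ h0e h0e' y
      rwa [htrd, htr0] at this
    have h2 : fundTensor (coordF F e 0) (stdVec 0) (stdVec i) (stdVec j) =
        fundTensor (coordF F e₀ x₀) (T (stdVec 0)) (T (stdVec i)) (T (stdVec j)) := by
      simp only [fundTensor, h1, map_add, map_smul]
    rw [metricCoeff, Matrix.of_apply, h2, hT, hT, hT, hb0, hB, ← hBapp, hb, Matrix.one_apply]
  · obtain ⟨c, hc⟩ := hξl x hx0
    have hI : UniqueDiffOn ℝ (Icc (-(2 * η)) (2 * η)) := uniqueDiffOn_Icc (by linarith)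
    have hin : ∀ t ∈ Icc (-(2 * η)) (2 * η), x + t • stdVec 0 ∈ tubeBox m η ε := fun t ht => by
      refine ⟨by simpa [hx0] using abs_le.2 ht, by simpa using hx.2⟩
    have hc' := fun t ht => hc t (hbox' (hin t ht))
    have hsm : ContDiffOn ℝ ∞ (fun t : ℝ => ξ (x + t • stdVec 0)) (Icc (-(2 * η)) (2 * η)) :=
      hξ.comp (by fun_prop) (fun t ht => hbox' (hin t ht))
    have hmem : ∀ t ∈ Icc (-(2 * η)) (2 * η), ξ (x + t • stdVec 0) ∈ e₀.target := fun t ht =>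
      hξΩ _ (hbox' (hin t ht))
    obtain ⟨h1, h2⟩ := isGeodesicOn_of_spray hF he₀ hI hsm (fun t ht => (hc' t ht).1)
      (fun t ht => (hc' t ht).2.1) (fun t ht => (hc' t ht).2.2.1)
    have h3 := (isArcLengthOn_iff (F := F) he₀ hI hsm hmem).2 fun t ht => by
      obtain ⟨e1, e2, -, e4⟩ := hc' t ht
      rw [h1 t ht, e1]
      have e5 : coordF F e₀ (c t).1 (c t).2 ^ 2 = 1 := by
        have : L (c t) = coordF F e₀ (c t).1 (c t).2 ^ 2 / 2 := rfl
        linarith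
      have e6 : 0 < coordF F e₀ (c t).1 (c t).2 :=
        hF.pos _ _ (mfderiv_chart_symm_ne_zero he₀ e2.1 e2.2)
      exact (pow_eq_one_iff_of_nonneg e6.le two_ne_zero).1 e5
    simp only [hesymm]
    exact ⟨h2, h3⟩
  · obtain ⟨c, hc⟩ := hξc
    have hin : ∀ s ∈ Ioo (-ε) ε, s • stdVec 1 ∈ Metric.ball (0 : Eucl (m + 2)) ρ := fun s hs => by
      refine hbox' ?_
      have := add_mem_tubeBox (m := m) (t := 0) (η := η) (by simpa using hη.le) (abs_lt.2 hs)
      rwa [zero_smul, zero_add] at this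
    have hsm : ContDiffOn ℝ ∞ (fun s : ℝ => ξ (s • stdVec 1)) (Ioo (-ε) ε) :=
      hξ.comp (by fun_prop) hin
    simp only [hesymm]
    exact (isGeodesicOn_of_spray hF he₀ isOpen_Ioo.uniqueDiffOn hsm
      (fun s hs => (hc s (hin s hs)).1) (fun s hs => (hc s (hin s hs)).2.1)
      (fun s hs => (hc s (hin s hs)).2.2)).2

/-- Adapted charts exist for all unit vectors `v` and all unit vectors `w` orthogonal to `v`. -/
theorem exists_isAdaptedChart (hF : IsFinslerMetric F) (p : M)
    (v w : TangentSpace (𝓡 (m + 2)) p) (hv : F p v = 1)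
    (hw : fundTensor (F p) v w w = 1) (hvw : fundTensor (F p) v v w = 0) :
    ∃ e : OpenPartialHomeomorph M (Eucl (m + 2)), ∃ r : ℝ, 0 < r ∧
      ∀ η ε : ℝ, 0 < η → η ≤ r → 0 < ε → ε ≤ r → IsAdaptedChart F p v w e η ε := by
  obtain ⟨e₀, he₀, x₀, hx₀, rfl⟩ : ∃ e₀ ∈ IsManifold.maximalAtlas (𝓡 (m + 2)) ∞ M,
      ∃ x₀ ∈ e₀.target, e₀.symm x₀ = p :=
    ⟨chartAt _ p, IsManifold.chart_mem_maximalAtlas p, chartAt _ p p, mem_chart_target _ p,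
      (chartAt _ p).left_inv (mem_chart_source _ p)⟩
  exact exists_isAdaptedChart_of_chart hF he₀ hx₀ v w hv hw hvw

end AdaptedChart

end

theorem lemma1 {m : ℕ} {M : Type*} [TopologicalSpace M] [T2Space M]
    [ChartedSpace (Eucl (m + 2)) M] [IsManifold (𝓡 (m + 2)) ∞ M]
    (F : ∀ x : M, TangentSpace (𝓡 (m + 2)) x → ℝ) (hF : IsFinslerMetric F)
    (p : M) (v w : TangentSpace (𝓡 (m + 2)) p) (hv : F p v = 1)
    (hw : fundTensor (F p) v w w = 1) (hvw : fundTensor (F p) v v w = 0) :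
    -- adapted coordinates exist for all sufficiently small `η` and `ε`
    (∃ e : OpenPartialHomeomorph M (Eucl (m + 2)), ∃ r : ℝ, 0 < r ∧
      ∀ η ε : ℝ, 0 < η → η ≤ r → 0 < ε → ε ≤ r → IsAdaptedChart F p v w e η ε) ∧
    -- and for all adapted coordinates the perturbation exists
    ∀ (e : OpenPartialHomeomorph M (Eucl (m + 2))) (η ε : ℝ), 0 < ε → 7 * ε < η →
      IsAdaptedChart F p v w e η ε →
      ∀ (u : ℝ → ℝ → ℝ) (δ₀ : ℝ), 0 < δ₀ → IsShiftFamily u δ₀ η ε →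
      ∀ U : Set M, IsOpen U →
        shiftedCurve e (fun _ => 0) '' (Icc (-η - 4 * ε) (-η) ∪ Icc η (η + 4 * ε)) ⊆ U →
        ∃ δ : ℝ, 0 < δ ∧ δ ≤ δ₀ ∧ ∃ φ : ℝ → C^∞⟮𝓡 (m + 2), M; 𝓘(ℝ, ℝ), ℝ⟯,
          φ 0 = 0 ∧
          ContMDiffOn (𝓘(ℝ, ℝ).prod (𝓡 (m + 2))) 𝓘(ℝ, ℝ) ∞
            (fun q : ℝ × M => φ q.1 q.2) (Ioo (-δ) δ ×ˢ univ) ∧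
          (∃ K : Set M, IsCompact K ∧ K ⊆ U ∧ ∀ s, |s| < δ → tsupport (φ s) ⊆ K) ∧
          (∀ N ∈ @nhds _ (smoothTopology (m + 2) M) 0,
            ∃ δ' : ℝ, 0 < δ' ∧ ∀ s, |s| < δ' → φ s ∈ N) ∧
          ∀ s, |s| < δ →
            (∀ t ∈ Icc (-(2 * η)) (2 * η),
              shiftedCurve e (u s) t ∈ e.symm '' tubeBox m η ε) ∧
            IsGeodesicOn (conformalMetric (φ s) F) (shiftedCurve e (u s))
              (Icc (-(2 * η)) (2 * η)) ∧
            IsArcLengthOn (conformalMetric (φ s) F) (shiftedCurve e (u s))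
              (Icc (-(2 * η)) (2 * η)) := by
  refine ⟨exists_isAdaptedChart hF p v w hv hw hvw, ?_⟩
  intro e η ε hε h7 h u δ₀ hδ₀ hu U hU hsub
  obtain ⟨δ, hδ, hδδ, φ, hφ0, hφ, hK, hφg⟩ :=
    exists_conformal_perturbation hF hε h7 h hδ₀ hu hU hsub
  refine ⟨δ, hδ, hδδ, φ, hφ0, hφ, hK, fun N hN => ?_, hφg⟩
  rw [← hφ0] at hN
  obtain ⟨δ', hδ', hN'⟩ := Metric.eventually_nhds_iff.1 (tendsto_smoothTopology hδ hφ hN)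
  exact ⟨δ', hδ', fun s hs => hN' (by rwa [Real.dist_0_eq_abs])⟩
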